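/- Let $\psi=\Gamma'/\Gamma$, let $\log$ and all powers be principal, let $\gamma$ be Euler's constant, let $\gamma_1=\lim_{n\to\infty}\big(\sum_{j=1}^n\frac{\log j}{j}-\frac{\log^2 n}{2}\big)$ be the first Stieltjes constant, and let $B_{j}$ be the Bernoulli numbers. For positive real $k,N$ with $k+N>1$, the series $$\mathscr{F}_{k,N}(x)=\sum_{n=1}^{\infty}\frac{\psi(n^{N}x)-\log(n^{N}x)}{n^k}$$ converges absolutely for every $x\in\mathbb{C}\setminus(-\infty,0]$. For positive integers $k,N$ put $\mathscr{B}(k,N,x)=(-1)^{k+N+1}x^{1/N}\zeta\left(1+\frac kN\right)$ if $k=N$ and $\mathscr{B}(k,N,x)=0$ if $k\ne N$. The asymptotic expansions below are in the sense of Poincaré (for every $M\ge0$, truncating the infinite series after $M$ terms leaves an error bounded by a constant times the power of $x$ in the $(M+1)$-th term) and hold as $x\to\infty$, respectively $x\to0$, uniformly in the sector $|\arg x|\le\pi-\delta$, for every fixed $0<\delta<\pi$. For real $k,N>0$ with $k+N>1$, as $x\to\infty$, $$\mathscr{F}_{k,N}(x)\sim-\frac{1}{2x}\zeta(k+N)-\sum_{n=1}^{\infty}\frac{B_{2n}}{2n}\zeta(k+2nN)x^{-2n}.$$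 (i) For integers $k,N$ with $1<k\le N$, as $x\to0$, $$\mathscr{F}_{k,N}(x)\sim-\frac{\zeta(k+N)}{x}-(\gamma+\log x)\zeta(k)+N\zeta'(k)+\frac{\pi}{N}\frac{\zeta\left(1+\frac{k-1}{N}\right)}{\sin\left(\frac{\pi}{N}(k-1)\right)}x^{\frac{k-1}{N}}+x^{\frac{k-1}{N}}\mathscr{B}(k,N,x)+(-1)^k\sum_{m=1}^{\infty}(-1)^{m(N+1)}\zeta(k-mN)\zeta(1+m)x^m.$$ (ii) For every integer $N\ge1$, as $x\to0$, $$\mathscr{F}_{1,N}(x)\sim-\frac{\zeta(N+1)}{x}+\frac1N\left\{\frac{\pi^2}{6}-(N-1)\gamma\log x+\frac12\log^2x-N\gamma^2-(N^2+1)\gamma_1\right\}+\mathscr{B}(1,N,x)-\sum_{m=1}^{\infty}(-1)^{m(N+1)}\zeta(1-mN)\zeta(1+m)x^m.$$ -/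

import Mathlib

open Filter Topology Asymptotics

noncomputable section

namespace Herglotz

/-- The `n`-th term (`n ≥ 1`) of the series defining the extended higher Herglotz function:
`(ψ(n^N x) - log (n^N x)) / n^k`, with `ψ` the digamma function and the principal logarithm. -/
def herglotzTerm (k N : ℝ) (x : ℂ) (n : ℕ) : ℂ :=
  (Complex.digamma (((n : ℝ) ^ N : ℝ) * x) - Complex.log (((n : ℝ) ^ N : ℝ) * x)) /
    (((n : ℝ) ^ k : ℝ) : ℂ)

/-- The extended higher Herglotz function
`𝓕_{k,N}(x) = ∑_{n ≥ 1} (ψ(n^N x) - log (n^N x)) / n^k`. -/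
def herglotzF (k N : ℝ) (x : ℂ) : ℂ := ∑' n : ℕ, herglotzTerm k N x (n + 1)

/-- The function `𝓑(k, N, x)`: equal to `(-1)^(k+N+1) x^(1/N) ζ(1 + k/N)` if `k = N`, and to `0`
otherwise (principal power). -/
def herglotzB (k N : ℕ) (x : ℂ) : ℂ :=
  if k = N then (-1) ^ (k + N + 1) * x ^ (1 / (N : ℂ)) * riemannZeta (1 + (k : ℂ) / (N : ℂ)) else 0

/-- The first Stieltjes constant `γ₁ = lim_{n → ∞} (∑_{j=1}^n (log j)/j - (log n)^2 / 2)`. -/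
def stieltjesOne : ℝ :=
  limUnder atTop fun n : ℕ ↦
    ∑ j ∈ Finset.Icc 1 n, Real.log (j : ℝ) / (j : ℝ) - Real.log (n : ℝ) ^ 2 / 2

/-- The closed subsector `|arg x| ≤ π - δ` of the plane cut along `(-∞, 0]` (vertex removed). -/
def sector (δ : ℝ) : Set ℂ := {x | x ∈ Complex.slitPlane ∧ |x.arg| ≤ Real.pi - δ}

/-- `x → ∞` inside the sector `|arg x| ≤ π - δ`. -/
def sectorAtInfty (δ : ℝ) : Filter ℂ := Bornology.cobounded ℂ ⊓ 𝓟 (sector δ)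

/-- `x → 0` inside the sector `|arg x| ≤ π - δ`. -/
def sectorAtZero (δ : ℝ) : Filter ℂ := 𝓝[sector δ] 0

/-- `f ~ h + ∑_{m ≥ 1} a m * φ m` along `l`, in the sense of Poincaré, for an asymptotic scale
`φ 1, φ 2, …`: for every `M ≥ 0`, truncating the series after `M` terms leaves an error
`O(φ (M + 1))`. -/
def HasAsymptoticSeries (l : Filter ℂ) (f h : ℂ → ℂ) (a : ℕ → ℂ) (φ : ℕ → ℂ → ℂ) : Prop :=
  ∀ M : ℕ, (fun x ↦ f x - (h x + ∑ m ∈ Finset.Icc 1 M, a m * φ m x)) =O[l] φ (M + 1)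

end Herglotz

end

namespace Herglotz

/-! Everything rests on ψ(z) ~ log z + ∑ ζ(1-m) z^(-m), uniformly in sectors
(`exists_norm_digamma_sub_le`). The defect of the truncated series in the recurrence ψ(z+1) - ψ(z) =
1/z is a power series in 1/z whose low coefficients vanish by the Bernoulli recursion, and Gauss's
limit writes the error as the sum of these defects over z, z+1, z+2, .... Putting z = n^N x,
dividing by n^k and summing over n gives the expansion at infinity.

At zero with k ≥ 2, the partial fractions of ψ(z+1) turn the function into an absolutely convergent
double series. Summed over n first, it becomes ∑_j S(j/x)/j with S(W) = ∑_n n^(N-k)/(n^N+W)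
(`herglotzF_eq_tsum_powSum`). Partial fractions over the N-th roots of -W make S a finite
combination of digamma values, so the digamma expansion applies again as W → ∞. The logarithms give
the sine term. Among the inverse powers only those with exponent divisible by N survive the sum over
the roots; they give ζ(k-qN) W^(-q), and summing over j gives ζ(1+q) x^q
(`exists_norm_powSum_sub_le`, `exists_norm_tsum_powSum_le`). The stated signs differ from the
natural ones only where ζ vanishes, or at ζ(0), which occurs for k = N and m = 1; that discrepancy
is what the 𝓑 term repairs.

For k = 1 the two sums cannot be separated so directly. The inner sum is cut at J and compensated by
log(1 + J/z), which dominated convergence allows (`tendsto_logSum_add_sum_powSum`). This brings in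
T_N(W) = ∑ log(1 + W/n^N)/n. Its derivative in u = log W is -S(e^u), so T_N(e^u) = γu + u²/(2N) +
C_N + o(1). For N = 1 the constant comes from harmonic numbers at x = 1, namely C_1 = ζ(2) - γ₁;
factoring 1 + Y^N/n^N over roots reduces general N to it, with C_N = π²/(6N) - Nγ₁
(`tendsto_logSumRest_natCast`). The divergent terms in J then cancel (`herglotzF_one_eq`). -/

/-! ### Geometry of sectors. -/

theorem sin_half_pos {δ : ℝ} (hδ : 0 < δ) (hδπ : δ < Real.pi) : 0 < Real.sin (δ / 2) :=
  Real.sin_pos_of_pos_of_lt_pi (by linarith) (by linarith)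

/-- Since Re z ≥ -|z| cos δ, the square |z+t|² is at least sin²(δ/2)(|z|+t)² + cos²(δ/2)(|z|-t)².
This is the source of uniformity in every later estimate. -/
theorem sin_half_mul_le_norm_add {δ : ℝ} (hδ : 0 < δ) {z : ℂ}
    (hz : z ∈ sector δ) {t : ℝ} (ht : 0 ≤ t) : Real.sin (δ / 2) * (‖z‖ + t) ≤ ‖z + t‖ := by
  have hre : -(‖z‖ * Real.cos δ) ≤ z.re := by
    rw [← Complex.norm_mul_cos_arg z, ← mul_neg, ← Real.cos_pi_sub, ← Real.cos_abs z.arg]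
    exact mul_le_mul_of_nonneg_left
      (Real.cos_le_cos_of_nonneg_of_le_pi (abs_nonneg _) (by linarith) hz.2) (norm_nonneg z)
  have hsin : Real.sin (δ / 2) ^ 2 = 1 / 2 - Real.cos δ / 2 := by
    rw [Real.sin_sq_eq_half_sub]; ring_nf
  have h1 : ‖z + t‖ ^ 2 = ‖z‖ ^ 2 + 2 * z.re * t + t ^ 2 := by
    simp only [Complex.sq_norm, Complex.normSq_apply, Complex.add_re, Complex.add_im,
      Complex.ofReal_re, Complex.ofReal_im]
    ring
  refine le_of_sq_le_sq ?_ (norm_nonneg _)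
  rw [h1, mul_pow, hsin]
  have h2 := Real.neg_one_le_cos δ
  nlinarith [mul_le_mul_of_nonneg_right hre ht,
    mul_nonneg (by linarith : (0 : ℝ) ≤ 1 + Real.cos δ) (sq_nonneg (‖z‖ - t))]

theorem exists_mem_sector {x : ℂ} (hx : x ∈ Complex.slitPlane) :
    ∃ δ, 0 < δ ∧ δ < Real.pi ∧ x ∈ sector δ := by
  have h1 : |x.arg| < Real.pi := by
    rw [abs_lt]
    exact ⟨Complex.neg_pi_lt_arg x, lt_of_le_of_ne (Complex.arg_le_pi x)
      (Complex.mem_slitPlane_iff_arg.1 hx).1⟩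
  have := abs_nonneg x.arg
  have := Real.pi_pos
  exact ⟨(Real.pi - |x.arg|) / 2, by linarith, by linarith, hx, by linarith⟩

theorem add_mem_slitPlane {z : ℂ} (hz : z ∈ Complex.slitPlane) {t : ℝ} (ht : 0 ≤ t) :
    z + t ∈ Complex.slitPlane := by
  rw [Complex.mem_slitPlane_iff] at *
  simp only [Complex.add_re, Complex.ofReal_re, Complex.add_im, Complex.ofReal_im, add_zero]
  exact hz.imp (fun h ↦ by linarith) id

theorem ofReal_mul_mem_slitPlane {z : ℂ} (hz : z ∈ Complex.slitPlane) {t : ℝ} (ht : 0 < t) :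
    (t : ℂ) * z ∈ Complex.slitPlane := by
  rw [Complex.mem_slitPlane_iff] at *
  simp only [Complex.re_ofReal_mul, Complex.im_ofReal_mul]
  exact hz.imp (fun h ↦ by positivity) (fun h ↦ by positivity)

theorem ofReal_mul_mem_sector {δ : ℝ} {z : ℂ} (hz : z ∈ sector δ) {t : ℝ} (ht : 0 < t) :
    (t : ℂ) * z ∈ sector δ :=
  ⟨ofReal_mul_mem_slitPlane hz.1 ht, by rw [Complex.arg_real_mul _ ht]; exact hz.2⟩

theorem inv_mem_slitPlane {z : ℂ} (hz : z ∈ Complex.slitPlane) : z⁻¹ ∈ Complex.slitPlane := by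
  rw [Complex.mem_slitPlane_iff_arg] at *
  refine ⟨?_, inv_ne_zero hz.2⟩
  rw [Complex.arg_inv, if_neg hz.1]
  have := Complex.neg_pi_lt_arg z
  intro h
  linarith

theorem inv_mem_sector {δ : ℝ} {z : ℂ} (hz : z ∈ sector δ) : z⁻¹ ∈ sector δ := by
  refine ⟨inv_mem_slitPlane hz.1, ?_⟩
  rw [Complex.arg_inv, if_neg (Complex.mem_slitPlane_iff_arg.1 hz.1).1, abs_neg]
  exact hz.2

theorem add_natCast_ne_zero {z : ℂ} (hz : z ∈ Complex.slitPlane) (j : ℕ) : z + j ≠ 0 := by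
  have := Complex.slitPlane_ne_zero (add_mem_slitPlane hz (Nat.cast_nonneg j))
  simpa using this

/-! ### Partial fractions and Gauss's limit for the digamma function. -/

/-- `Γ(z + 1) e^{γ z}` is the exponential of a convergent series in the right half-plane. -/
theorem exp_tsum_eq_exp_mul_Gamma {z : ℂ} (hz : 0 < z.re)
    (hs : Summable fun j : ℕ ↦ z / ((j : ℂ) + 1) - Complex.log (1 + z / ((j : ℂ) + 1))) :
    Complex.exp (∑' j : ℕ, (z / ((j : ℂ) + 1) - Complex.log (1 + z / ((j : ℂ) + 1)))) =
      Complex.exp (Real.eulerMascheroniConstant * z) * Complex.Gamma (z + 1) := by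
  have hz0 : z ≠ 0 := by rintro rfl; simp at hz
  have hslit : z ∈ Complex.slitPlane := Or.inl hz
  have h1 := (Complex.continuous_exp.tendsto _).comp hs.hasSum.tendsto_sum_nat
  have h2 : Tendsto (fun n : ℕ ↦ Complex.exp (((harmonic n : ℚ) - Real.log n : ℝ) * z) *
      (z * Complex.GammaSeq z n)) atTop
      (𝓝 (Complex.exp (Real.eulerMascheroniConstant * z) * (z * Complex.Gamma z))) := by
    refine Tendsto.mul ?_ ((Complex.GammaSeq_tendsto_Gamma z).const_mul z)
    refine (Complex.continuous_exp.tendsto _).comp (Tendsto.mul_const _ ?_)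
    exact (Complex.continuous_ofReal.tendsto _).comp Real.tendsto_harmonic_sub_log
  rw [Complex.Gamma_add_one z hz0]
  refine tendsto_nhds_unique h1 (h2.congr' ?_)
  filter_upwards [eventually_gt_atTop 0] with n hn
  have hn0 : (n : ℂ) ≠ 0 := by exact_mod_cast hn.ne'
  simp only [Function.comp]
  rw [Finset.sum_sub_distrib, Complex.exp_sub, Complex.exp_sum (Finset.range n)
    (fun j : ℕ ↦ Complex.log (1 + z / ((j : ℂ) + 1)))]
  have hlog : ∀ j ∈ Finset.range n, Complex.exp (Complex.log (1 + z / ((j : ℂ) + 1))) =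
      (z + (j + 1 : ℕ)) / ((j + 1 : ℕ) : ℂ) := by
    intro j _
    have hj : ((j : ℂ) + 1) ≠ 0 := Nat.cast_add_one_ne_zero j
    have := add_natCast_ne_zero hslit (j + 1)
    rw [Complex.exp_log]
    · push_cast; field_simp; ring
    · intro h
      apply this
      field_simp at h
      push_cast
      linear_combination h
  rw [Finset.prod_congr rfl hlog, Finset.prod_div_distrib, ← Nat.cast_prod,
    Finset.prod_range_add_one_eq_factorial, Complex.GammaSeq, Finset.prod_range_succ']
  have h3 : ∏ j ∈ Finset.range n, (z + (j + 1 : ℕ)) ≠ 0 :=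
    Finset.prod_ne_zero_iff.2 fun j _ ↦ add_natCast_ne_zero hslit (j + 1)
  have h4 : (n.factorial : ℂ) ≠ 0 := by exact_mod_cast n.factorial_ne_zero
  rw [Complex.cpow_def_of_ne_zero hn0, ← Complex.natCast_log]
  have h5 : ∑ j ∈ Finset.range n, z / ((j : ℂ) + 1) = (harmonic n : ℚ) * z := by
    rw [harmonic, Rat.cast_sum, Finset.sum_mul]
    refine Finset.sum_congr rfl fun j _ ↦ ?_
    push_cast
    ring
  rw [h5]
  have h6 : Complex.exp (((harmonic n : ℚ) : ℂ) * z) =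
      Complex.exp (((harmonic n : ℚ) - Real.log n : ℝ) * z) * Complex.exp (Real.log n * z) := by
    rw [← Complex.exp_add]; congr 1; push_cast; ring
  rw [h6]
  simp only [Nat.cast_zero, add_zero]
  field_simp

theorem summable_log_one_add_half :
    Summable fun j : ℕ ↦ (1 / 2 : ℂ) / ((j : ℂ) + 1) - Complex.log (1 + (1 / 2) / ((j : ℂ) + 1)) := by
  refine Summable.of_norm_bounded
    ((summable_nat_add_iff 1).2 (Real.summable_one_div_nat_pow.2 one_lt_two)) fun j ↦ ?_
  have hj : ‖(1 / 2 : ℂ) / ((j : ℂ) + 1)‖ = 1 / 2 / (j + 1) := by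
    rw [norm_div, show ((j : ℂ) + 1) = ((j + 1 : ℕ) : ℂ) by push_cast; ring, Complex.norm_natCast]
    simp
  have hj1 : (1 / 2 : ℝ) / (j + 1) ≤ 1 / 2 := by
    rw [div_le_iff₀ (by positivity)]; nlinarith [(Nat.cast_nonneg j : (0 : ℝ) ≤ j)]
  rw [norm_sub_rev]
  refine (Complex.norm_log_one_add_sub_self_le (by rw [hj]; linarith)).trans ?_
  rw [hj]
  have : (1 - 1 / 2 / ((j : ℝ) + 1))⁻¹ ≤ 2 := by
    rw [inv_le_comm₀ (by linarith) two_pos]; linarith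
  push_cast
  calc (1 / 2 / ((j : ℝ) + 1)) ^ 2 * (1 - 1 / 2 / ((j : ℝ) + 1))⁻¹ / 2
      ≤ (1 / 2 / ((j : ℝ) + 1)) ^ 2 * 2 / 2 := by gcongr
    _ = 1 / 4 * (1 / ((j : ℝ) + 1) ^ 2) := by field_simp; norm_num
    _ ≤ 1 / ((j : ℝ) + 1) ^ 2 := by
      have : 0 ≤ 1 / ((j : ℝ) + 1) ^ 2 := by positivity
      linarith

/-- Logarithmic derivative of the product for Γ(z+1) e^(γz). The exponentiated identity is
differentiated, so no branch of log Γ is needed. Intersecting the half-plane with a ball makes the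
termwise derivatives O(1/(j+1)²), and 1/2 is a base point where the undifferentiated series is known
to converge. -/
theorem digamma_add_one_eq_tsum {z : ℂ} (hz : 0 < z.re) :
    (Summable fun j : ℕ ↦ 1 / ((j : ℂ) + 1) - 1 / (z + 1 + j)) ∧
    ∑' j : ℕ, (1 / ((j : ℂ) + 1) - 1 / (z + 1 + j)) =
      Complex.digamma (z + 1) + Real.eulerMascheroniConstant := by
  set R : ℝ := ‖z‖ + 1
  set t : Set ℂ := {w : ℂ | 0 < w.re} ∩ Metric.ball 0 R
  set g : ℕ → ℂ → ℂ := fun j w ↦ w / ((j : ℂ) + 1) - Complex.log (1 + w / ((j : ℂ) + 1))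
  set g' : ℕ → ℂ → ℂ := fun j w ↦ 1 / ((j : ℂ) + 1) - 1 / (w + 1 + j)
  have hj0 : ∀ j : ℕ, ((j : ℂ) + 1) ≠ 0 := fun j ↦ Nat.cast_add_one_ne_zero j
  have hw0 : ∀ (j : ℕ) (w : ℂ), 0 < w.re → w + 1 + j ≠ 0 := by
    intro j w hw h
    have := congrArg Complex.re h
    simp at this
    have := (Nat.cast_nonneg j : (0 : ℝ) ≤ j)
    linarith
  have ht : IsOpen t := (isOpen_lt continuous_const Complex.continuous_re).inter Metric.isOpen_ball
  have h't : IsPreconnected t :=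
    ((convex_halfSpace_re_gt 0).inter (convex_ball 0 R)).isPreconnected
  have hg : ∀ n y, y ∈ t → HasDerivAt (g n) (g' n y) y := by
    intro j w hw
    have h1 : HasDerivAt (fun w : ℂ ↦ w / ((j : ℂ) + 1)) (1 / ((j : ℂ) + 1)) w :=
      (hasDerivAt_id w).div_const _
    have h2 : 1 + w / ((j : ℂ) + 1) ∈ Complex.slitPlane := by
      refine Or.inl ?_
      have : w / ((j : ℂ) + 1) = w / ((j + 1 : ℝ) : ℂ) := by push_cast; ring
      rw [this, Complex.add_re, Complex.div_ofReal_re, Complex.one_re]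
      have := hw.1
      simp only [Set.mem_ofPred_eq] at this
      positivity
    refine (h1.sub ((h1.const_add 1).clog h2)).congr_deriv ?_
    simp only [g']
    have h3 := hw0 j w hw.1
    have h4 := hj0 j
    have h5 : (1 + w / ((j : ℂ) + 1)) = (w + 1 + j) / ((j : ℂ) + 1) := by field_simp; ring
    rw [h5]
    field_simp
  have hu : Summable fun j : ℕ ↦ R * (1 / ((j : ℝ) + 1) ^ 2) := by
    have := ((summable_nat_add_iff 1).2 (Real.summable_one_div_nat_pow.2 one_lt_two)).mul_left R
    simpa using this
  have hg' : ∀ n y, y ∈ t → ‖g' n y‖ ≤ R * (1 / ((n : ℝ) + 1) ^ 2) := by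
    intro j w hw
    have h3 := hw0 j w hw.1
    have h4 := hj0 j
    have h5 : g' j w = w / (((j : ℂ) + 1) * (w + 1 + j)) := by
      simp only [g']; field_simp; ring
    have h6 : (j : ℝ) + 1 ≤ ‖w + 1 + j‖ := by
      refine le_trans ?_ (Complex.re_le_norm _)
      have := hw.1
      simp only [Set.mem_ofPred_eq] at this
      simp; linarith
    have h7 : ‖(j : ℂ) + 1‖ = (j : ℝ) + 1 := by
      rw [show ((j : ℂ) + 1) = ((j + 1 : ℕ) : ℂ) by push_cast; ring, Complex.norm_natCast]
      push_cast; rfl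
    have h8 : ‖w‖ ≤ R := by
      have := hw.2
      rw [mem_ball_zero_iff] at this
      exact this.le
    rw [h5, norm_div, norm_mul, h7, mul_one_div, sq]
    gcongr
  have hhalf : (1 / 2 : ℂ) ∈ t := by
    refine ⟨by simp, ?_⟩
    rw [mem_ball_zero_iff]
    have := norm_nonneg z
    norm_num
    linarith
  have hzt : z ∈ t := ⟨hz, by rw [mem_ball_zero_iff]; exact lt_add_one _⟩
  have hsum : ∀ y ∈ t, Summable fun j ↦ g j y := fun y hy ↦
    summable_of_summable_hasDerivAt_of_isPreconnected hu ht h't hg hg' hhalf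
      summable_log_one_add_half hy
  have hder := hasDerivAt_tsum_of_isPreconnected hu ht h't hg hg' hhalf
      summable_log_one_add_half hzt
  refine ⟨Summable.of_norm_bounded hu fun j ↦ hg' j z hzt, ?_⟩
  have hΓ0 : Complex.Gamma (z + 1) ≠ 0 := Complex.Gamma_ne_zero_of_re_pos (by simp; linarith)
  have hΓ : DifferentiableAt ℂ Complex.Gamma (z + 1) := by
    refine Complex.differentiableAt_Gamma _ fun m hm ↦ ?_
    have := congrArg Complex.re hm
    simp at this
    have := (Nat.cast_nonneg m : (0 : ℝ) ≤ m)
    linarith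
  have e1 := hder.cexp
  have e2 : HasDerivAt (fun w : ℂ ↦ Complex.exp (Real.eulerMascheroniConstant * w) *
      Complex.Gamma (w + 1))
      (Complex.exp (Real.eulerMascheroniConstant * z) * Real.eulerMascheroniConstant *
        Complex.Gamma (z + 1) + Complex.exp (Real.eulerMascheroniConstant * z) *
        deriv Complex.Gamma (z + 1)) z := by
    have a1 : HasDerivAt (fun w : ℂ ↦ Complex.exp (Real.eulerMascheroniConstant * w))
        (Complex.exp (Real.eulerMascheroniConstant * z) * Real.eulerMascheroniConstant) z := by
      have := ((hasDerivAt_id z).const_mul (Real.eulerMascheroniConstant : ℂ)).cexp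
      simpa using this
    have a2 : HasDerivAt (fun w : ℂ ↦ Complex.Gamma (w + 1)) (deriv Complex.Gamma (z + 1)) z :=
      hΓ.hasDerivAt.comp_add_const z 1
    exact a1.mul a2
  have e3 := e1.congr_of_eventuallyEq (f₁ := fun w : ℂ ↦
    Complex.exp (Real.eulerMascheroniConstant * w) * Complex.Gamma (w + 1)) (by
      filter_upwards [ht.mem_nhds hzt] with w hw
      exact (exp_tsum_eq_exp_mul_Gamma hw.1 (hsum w hw)).symm)
  have e4 := e3.unique e2
  have e5 := exp_tsum_eq_exp_mul_Gamma hz (hsum z hzt)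
  simp only [g] at e4
  rw [e5] at e4
  have hE := Complex.exp_ne_zero (Real.eulerMascheroniConstant * z)
  rw [Complex.digamma_def, logDeriv_apply]
  rw [eq_comm, ← eq_sub_iff_add_eq, div_eq_iff hΓ0]
  have : Complex.exp (Real.eulerMascheroniConstant * z) * ((∑' j, g' j z) * Complex.Gamma (z + 1)) =
      Complex.exp (Real.eulerMascheroniConstant * z) *
      (deriv Complex.Gamma (z + 1) + Real.eulerMascheroniConstant * Complex.Gamma (z + 1)) := by
    linear_combination e4
  have := mul_left_cancel₀ hE this
  simp only [g'] at this
  linear_combination -this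

theorem tendsto_add_natCast_cobounded (w : ℂ) :
    Tendsto (fun n : ℕ ↦ w + n) atTop (Bornology.cobounded ℂ) := by
  refine tendsto_norm_atTop_iff_cobounded.1 (tendsto_atTop_mono (fun n ↦ ?_)
    (tendsto_atTop_add_const_left _ (-‖w‖) tendsto_natCast_atTop_atTop))
  have := norm_sub_le (w + n) w
  rw [add_sub_cancel_left, Complex.norm_natCast] at this
  linarith

/-- Gauss's limit for the digamma function. -/
theorem tendsto_log_sub_sum_digamma {z : ℂ} (hz : z ∈ Complex.slitPlane) :
    Tendsto (fun n : ℕ ↦ (Real.log n : ℂ) - ∑ j ∈ Finset.range n, 1 / (z + j)) atTop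
      (𝓝 (Complex.digamma z)) := by
  have hinv : ∀ w : ℂ, Tendsto (fun n : ℕ ↦ 1 / (w + n)) atTop (𝓝 0) := by
    intro w
    simp only [one_div]
    exact tendsto_inv₀_cobounded.comp (tendsto_add_natCast_cobounded w)
  have step : ∀ w : ℂ, w ∈ Complex.slitPlane →
      Tendsto (fun n : ℕ ↦ (Real.log n : ℂ) - ∑ j ∈ Finset.range n, 1 / (w + 1 + j)) atTop
        (𝓝 (Complex.digamma (w + 1))) →
      Tendsto (fun n : ℕ ↦ (Real.log n : ℂ) - ∑ j ∈ Finset.range n, 1 / (w + j)) atTop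
        (𝓝 (Complex.digamma w)) := by
    intro w hw h
    have h1 := (h.sub_const (1 / w)).add (hinv w)
    have h2 : Complex.digamma w = Complex.digamma (w + 1) - 1 / w + 0 := by
      rw [Complex.digamma_apply_add_one w fun m hm ↦ add_natCast_ne_zero hw m (by rw [hm]; ring)]
      rw [one_div]; ring
    rw [h2]
    refine h1.congr fun n ↦ ?_
    have h3 := Finset.sum_range_succ (fun j : ℕ ↦ 1 / (w + j)) n
    rw [Finset.sum_range_succ'] at h3
    have h4 : ∑ j ∈ Finset.range n, 1 / (w + 1 + j) =
      ∑ j ∈ Finset.range n, 1 / (w + (j + 1 : ℕ)) :=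
      Finset.sum_congr rfl fun j _ ↦ by push_cast; ring_nf
    rw [h4]
    simp only [Nat.cast_zero, add_zero] at h3
    linear_combination -h3
  have base : ∀ w : ℂ, 0 < w.re →
      Tendsto (fun n : ℕ ↦ (Real.log n : ℂ) - ∑ j ∈ Finset.range n, 1 / (w + j)) atTop
        (𝓝 (Complex.digamma w)) := by
    intro w hw
    refine step w (Or.inl hw) ?_
    obtain ⟨h1, h2⟩ := digamma_add_one_eq_tsum hw
    have h3 := h1.hasSum.tendsto_sum_nat
    rw [h2] at h3
    have h4 : Tendsto (fun n : ℕ ↦ (((harmonic n : ℚ) - Real.log n : ℝ) : ℂ)) atTop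
      (𝓝 (Real.eulerMascheroniConstant : ℂ)) :=
      (Complex.continuous_ofReal.tendsto _).comp Real.tendsto_harmonic_sub_log
    have h5 := h3.sub h4
    rw [add_sub_cancel_right] at h5
    refine h5.congr fun n ↦ ?_
    rw [Finset.sum_sub_distrib, harmonic]
    push_cast
    simp only [one_div]
    ring
  -- The recurrence carries the limit one unit to the left, so induction on the number of unit
  -- shifts into the right half-plane reaches the whole slit plane.
  have key : ∀ (m : ℕ) (w : ℂ), w ∈ Complex.slitPlane → 0 < w.re + m →
      Tendsto (fun n : ℕ ↦ (Real.log n : ℂ) - ∑ j ∈ Finset.range n, 1 / (w + j)) atTop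
        (𝓝 (Complex.digamma w)) := by
    intro m
    induction m with
    | zero => intro w _ h; exact base w (by simpa using h)
    | succ m ih =>
      intro w hw h
      refine step w hw (ih (w + 1) ?_ ?_)
      · simpa using add_mem_slitPlane hw zero_le_one
      · push_cast at h; simp; linarith
  obtain ⟨m, hm⟩ := exists_nat_gt (-z.re)
  exact key m z hz (by linarith)


/-! ### Uniform asymptotic expansion of the digamma function. -/

/-- A power series without terms of degree below `R` is `O(w ^ R)` on the disc of radius `1/2`. -/
theorem exists_norm_le_of_hasSum_pow {a : ℕ → ℂ} {f : ℂ → ℂ} {R : ℕ}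
    (hf : ∀ w : ℂ, ‖w‖ < 1 → HasSum (fun r ↦ a r * w ^ r) (f w)) (ha : ∀ r < R, a r = 0) :
    ∃ K, 0 ≤ K ∧ ∀ w : ℂ, ‖w‖ ≤ 1 / 2 → ‖f w‖ ≤ K * ‖w‖ ^ R := by
  have hs : Summable fun r ↦ ‖a r‖ * (1 / 2) ^ r := by
    have := (hf (1 / 2) (by norm_num)).summable.norm
    simpa using this
  have hs2 := hs.mul_left (2 ^ R : ℝ)
  refine ⟨∑' r, 2 ^ R * (‖a r‖ * (1 / 2) ^ r), tsum_nonneg fun r ↦ by positivity, fun w hw ↦ ?_⟩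
  have hb : ∀ r, ‖a r * w ^ r‖ ≤ 2 ^ R * (‖a r‖ * (1 / 2) ^ r) * ‖w‖ ^ R := by
    intro r
    rcases lt_or_ge r R with h | h
    · rw [ha r h]; simp
    · obtain ⟨i, rfl⟩ := Nat.exists_eq_add_of_le h
      have h2 : (2 : ℝ) ^ R * (1 / 2) ^ R = 1 := by rw [← mul_pow]; norm_num
      rw [norm_mul, norm_pow, pow_add, pow_add]
      calc ‖a (R + i)‖ * (‖w‖ ^ R * ‖w‖ ^ i) ≤ ‖a (R + i)‖ * (‖w‖ ^ R * (1 / 2) ^ i) := by gcongr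
        _ = _ := by linear_combination (-‖a (R + i)‖ * ‖w‖ ^ R * (1 / 2) ^ i) * h2
  rw [← (hf w (by linarith)).tsum_eq, ← tsum_mul_right]
  exact tsum_of_norm_bounded (hs2.mul_right _).hasSum hb

theorem hasSum_div_one_add_pow (m : ℕ) {w : ℂ} (hw : ‖w‖ < 1) :
    HasSum (fun r : ℕ ↦ (if m + 1 ≤ r then (-1) ^ (r - (m + 1)) * ((r - 1).choose m : ℂ) else 0) *
      w ^ r) ((w / (1 + w)) ^ (m + 1)) := by
  have h := (hasSum_choose_mul_geometric_of_norm_lt_one m (r := -w) (by simpa using hw)).mul_right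
    (w ^ (m + 1))
  rw [← hasSum_nat_add_iff' (m + 1)]
  have h0 : ∑ r ∈ Finset.range (m + 1), (if m + 1 ≤ r then (-1) ^ (r - (m + 1)) *
      ((r - 1).choose m : ℂ) else 0) * w ^ r = 0 := by
    refine Finset.sum_eq_zero fun r hr ↦ ?_
    rw [if_neg (by simpa using hr), zero_mul]
  rw [h0, sub_zero]
  convert! h using 1
  · ext n
    rw [if_pos (by lia), show n + (m + 1) - (m + 1) = n by lia, show n + (m + 1) - 1 = n + m by lia,
      neg_pow w, pow_add]
    ring
  · rw [div_pow, sub_neg_eq_add]; ring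

theorem riemannZeta_one_sub_natCast {m : ℕ} (hm : 1 ≤ m) :
    riemannZeta (1 - m) = -((-1) ^ m * bernoulli m) / m := by
  obtain ⟨k, rfl⟩ := Nat.exists_eq_add_of_le' hm
  have := riemannZeta_neg_nat_eq_bernoulli' k
  rw [show (1 - ((k + 1 : ℕ) : ℂ)) = -k by push_cast; ring, this, bernoulli'_eq_bernoulli]
  push_cast
  ring

/-- The Bernoulli recursion, in the form needed for the digamma function. -/
theorem sum_riemannZeta_mul_choose {r : ℕ} (hr : 2 ≤ r) :
    ∑ m ∈ Finset.Icc 1 (r - 1), riemannZeta (1 - m) * ((-1) ^ (r - m) * ((r - 1).choose (m - 1) : ℂ))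
      = (-1) ^ r / r := by
  have hr0 : (r : ℂ) ≠ 0 := by exact_mod_cast (by lia : r ≠ 0)
  have h := sum_bernoulli r
  rw [if_neg (by lia), Finset.range_eq_Ico, Finset.sum_eq_sum_Ico_succ_bot (by lia)] at h
  have hset : Finset.Ico (0 + 1) r = Finset.Icc 1 (r - 1) := by ext; simp; lia
  rw [hset] at h
  have h' := congrArg (Rat.cast : ℚ → ℂ) h
  push_cast at h'
  have hterm : ∀ m ∈ Finset.Icc 1 (r - 1), riemannZeta (1 - m) *
      ((-1) ^ (r - m) * ((r - 1).choose (m - 1) : ℂ)) =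
      -(-1) ^ r / r * ((r.choose m : ℂ) * (bernoulli m : ℂ)) := by
    intro m hm
    obtain ⟨hm1, hm2⟩ := Finset.mem_Icc.1 hm
    have hm0 : (m : ℂ) ≠ 0 := by exact_mod_cast (by lia : m ≠ 0)
    have hc : (r : ℂ) * ((r - 1).choose (m - 1) : ℂ) = (r.choose m : ℂ) * m := by
      have := Nat.add_one_mul_choose_eq (r - 1) (m - 1)
      rw [show r - 1 + 1 = r by lia, show m - 1 + 1 = m by lia] at this
      exact_mod_cast this
    have hs : (-1 : ℂ) ^ m * (-1) ^ (r - m) = (-1) ^ r := by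
      rw [← pow_add]; congr 1; lia
    rw [riemannZeta_one_sub_natCast hm1, div_mul_eq_mul_div, div_mul_eq_mul_div,
      div_eq_div_iff hm0 hr0, ← hs]
    linear_combination (-(-1 : ℂ) ^ m * (-1) ^ (r - m) * bernoulli m) * hc
  rw [Finset.sum_congr rfl hterm, ← Finset.mul_sum]
  have h0 : ∑ m ∈ Finset.Icc 1 (r - 1), (r.choose m : ℂ) * (bernoulli m : ℂ) = -1 := by
    simp only [Nat.choose_zero_right, bernoulli_zero] at h'
    push_cast at h'
    linear_combination h'
  rw [h0]
  ring

/-- The truncated asymptotic series of the digamma function. -/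
noncomputable def digammaApprox (M : ℕ) (z : ℂ) : ℂ :=
  Complex.log z + ∑ m ∈ Finset.Icc 1 M, riemannZeta (1 - m) * (z ^ m)⁻¹

/-- With w = 1/z this is the defect of `digammaApprox` in the digamma recurrence. The gain to order
M+2, two more than the number of terms kept, makes the defects summable along z + j. -/
theorem exists_norm_difference_le (M : ℕ) :
    ∃ K, 0 ≤ K ∧ ∀ w : ℂ, ‖w‖ ≤ 1 / 2 →
      ‖Complex.log (1 + w) - w + ∑ m ∈ Finset.Icc 1 M,
        riemannZeta (1 - m) * ((w / (1 + w)) ^ m - w ^ m)‖ ≤ K * ‖w‖ ^ (M + 2) := by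
  refine exists_norm_le_of_hasSum_pow (a := fun r ↦ (-1) ^ (r + 1) / r - (if r = 1 then 1 else 0) +
    ∑ m ∈ Finset.Icc 1 M, riemannZeta (1 - m) *
      ((if m ≤ r then (-1) ^ (r - m) * ((r - 1).choose (m - 1) : ℂ) else 0) -
        if r = m then 1 else 0)) ?_ ?_
  · intro w hw
    have hmono : ∀ m : ℕ, HasSum (fun r ↦ (if r = m then (1 : ℂ) else 0) * w ^ r) (w ^ m) := by
      intro m
      convert! hasSum_ite_eq m (w ^ m) using 2 with r
      split_ifs with h <;> simp [h]
    have h1 := (Complex.hasSum_taylorSeries_log hw).sub ((pow_one w) ▸ hmono 1)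
    have h2 := hasSum_sum fun m (hm : m ∈ Finset.Icc 1 M) ↦
      ((hasSum_div_one_add_pow (m - 1) hw).sub (hmono m)).mul_left (riemannZeta (1 - m))
    convert! h1.add h2 using 1
    · ext r
      rw [add_mul, Finset.sum_mul]
      congr 1
      · ring
      · refine Finset.sum_congr rfl fun m hm ↦ ?_
        rw [show m - 1 + 1 = m by have := (Finset.mem_Icc.1 hm).1; lia]
        ring
    · congr 1
      refine Finset.sum_congr rfl fun m hm ↦ ?_
      rw [show m - 1 + 1 = m by have := (Finset.mem_Icc.1 hm).1; lia]
  -- Degrees 0 and 1 cancel by inspection. For 2 ≤ r ≤ M+1 the terms with m > r are zero and the two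
  -- parts of m = r cancel, leaving exactly the Bernoulli recursion against the coefficient of
  -- log(1+w).
  · intro r hr
    rcases Nat.lt_or_ge r 2 with h2 | h2
    · have h0 : ∑ m ∈ Finset.Icc 1 M, riemannZeta (1 - m) *
          ((if m ≤ r then (-1) ^ (r - m) * ((r - 1).choose (m - 1) : ℂ) else 0) -
            if r = m then 1 else 0) = 0 := by
        refine Finset.sum_eq_zero fun m hm ↦ ?_
        have hm1 := (Finset.mem_Icc.1 hm).1
        rcases lt_or_ge r m with h | h
        · rw [if_neg (by lia), if_neg (by lia)]; simp
        · obtain rfl : r = 1 := by lia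
          obtain rfl : m = 1 := by lia
          simp
      rw [h0]
      interval_cases r <;> simp
    · rw [if_neg (by lia)]
      have hsub : Finset.Icc 1 (r - 1) ⊆ Finset.Icc 1 M := Finset.Icc_subset_Icc le_rfl (by lia)
      rw [← Finset.sum_subset hsub]
      · have : ∑ m ∈ Finset.Icc 1 (r - 1), riemannZeta (1 - m) *
          ((if m ≤ r then (-1) ^ (r - m) * ((r - 1).choose (m - 1) : ℂ) else 0) -
            if r = m then 1 else 0) = (-1) ^ r / r := by
          rw [← sum_riemannZeta_mul_choose h2]
          refine Finset.sum_congr rfl fun m hm ↦ ?_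
          have := (Finset.mem_Icc.1 hm).2
          rw [if_pos (by lia), if_neg (by lia), sub_zero]
        rw [this]
        ring
      · intro m hm hm'
        have hmr : r ≤ m := by
          by_contra h
          exact hm' (Finset.mem_Icc.2 ⟨(Finset.mem_Icc.1 hm).1, by lia⟩)
        rcases hmr.eq_or_lt with rfl | h
        · simp
        · rw [if_neg (by lia), if_neg (by lia)]; simp

/-- The imaginary parts of z and 1 + 1/z have opposite signs, so their arguments add without leaving
(-π, π]. -/
theorem log_add_one {z : ℂ} (hz : z ∈ Complex.slitPlane) :
    Complex.log (z + 1) = Complex.log z + Complex.log (1 + z⁻¹) := by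
  have hz0 := Complex.slitPlane_ne_zero hz
  have hiz : z⁻¹ ∈ Complex.slitPlane := inv_mem_slitPlane hz
  have h1 : 1 + z⁻¹ ∈ Complex.slitPlane := by
    simpa [add_comm] using add_mem_slitPlane hiz zero_le_one
  have h10 := Complex.slitPlane_ne_zero h1
  rw [← Complex.log_mul hz0 h10]
  · congr 1; field_simp
  · have him : (1 + z⁻¹).im = -z.im / Complex.normSq z := by simp [Complex.inv_im]
    have hn : 0 < Complex.normSq z := Complex.normSq_pos.2 hz0
    have a1 := Complex.neg_pi_lt_arg z
    have a2 := lt_of_le_of_ne (Complex.arg_le_pi z) (Complex.mem_slitPlane_iff_arg.1 hz).1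
    have b1 := Complex.neg_pi_lt_arg (1 + z⁻¹)
    have b2 := lt_of_le_of_ne (Complex.arg_le_pi _) (Complex.mem_slitPlane_iff_arg.1 h1).1
    rcases lt_or_ge z.im 0 with h | h
    · have c1 := Complex.arg_neg_iff.2 h
      have c2 : 0 ≤ Complex.arg (1 + z⁻¹) := by
        rw [Complex.arg_nonneg_iff, him]; exact div_nonneg (by linarith) hn.le
      constructor <;> linarith
    · have c1 := Complex.arg_nonneg_iff.2 h
      rcases h.eq_or_lt with h | h
      · have hre : 0 < z.re := hz.resolve_right (by rw [← h]; simp)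
        have c2 : Complex.arg z = 0 := Complex.arg_eq_zero_iff.2 ⟨hre.le, h.symm⟩
        rw [c2, zero_add]
        exact ⟨b1, b2.le⟩
      · have c2 : Complex.arg (1 + z⁻¹) < 0 := by
          rw [Complex.arg_neg_iff, him]
          exact div_neg_of_neg_of_pos (by linarith) hn
        constructor <;> linarith

theorem digammaApprox_add_one_sub (M : ℕ) {z : ℂ} (hz : z ∈ Complex.slitPlane) :
    digammaApprox M (z + 1) - digammaApprox M z - z⁻¹ =
      Complex.log (1 + z⁻¹) - z⁻¹ + ∑ m ∈ Finset.Icc 1 M,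
        riemannZeta (1 - m) * ((z⁻¹ / (1 + z⁻¹)) ^ m - z⁻¹ ^ m) := by
  have hz0 := Complex.slitPlane_ne_zero hz
  have h : z⁻¹ / (1 + z⁻¹) = (z + 1)⁻¹ := by
    have h1 : z + 1 ≠ 0 := by simpa using add_natCast_ne_zero hz 1
    have h2 : 1 + z⁻¹ ≠ 0 := by
      intro h0
      apply h1
      field_simp at h0
      linear_combination h0
    field_simp
  simp only [digammaApprox, log_add_one hz, h, mul_sub, Finset.sum_sub_distrib, inv_pow]
  ring

theorem tendsto_log_add_natCast_sub_log (z : ℂ) :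
    Tendsto (fun n : ℕ ↦ Complex.log (z + n) - Real.log n) atTop (𝓝 0) := by
  have h1 : Tendsto (fun n : ℕ ↦ z / n + 1) atTop (𝓝 1) := by
    simpa using (tendsto_const_div_atTop_nhds_zero_nat z).add_const 1
  have h2 := ((continuousAt_clog (Complex.one_mem_slitPlane)).tendsto.comp h1)
  rw [Complex.log_one] at h2
  refine h2.congr' ?_
  filter_upwards [eventually_gt_atTop 0,
    h1.eventually_ne one_ne_zero] with n hn hne
  have hn0 : (n : ℂ) ≠ 0 := by exact_mod_cast hn.ne'
  have : z + n = ((n : ℝ) : ℂ) * (z / n + 1) := by push_cast; field_simp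
  rw [this, Complex.log_ofReal_mul (by exact_mod_cast hn) hne]
  simp

theorem tendsto_digammaApprox_add_natCast (M : ℕ) (z : ℂ) :
    Tendsto (fun n : ℕ ↦ digammaApprox M (z + n) - Real.log n) atTop (𝓝 0) := by
  have h : Tendsto (fun n : ℕ ↦ ∑ m ∈ Finset.Icc 1 M, riemannZeta (1 - m) * ((z + n) ^ m)⁻¹) atTop
      (𝓝 0) := by
    have h1 : Tendsto (fun n : ℕ ↦ (z + n)⁻¹) atTop (𝓝 0) :=
      tendsto_inv₀_cobounded.comp (tendsto_add_natCast_cobounded z)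
    have h2 := tendsto_finsetSum (Finset.Icc 1 M) fun m hm ↦
      ((h1.pow m).const_mul (riemannZeta (1 - m)))
    have h3 : ∑ m ∈ Finset.Icc 1 M, riemannZeta (1 - m) * (0 : ℂ) ^ m = 0 :=
      Finset.sum_eq_zero fun m hm ↦ by
        rw [zero_pow (by have := (Finset.mem_Icc.1 hm).1; lia), mul_zero]
    rw [h3] at h2
    simpa only [inv_pow] using h2
  have := (tendsto_log_add_natCast_sub_log z).add h
  rw [add_zero] at this
  refine this.congr fun n ↦ ?_
  simp only [digammaApprox]
  ring

theorem sum_one_div_add_sq_le {r : ℝ} (hr : 2 ≤ r) (n : ℕ) :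
    ∑ j ∈ Finset.range n, 1 / (r + j) ^ 2 ≤ 2 / r := by
  have h : ∀ n : ℕ, ∑ j ∈ Finset.range n, 1 / (r + j) ^ 2 ≤ 1 / (r - 1) - 1 / (r - 1 + n) := by
    intro n
    induction n with
    | zero => simp
    | succ n ih =>
      rw [Finset.sum_range_succ]
      have hn : (0 : ℝ) ≤ n := Nat.cast_nonneg n
      have h1 : 1 / (r + n) ^ 2 ≤ 1 / (r - 1 + n) - 1 / (r - 1 + (n + 1 : ℕ)) := by
        push_cast
        rw [div_sub_div _ _ (by linarith) (by linarith), div_le_div_iff₀ (by positivity)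
          (by apply mul_pos <;> linarith)]
        nlinarith
      linarith
  refine (h n).trans ?_
  have h1 : 1 / (r - 1) ≤ 2 / r := by
    rw [div_le_div_iff₀ (by linarith) (by linarith)]; linarith
  have h2 : 0 ≤ 1 / (r - 1 + n) := by
    have hn : (0 : ℝ) ≤ n := Nat.cast_nonneg n
    apply div_nonneg zero_le_one; linarith
  linarith

/-- The asymptotic expansion of the digamma function, uniform in closed sectors. -/
theorem exists_norm_digamma_sub_le {δ : ℝ} (hδ : 0 < δ) (hδπ : δ < Real.pi) (M : ℕ) :
    ∃ R K : ℝ, 2 ≤ R ∧ 0 ≤ K ∧ ∀ z ∈ sector δ, R ≤ ‖z‖ →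
      ‖Complex.digamma z - digammaApprox M z‖ ≤ K / ‖z‖ ^ (M + 1) := by
  obtain ⟨K, hK, hbound⟩ := exists_norm_difference_le M
  set c := Real.sin (δ / 2)
  have hc : 0 < c := sin_half_pos hδ hδπ
  have hc1 : c ≤ 1 := Real.sin_le_one _
  -- With |z| ≥ 2/c every shift satisfies |z+j| ≥ c(|z|+j) ≥ 2, so 1/(z+j) stays in the disc of
  -- radius 1/2 where the defect bound holds.
  refine ⟨2 / c, K / c ^ (M + 2) * 2, ?_, by positivity, fun z hz hR ↦ ?_⟩
  · rw [le_div_iff₀ hc]; linarith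
  have hz2 : 2 ≤ ‖z‖ := le_trans (by rw [le_div_iff₀ hc]; linarith) hR
  have hz0 : 0 < ‖z‖ := by linarith
  have hslit : ∀ j : ℕ, z + j ∈ Complex.slitPlane := fun j ↦ by
    simpa using add_mem_slitPlane hz.1 (Nat.cast_nonneg j)
  set e : ℂ → ℂ := fun z ↦ digammaApprox M (z + 1) - digammaApprox M z - z⁻¹
  have hterm : ∀ j : ℕ, ‖e (z + j)‖ ≤ K / c ^ (M + 2) / ‖z‖ ^ M * (1 / (‖z‖ + j) ^ 2) := by
    intro j
    have hj : (0 : ℝ) ≤ j := Nat.cast_nonneg j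
    have hlow : c * (‖z‖ + j) ≤ ‖z + j‖ := by
      simpa using sin_half_mul_le_norm_add hδ hz hj
    have hlow2 : 2 ≤ ‖z + j‖ := by
      refine le_trans ?_ hlow
      rw [div_le_iff₀ hc] at hR
      nlinarith
    have hw : ‖(z + j)⁻¹‖ ≤ 1 / 2 := by
      rw [norm_inv, inv_eq_one_div]; gcongr
    simp only [e]
    rw [digammaApprox_add_one_sub M (hslit j)]
    refine (hbound _ hw).trans ?_
    have hpos : 0 < c * (‖z‖ + j) := by positivity
    calc K * ‖(z + j)⁻¹‖ ^ (M + 2) = K * (1 / ‖z + j‖) ^ (M + 2) := by rw [norm_inv, one_div]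
      _ ≤ K * (1 / (c * (‖z‖ + j))) ^ (M + 2) := by gcongr
      _ = K / c ^ (M + 2) / (‖z‖ + j) ^ M * (1 / (‖z‖ + j) ^ 2) := by
        rw [div_pow, mul_pow, pow_add (‖z‖ + j), one_pow]; field_simp
      _ ≤ _ := by gcongr; linarith
  -- The differences of `digammaApprox` telescope, the reciprocals are those of Gauss's limit, and
  -- the end term `digammaApprox M (z + n)` matches log n.
  have hlim : Tendsto (fun n : ℕ ↦ ∑ j ∈ Finset.range n, e (z + j)) atTop
      (𝓝 (Complex.digamma z - digammaApprox M z)) := by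
    have h1 := ((tendsto_log_sub_sum_digamma hz.1).add
      (tendsto_digammaApprox_add_natCast M z)).sub_const (digammaApprox M z)
    rw [add_zero] at h1
    refine h1.congr fun n ↦ ?_
    have htel := Finset.sum_range_sub (fun j : ℕ ↦ digammaApprox M (z + j)) n
    simp only [e, Finset.sum_sub_distrib, one_div] at htel ⊢
    have : ∑ j ∈ Finset.range n, digammaApprox M (z + j + 1) =
        ∑ j ∈ Finset.range n, digammaApprox M (z + (j + 1 : ℕ)) :=
      Finset.sum_congr rfl fun j _ ↦ by push_cast; rw [add_assoc]
    rw [this]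
    simp only [Nat.cast_zero, add_zero] at htel
    linear_combination -htel
  refine le_of_tendsto hlim.norm (Eventually.of_forall fun n ↦ ?_)
  refine (norm_sum_le _ _).trans ((Finset.sum_le_sum fun j _ ↦ hterm j).trans ?_)
  rw [← Finset.mul_sum]
  calc K / c ^ (M + 2) / ‖z‖ ^ M * ∑ j ∈ Finset.range n, 1 / (‖z‖ + j) ^ 2
      ≤ K / c ^ (M + 2) / ‖z‖ ^ M * (2 / ‖z‖) := by
        gcongr; exact sum_one_div_add_sq_le hz2 n
    _ = _ := by rw [pow_succ ‖z‖ M]; field_simp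


/-! ### Absolute convergence and the expansion at infinity. -/

theorem hasSum_rpow_neg_riemannZeta {s : ℝ} (hs : 1 < s) :
    HasSum (fun n : ℕ ↦ ((((n + 1 : ℕ) : ℝ) ^ (-s) : ℝ) : ℂ)) (riemannZeta s) := by
  have h1 : Summable fun n : ℕ ↦ ((n + 1 : ℕ) : ℝ) ^ (-s) :=
    (summable_nat_add_iff 1).2 (Real.summable_nat_rpow.2 (by linarith))
  have h2 : Summable fun n : ℕ ↦ ((((n + 1 : ℕ) : ℝ) ^ (-s) : ℝ) : ℂ) :=
    Complex.ofRealCLM.summable h1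
  rw [h2.hasSum_iff, zeta_eq_tsum_one_div_nat_add_one_cpow (by simpa using hs)]
  refine tsum_congr fun n ↦ ?_
  rw [Complex.ofReal_cpow (Nat.cast_nonneg _), one_div, ← Complex.cpow_neg]
  push_cast
  rfl

/-- Scaling by n^N > 0 preserves the sector, so the digamma expansion holds with constants
independent of n. The case M = 0 already gives absolute convergence. -/
theorem exists_norm_herglotzTerm_sub_le (k N : ℝ) {δ : ℝ} (hδ : 0 < δ) (hδπ : δ < Real.pi) (M : ℕ) :
    ∃ R K : ℝ, 2 ≤ R ∧ 0 ≤ K ∧ ∀ x ∈ sector δ, ∀ n : ℕ, R ≤ ((n + 1 : ℕ) : ℝ) ^ N * ‖x‖ →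
      ‖herglotzTerm k N x (n + 1) - ∑ m ∈ Finset.Icc 1 M, riemannZeta (1 - m) * (x ^ m)⁻¹ *
        ((((n + 1 : ℕ) : ℝ) ^ (-(k + m * N)) : ℝ) : ℂ)‖ ≤
      K / ‖x‖ ^ (M + 1) * ((n + 1 : ℕ) : ℝ) ^ (-(k + (M + 1 : ℕ) * N)) := by
  obtain ⟨R, K, hR, hK, h⟩ := exists_norm_digamma_sub_le hδ hδπ M
  refine ⟨R, K, hR, hK, fun x hx n hn ↦ ?_⟩
  set b : ℝ := ((n + 1 : ℕ) : ℝ)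
  have hb : 0 < b := by positivity
  set a : ℝ := b ^ N
  have ha : 0 < a := by positivity
  have hbm : ∀ m : ℕ, b ^ (-(k + m * N)) = (a ^ m)⁻¹ * (b ^ k)⁻¹ := by
    intro m
    rw [← Real.rpow_natCast, ← Real.rpow_mul hb.le, ← Real.rpow_neg hb.le, ← Real.rpow_neg hb.le,
      ← Real.rpow_add hb]
    congr 1; ring
  have hnorm : ‖(a : ℂ) * x‖ = a * ‖x‖ := by
    rw [norm_mul, Complex.norm_real, Real.norm_of_nonneg ha.le]
  have h1 := h (a * x) (ofReal_mul_mem_sector hx ha) (by rw [hnorm]; exact hn)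
  have h2 : herglotzTerm k N x (n + 1) - ∑ m ∈ Finset.Icc 1 M, riemannZeta (1 - m) * (x ^ m)⁻¹ *
        ((b ^ (-(k + m * N)) : ℝ) : ℂ) =
      (Complex.digamma (a * x) - digammaApprox M (a * x)) * ((b ^ k : ℝ) : ℂ)⁻¹ := by
    rw [herglotzTerm, digammaApprox, ← sub_sub, sub_mul, Finset.sum_mul, div_eq_mul_inv]
    congr 1
    refine Finset.sum_congr rfl fun m _ ↦ ?_
    rw [hbm, mul_pow, mul_inv]
    push_cast
    ring
  rw [h2, norm_mul, norm_inv, Complex.norm_real, Real.norm_of_nonneg (by positivity), hbm]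
  calc ‖Complex.digamma (a * x) - digammaApprox M (a * x)‖ * (b ^ k)⁻¹
      ≤ K / ‖(a : ℂ) * x‖ ^ (M + 1) * (b ^ k)⁻¹ := by gcongr
    _ = _ := by rw [hnorm, mul_pow]; field_simp

theorem summable_herglotzTerm {k N : ℝ} (hN : 0 < N) (hkN : 1 < k + N) {x : ℂ}
    (hx : x ∈ Complex.slitPlane) : Summable fun n : ℕ ↦ herglotzTerm k N x (n + 1) := by
  obtain ⟨δ, hδ, hδπ, hxδ⟩ := exists_mem_sector hx
  obtain ⟨R, K, hR, hK, h⟩ := exists_norm_herglotzTerm_sub_le k N hδ hδπ 0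
  have hs : Summable fun n : ℕ ↦ ((n + 1 : ℕ) : ℝ) ^ (-(k + N)) :=
    (summable_nat_add_iff 1).2 (Real.summable_nat_rpow.2 (by linarith))
  refine Summable.of_norm_bounded_eventually_nat (hs.mul_left (K / ‖x‖)) ?_
  have hx0 : 0 < ‖x‖ := norm_pos_iff.2 (Complex.slitPlane_ne_zero hx)
  have hlim : Tendsto (fun n : ℕ ↦ ((n + 1 : ℕ) : ℝ) ^ N * ‖x‖) atTop atTop :=
    (((tendsto_rpow_atTop hN).comp tendsto_natCast_atTop_atTop).comp
      (tendsto_add_atTop_nat 1)).atTop_mul_const hx0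
  filter_upwards [hlim.eventually_ge_atTop R] with n hn
  simpa using h x hxδ n hn

/-- ζ(0) = -1/2 and the odd Bernoulli numbers beyond the first vanish. Stopping at the odd index
2M+1 keeps M Bernoulli terms and leaves an error of order 2M+2, the order of the next nominal term.
-/
theorem sum_Icc_odd_eq (M : ℕ) (g : ℕ → ℂ) :
    ∑ m ∈ Finset.Icc 1 (2 * M + 1), riemannZeta (1 - m) * g m =
      -(1 / 2) * g 1 + ∑ n ∈ Finset.Icc 1 M, -(bernoulli (2 * n) / (2 * n)) * g (2 * n) := by
  induction M with
  | zero => simp [riemannZeta_zero]; norm_num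
  | succ M ih =>
    rw [show 2 * (M + 1) + 1 = 2 * M + 1 + 1 + 1 by lia, Finset.sum_Icc_succ_top (by lia),
      Finset.sum_Icc_succ_top (by lia), ih, Finset.sum_Icc_succ_top (by lia),
      riemannZeta_one_sub_natCast (by lia : 1 ≤ 2 * M + 1 + 1),
      riemannZeta_one_sub_natCast (by lia : 1 ≤ 2 * M + 1 + 1 + 1),
      bernoulli_eq_zero_of_odd (n := 2 * M + 1 + 1 + 1) ⟨M + 1, by lia⟩ (by lia)]
    rw [Even.neg_one_pow (⟨M + 1, by lia⟩ : Even (2 * M + 1 + 1)),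
      show 2 * M + 1 + 1 = 2 * (M + 1) by lia]
    push_cast
    ring

theorem hasAsymptoticSeries_atInfty {k N : ℝ} (hN : 0 < N) (hkN : 1 < k + N) {δ : ℝ}
    (hδ : 0 < δ) (hδπ : δ < Real.pi) :
    HasAsymptoticSeries (sectorAtInfty δ) (herglotzF k N)
      (fun x ↦ -(1 / (2 * x)) * riemannZeta ((k : ℂ) + (N : ℂ)))
      (fun n ↦ -(((bernoulli (2 * n) : ℚ) : ℂ) / (2 * (n : ℂ)) *
        riemannZeta ((k : ℂ) + 2 * (n : ℂ) * (N : ℂ))))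
      (fun n x ↦ (x ^ (2 * n))⁻¹) := by
  intro M
  obtain ⟨R, K, hR, hK, h⟩ := exists_norm_herglotzTerm_sub_le k N hδ hδπ (2 * M + 1)
  have hexp : ∀ m : ℕ, 1 ≤ m → 1 < k + m * N := fun m hm ↦ by
    have : (1 : ℝ) ≤ m := by exact_mod_cast hm
    nlinarith
  have hsR : Summable fun n : ℕ ↦ ((n + 1 : ℕ) : ℝ) ^ (-(k + (2 * M + 1 + 1 : ℕ) * N)) := by
    have := hexp (2 * M + 1 + 1) (by lia)
    exact (summable_nat_add_iff 1).2 (Real.summable_nat_rpow.2 (by linarith))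
  refine IsBigO.of_bound (K * ∑' n : ℕ, ((n + 1 : ℕ) : ℝ) ^ (-(k + (2 * M + 1 + 1 : ℕ) * N))) ?_
  rw [sectorAtInfty, eventually_inf_principal]
  filter_upwards [eventually_cobounded_le_norm R] with x hxR hx
  have hx0 : 0 < ‖x‖ := by linarith
  have hterm := fun n : ℕ ↦ h x hx n (by
    have : (1 : ℝ) ≤ ((n + 1 : ℕ) : ℝ) ^ N := Real.one_le_rpow (by simp) hN.le
    nlinarith)
  have hS := (summable_herglotzTerm hN hkN hx.1).hasSum
  have hZ := hasSum_sum fun m (hm : m ∈ Finset.Icc 1 (2 * M + 1)) ↦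
    (hasSum_rpow_neg_riemannZeta (hexp m (Finset.mem_Icc.1 hm).1)).mul_left
      (riemannZeta (1 - m) * (x ^ m)⁻¹)
  have hD := hS.sub hZ
  have hb := tsum_of_norm_bounded (hsR.mul_left (K / ‖x‖ ^ (2 * M + 1 + 1))).hasSum hterm
  rw [hD.tsum_eq, tsum_mul_left] at hb
  have hsum := sum_Icc_odd_eq M fun m ↦ (x ^ m)⁻¹ * riemannZeta ((k + m * N : ℝ) : ℂ)
  simp only [← mul_assoc] at hsum
  rw [hsum] at hb
  have heq : -(1 / (2 * x)) * riemannZeta ((k : ℂ) + (N : ℂ)) + ∑ n ∈ Finset.Icc 1 M,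
      -(((bernoulli (2 * n) : ℚ) : ℂ) / (2 * (n : ℂ)) *
        riemannZeta ((k : ℂ) + 2 * (n : ℂ) * (N : ℂ))) * (x ^ (2 * n))⁻¹ =
      -(1 / 2) * (x ^ 1)⁻¹ * riemannZeta ((k + (1 : ℕ) * N : ℝ) : ℂ) + ∑ n ∈ Finset.Icc 1 M,
        -(((bernoulli (2 * n) : ℚ) : ℂ) / (2 * n)) * (x ^ (2 * n))⁻¹ *
          riemannZeta ((k + (2 * n : ℕ) * N : ℝ) : ℂ) := by
    congr 1
    · push_cast
      ring_nf
    · refine Finset.sum_congr rfl fun n _ ↦ ?_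
      push_cast
      ring_nf
  rw [heq]
  refine (show ‖_‖ ≤ _ from hb).trans (le_of_eq ?_)
  rw [norm_inv, norm_pow, show 2 * (M + 1) = 2 * M + 1 + 1 by lia]
  ring


/-! ### Roots of -W and the finite digamma formula for `powSum`. -/

/-- The `N`-th roots of `-1`. -/
noncomputable def rootNegOne (N l : ℕ) : ℂ :=
  Complex.exp (Real.pi * Complex.I * (2 * l + 1) / N)

theorem rootNegOne_zpow (N l : ℕ) (e : ℤ) :
    rootNegOne N l ^ e = Complex.exp (Real.pi * Complex.I * e / N) *
      (Complex.exp (2 * Real.pi * Complex.I / N) ^ e) ^ l := by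
  rw [rootNegOne, ← Complex.exp_int_mul, ← Complex.exp_int_mul, ← Complex.exp_nat_mul,
    ← Complex.exp_add]
  congr 1; ring

theorem exp_two_pi_div_zpow_eq_one_iff {N : ℕ} (hN : N ≠ 0) (e : ℤ) :
    Complex.exp (2 * Real.pi * Complex.I / N) ^ e = 1 ↔ (N : ℤ) ∣ e :=
  (Complex.isPrimitiveRoot_exp N hN).zpow_eq_one_iff_dvd e

theorem geom_sum_exp_eq_zero {N : ℕ} (hN : N ≠ 0) {e : ℤ} (he : ¬ (N : ℤ) ∣ e) :
    ∑ l ∈ Finset.range N, (Complex.exp (2 * Real.pi * Complex.I / N) ^ e) ^ l = 0 := by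
  have h1 := mt (exp_two_pi_div_zpow_eq_one_iff hN e).1 he
  rw [geom_sum_eq h1, ← zpow_natCast, ← zpow_mul,
    (exp_two_pi_div_zpow_eq_one_iff hN _).2 (dvd_mul_left _ _), sub_self, zero_div]

theorem sum_rootNegOne_zpow_of_not_dvd {N : ℕ} (hN : N ≠ 0) {e : ℤ} (he : ¬ (N : ℤ) ∣ e) :
    ∑ l ∈ Finset.range N, rootNegOne N l ^ e = 0 := by
  simp only [rootNegOne_zpow, ← Finset.mul_sum, geom_sum_exp_eq_zero hN he, mul_zero]

theorem rootNegOne_pow {N : ℕ} (hN : N ≠ 0) (l : ℕ) : rootNegOne N l ^ N = -1 := by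
  have hN' : (N : ℂ) ≠ 0 := by exact_mod_cast hN
  rw [rootNegOne, ← Complex.exp_nat_mul]
  have : (N : ℂ) * (Real.pi * Complex.I * (2 * l + 1) / N) =
      Real.pi * Complex.I + l * (2 * Real.pi * Complex.I) := by
    field_simp; ring
  rw [this, Complex.exp_add, Complex.exp_nat_mul_two_pi_mul_I, Complex.exp_pi_mul_I, mul_one]

theorem rootNegOne_ne_zero (N l : ℕ) : rootNegOne N l ≠ 0 := Complex.exp_ne_zero _

theorem sum_natCast_mul_pow (ω : ℂ) (n : ℕ) :
    (ω - 1) * ∑ l ∈ Finset.range n, (l : ℂ) * ω ^ l =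
      n * ω ^ n - ω * ∑ l ∈ Finset.range n, ω ^ l := by
  induction n with
  | zero => simp
  | succ n ih =>
    rw [Finset.sum_range_succ, Finset.sum_range_succ, mul_add, ih]
    push_cast
    ring

/-- The argument of `-rootNegOne N l` in `(-π, π)`. -/
noncomputable def rootAngle (N l : ℕ) : ℝ := Real.pi * (2 * l + 1 - N) / N

/-- The angle is affine in l. Its constant part drops out because the power sum of the roots
vanishes; its linear part is the arithmetic-geometric sum ∑ l ω^l = N/(ω-1), and ω - 1 is a phase
times the sine. -/
theorem sum_rootNegOne_zpow_mul_angle {k N : ℕ} (hk : 1 < k) (hkN : k ≤ N) :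
    ∑ l ∈ Finset.range N, rootNegOne N l ^ (1 - k : ℤ) * (rootAngle N l * Complex.I) =
      -Real.pi / Complex.sin (Real.pi / N * (k - 1)) := by
  have hN : N ≠ 0 := by lia
  have hN' : (N : ℂ) ≠ 0 := by exact_mod_cast hN
  have he : ¬ (N : ℤ) ∣ (1 - k : ℤ) := by
    intro h
    have := Int.le_of_dvd (by lia) ((dvd_neg).2 h)
    lia
  set ω := Complex.exp (2 * Real.pi * Complex.I / N) ^ (1 - k : ℤ)
  have hω1 : ω ≠ 1 := mt (exp_two_pi_div_zpow_eq_one_iff hN _).1 he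
  have hωN : ω ^ N = 1 := by
    rw [← zpow_natCast, ← zpow_mul]
    exact (exp_two_pi_div_zpow_eq_one_iff hN _).2 (dvd_mul_left _ _)
  have h1 := sum_natCast_mul_pow ω N
  rw [geom_sum_exp_eq_zero hN he, hωN, mul_zero, sub_zero, mul_one] at h1
  have h2 := sum_rootNegOne_zpow_of_not_dvd hN he
  set φ : ℂ := Real.pi / N * (k - 1)
  have hE : Complex.exp (Real.pi * Complex.I * (1 - k : ℤ) / N) = Complex.exp (-φ * Complex.I) := by
    congr 1; simp only [φ]; push_cast; ring
  have hω : ω = Complex.exp (-φ * Complex.I) * Complex.exp (-φ * Complex.I) := by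
    simp only [ω]
    rw [← Complex.exp_int_mul, ← Complex.exp_add]
    congr 1; simp only [φ]; push_cast; ring
  have h3 : ∑ l ∈ Finset.range N, rootNegOne N l ^ (1 - k : ℤ) * (rootAngle N l * Complex.I) =
      Complex.exp (-φ * Complex.I) * (2 * Real.pi * Complex.I / N) *
        ∑ l ∈ Finset.range N, (l : ℂ) * ω ^ l +
      Real.pi * (1 - N) / N * Complex.I * ∑ l ∈ Finset.range N, rootNegOne N l ^ (1 - k : ℤ) := by
    rw [Finset.mul_sum, Finset.mul_sum, ← Finset.sum_add_distrib]
    refine Finset.sum_congr rfl fun l _ ↦ ?_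
    rw [rootNegOne_zpow, hE, rootAngle]
    push_cast
    ring
  rw [h3, h2, mul_zero, add_zero]
  have hω1' := sub_ne_zero.2 hω1
  have h4 : ∑ l ∈ Finset.range N, (l : ℂ) * ω ^ l = N / (ω - 1) := by
    rw [eq_div_iff hω1', mul_comm]; exact h1
  have hI : Complex.exp (φ * Complex.I) * Complex.exp (-φ * Complex.I) = 1 := by
    rw [← Complex.exp_add]; simp
  have hsin : Complex.sin φ * Complex.exp (-φ * Complex.I) * 2 = (ω - 1) * Complex.I := by
    rw [Complex.sin, hω]
    linear_combination (-Complex.I) * hI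
  have hs0 : Complex.sin φ ≠ 0 := by
    intro h
    rw [h, zero_mul, zero_mul] at hsin
    exact mul_ne_zero hω1' Complex.I_ne_zero hsin.symm
  rw [h4]
  rw [neg_mul] at hsin ⊢
  field_simp
  linear_combination (Complex.I) * hsin + (ω - 1) * Complex.I_sq

theorem sum_rootAngle (N : ℕ) : ∑ l ∈ Finset.range N, (rootAngle N l : ℂ) = 0 := by
  have h : ∀ n : ℕ, ∑ l ∈ Finset.range n, (2 * (l : ℂ) + 1 - N) = n * (n - N) := by
    intro n
    induction n with
    | zero => simp
    | succ n ih => rw [Finset.sum_range_succ, ih]; push_cast; ring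
  simp only [rootAngle]
  push_cast
  rw [← Finset.sum_div, ← Finset.mul_sum, h N]
  simp

/-- The `N`-th roots of `-W`. -/
noncomputable def negRoot (N : ℕ) (W : ℂ) (l : ℕ) : ℂ :=
  rootNegOne N l * Complex.exp (Complex.log W / N)

theorem negRoot_ne_zero (N : ℕ) (W : ℂ) (l : ℕ) : negRoot N W l ≠ 0 :=
  mul_ne_zero (rootNegOne_ne_zero N l) (Complex.exp_ne_zero _)

theorem negRoot_pow {N : ℕ} (hN : N ≠ 0) {W : ℂ} (hW : W ≠ 0) (l : ℕ) : negRoot N W l ^ N = -W := by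
  have hN' : (N : ℂ) ≠ 0 := by exact_mod_cast hN
  rw [negRoot, mul_pow, rootNegOne_pow hN, ← Complex.exp_nat_mul, mul_div_cancel₀ _ hN',
    Complex.exp_log hW, neg_one_mul]

theorem norm_negRoot_pow {N : ℕ} (hN : N ≠ 0) {W : ℂ} (hW : W ≠ 0) (l : ℕ) :
    ‖negRoot N W l‖ ^ N = ‖W‖ := by
  rw [← norm_pow, negRoot_pow hN hW, norm_neg]

theorem sum_negRoot_zpow (N : ℕ) (W : ℂ) (e : ℤ) :
    ∑ l ∈ Finset.range N, negRoot N W l ^ e =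
      Complex.exp (e * (Complex.log W / N)) * ∑ l ∈ Finset.range N, rootNegOne N l ^ e := by
  rw [Finset.mul_sum]
  refine Finset.sum_congr rfl fun l _ ↦ ?_
  rw [negRoot, mul_zpow, Complex.exp_int_mul, mul_comm]

theorem sum_negRoot_zpow_of_not_dvd {N : ℕ} (hN : N ≠ 0) (W : ℂ) {e : ℤ} (he : ¬ (N : ℤ) ∣ e) :
    ∑ l ∈ Finset.range N, negRoot N W l ^ e = 0 := by
  rw [sum_negRoot_zpow, sum_rootNegOne_zpow_of_not_dvd hN he, mul_zero]

theorem sum_negRoot_zpow_mul {N : ℕ} (hN : N ≠ 0) {W : ℂ} (hW : W ≠ 0) (q : ℤ) :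
    ∑ l ∈ Finset.range N, negRoot N W l ^ (N * q : ℤ) = N * (-W) ^ q := by
  simp only [zpow_mul, zpow_natCast, negRoot_pow hN hW, Finset.sum_const, Finset.card_range,
    nsmul_eq_mul]

theorem sum_negRoot_one_sub {k N : ℕ} (hk : 1 ≤ k) (hkN : k ≤ N) (W : ℂ) :
    ∑ l ∈ Finset.range N, negRoot N W l ^ (1 - k : ℤ) = if k = 1 then (N : ℂ) else 0 := by
  split_ifs with h
  · subst h; simp
  · refine sum_negRoot_zpow_of_not_dvd (by lia) W fun hd ↦ ?_
    have := Int.le_of_dvd (by lia) ((dvd_neg).2 hd)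
    lia

/-- Partial fractions: with b a root of -W, 1/(a-b) = ∑ a^i b^(N-1-i)/(a^N+W). After weighting by
b^(1-k) and summing over the roots, only i = N-k survives, all other exponents of b lying strictly
between -N and N. -/
theorem sum_negRoot_div {k N : ℕ} (hk : 1 ≤ k) (hkN : k ≤ N) {W : ℂ} (hW : W ≠ 0) {a : ℂ}
    (ha : a ^ N + W ≠ 0) :
    ∑ l ∈ Finset.range N, negRoot N W l ^ (1 - k : ℤ) * (1 / (a - negRoot N W l)) =
      N * (a ^ (N - k) / (a ^ N + W)) := by
  have hN : N ≠ 0 := by lia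
  have h1 : ∀ l, 1 / (a - negRoot N W l) =
      (∑ i ∈ Finset.range N, a ^ i * negRoot N W l ^ (N - 1 - i)) / (a ^ N + W) := by
    intro l
    have h := (Commute.all a (negRoot N W l)).geom_sum₂_mul N
    rw [negRoot_pow hN hW, sub_neg_eq_add] at h
    have h2 : a - negRoot N W l ≠ 0 := by
      intro h0
      rw [h0, mul_zero] at h
      exact ha h.symm
    rw [div_eq_div_iff h2 ha, one_mul, h]
  have h2 : ∀ i ∈ Finset.range N, ∑ l ∈ Finset.range N, negRoot N W l ^ (1 - k : ℤ) *
      negRoot N W l ^ (N - 1 - i) = if i = N - k then (N : ℂ) else 0 := by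
    intro i hi
    have hi := Finset.mem_range.1 hi
    have h3 : ∀ l, negRoot N W l ^ (1 - k : ℤ) * negRoot N W l ^ (N - 1 - i) =
        negRoot N W l ^ ((N : ℤ) - k - i) := by
      intro l
      rw [← zpow_natCast, ← zpow_add₀ (negRoot_ne_zero N W l)]
      congr 1
      lia
    simp only [h3]
    split_ifs with h
    · have : (N : ℤ) - k - i = 0 := by lia
      simp [this]
    · refine sum_negRoot_zpow_of_not_dvd hN W fun hd ↦ ?_
      rcases lt_trichotomy ((N : ℤ) - k - i) 0 with h0 | h0 | h0
      · have := Int.le_of_dvd (by lia) ((dvd_neg).2 hd)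
        lia
      · lia
      · have := Int.le_of_dvd h0 hd
        lia
  calc ∑ l ∈ Finset.range N, negRoot N W l ^ (1 - k : ℤ) * (1 / (a - negRoot N W l))
      = (∑ i ∈ Finset.range N, a ^ i * ∑ l ∈ Finset.range N, negRoot N W l ^ (1 - k : ℤ) *
          negRoot N W l ^ (N - 1 - i)) / (a ^ N + W) := by
        simp only [h1, Finset.mul_sum, Finset.sum_div, mul_div_assoc']
        rw [Finset.sum_comm]
        refine Finset.sum_congr rfl fun i _ ↦ Finset.sum_congr rfl fun l _ ↦ ?_
        ring
    _ = (∑ i ∈ Finset.range N, a ^ i * if i = N - k then (N : ℂ) else 0) / (a ^ N + W) := by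
        rw [Finset.sum_congr rfl fun i hi ↦ by rw [h2 i hi]]
    _ = _ := by
        simp only [mul_ite, mul_zero]
        rw [Finset.sum_ite_eq' (Finset.range N) (N - k), if_pos (Finset.mem_range.2 (by lia))]
        ring

theorem neg_negRoot_eq_exp {N : ℕ} (hN : N ≠ 0) (W : ℂ) (l : ℕ) :
    -negRoot N W l = Complex.exp (Complex.log W / N + rootAngle N l * Complex.I) := by
  have hN' : (N : ℂ) ≠ 0 := by exact_mod_cast hN
  have h : (Complex.log W / N + rootAngle N l * Complex.I) + Real.pi * Complex.I =
      Real.pi * Complex.I * (2 * l + 1) / N + Complex.log W / N := by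
    rw [rootAngle]; push_cast; field_simp; ring
  have h2 := congrArg Complex.exp h
  rw [Complex.exp_add_pi_mul_I, Complex.exp_add _ (Complex.log W / N)] at h2
  rw [negRoot, rootNegOne, ← h2, neg_neg]

theorem abs_rootAngle_le {N l : ℕ} (hl : l < N) : |rootAngle N l| ≤ Real.pi * (N - 1) / N := by
  have hN0 : (0 : ℝ) < N := by exact_mod_cast (Nat.zero_le l).trans_lt hl
  rw [rootAngle, abs_div, abs_mul, abs_of_pos Real.pi_pos, abs_of_pos hN0]
  have : (l : ℝ) + 1 ≤ N := by exact_mod_cast hl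
  have : (0 : ℝ) ≤ l := Nat.cast_nonneg l
  have h3 : |2 * (l : ℝ) + 1 - N| ≤ N - 1 := by rw [abs_le]; constructor <;> linarith
  have := Real.pi_pos
  gcongr

/-- The candidate argument is at most (π-δ)/N + π(N-1)/N = π - δ/N in absolute value, so it is
principal. The sector shrinks only to the angle δ/N, and the digamma expansion still applies
uniformly. -/
theorem log_neg_negRoot {N l : ℕ} (hl : l < N) {δ : ℝ} (hδ : 0 < δ) {W : ℂ} (hW : W ∈ sector δ) :
    Complex.log (-negRoot N W l) = Complex.log W / N + rootAngle N l * Complex.I ∧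
      -negRoot N W l ∈ sector (δ / N) := by
  have hN : N ≠ 0 := by lia
  have hN0 : (0 : ℝ) < N := by exact_mod_cast Nat.pos_of_ne_zero hN
  set u := Complex.log W / N + rootAngle N l * Complex.I
  have him : u.im = W.arg / N + rootAngle N l := by
    simp [u, Complex.div_natCast_im, Complex.log_im]
  have hθ := abs_rootAngle_le hl
  have hb : |u.im| ≤ Real.pi - δ / N := by
    rw [him]
    refine (abs_add_le _ _).trans ?_
    have h4 : |W.arg / N| ≤ (Real.pi - δ) / N := by
      rw [abs_div, abs_of_pos hN0]
      gcongr
      exact hW.2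
    refine (add_le_add h4 hθ).trans (le_of_eq ?_)
    field_simp
    ring
  have hb' := abs_le.1 hb
  have hpos : 0 < δ / N := by positivity
  have hlog : Complex.log (-negRoot N W l) = u := by
    rw [neg_negRoot_eq_exp hN]
    exact Complex.log_exp (by linarith) (by linarith)
  have harg : (-negRoot N W l).arg = u.im := by rw [← Complex.log_im, hlog]
  refine ⟨hlog, Complex.mem_slitPlane_iff_arg.2 ⟨?_, neg_ne_zero.2 (negRoot_ne_zero N W l)⟩, ?_⟩
  · rw [harg]; intro h; linarith
  · rw [harg]; exact hb

/-- The partial fraction expansion of the digamma function. -/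
theorem hasSum_digamma_add_one {z : ℂ} (hz : z ∈ Complex.slitPlane) :
    HasSum (fun n : ℕ ↦ 1 / ((n + 1 : ℕ) : ℂ) - 1 / (((n + 1 : ℕ) : ℂ) + z))
      (Complex.digamma (z + 1) + Real.eulerMascheroniConstant) := by
  obtain ⟨δ, hδ, hδπ, hzδ⟩ := exists_mem_sector hz
  set c := Real.sin (δ / 2)
  have hc : 0 < c := sin_half_pos hδ hδπ
  have hs : Summable fun n : ℕ ↦ 1 / ((n + 1 : ℕ) : ℂ) - 1 / (((n + 1 : ℕ) : ℂ) + z) := by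
    refine Summable.of_norm_bounded (((summable_nat_add_iff 1).2
      (Real.summable_one_div_nat_pow.2 one_lt_two)).mul_left (‖z‖ / c)) fun n ↦ ?_
    have h0 : ((n + 1 : ℕ) : ℂ) ≠ 0 := Nat.cast_ne_zero.2 n.succ_ne_zero
    have h1 : ((n + 1 : ℕ) : ℂ) + z ≠ 0 := by
      rw [add_comm]; exact add_natCast_ne_zero hz (n + 1)
    have h2 : 1 / ((n + 1 : ℕ) : ℂ) - 1 / (((n + 1 : ℕ) : ℂ) + z) =
        z / (((n + 1 : ℕ) : ℂ) * (((n + 1 : ℕ) : ℂ) + z)) := by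
      field_simp; ring
    have h3 : c * ((n + 1 : ℕ) : ℝ) ≤ ‖((n + 1 : ℕ) : ℂ) + z‖ := by
      have := sin_half_mul_le_norm_add hδ hzδ (Nat.cast_nonneg (n + 1))
      rw [Complex.ofReal_natCast, add_comm z] at this
      refine le_trans ?_ this
      have := norm_nonneg z
      exact mul_le_mul_of_nonneg_left (by linarith) hc.le
    rw [h2, norm_div, norm_mul, Complex.norm_natCast]
    calc ‖z‖ / (((n + 1 : ℕ) : ℝ) * ‖((n + 1 : ℕ) : ℂ) + z‖)
        ≤ ‖z‖ / (((n + 1 : ℕ) : ℝ) * (c * ((n + 1 : ℕ) : ℝ))) := by gcongr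
      _ = _ := by field_simp
  rw [hs.hasSum_iff_tendsto_nat]
  have hz1 : z + 1 ∈ Complex.slitPlane := by simpa using add_mem_slitPlane hz zero_le_one
  have h4 : Tendsto (fun n : ℕ ↦ (((harmonic n : ℚ) - Real.log n : ℝ) : ℂ)) atTop
    (𝓝 (Real.eulerMascheroniConstant : ℂ)) :=
    (Complex.continuous_ofReal.tendsto _).comp Real.tendsto_harmonic_sub_log
  refine ((tendsto_log_sub_sum_digamma hz1).add h4).congr fun n ↦ ?_
  rw [Finset.sum_sub_distrib, harmonic]
  have : ∑ j ∈ Finset.range n, 1 / (z + 1 + j) =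
      ∑ j ∈ Finset.range n, 1 / (((j + 1 : ℕ) : ℂ) + z) :=
    Finset.sum_congr rfl fun j _ ↦ by push_cast; ring_nf
  rw [this]
  push_cast
  simp only [one_div]
  ring

theorem natCast_pow_add_ne_zero {W : ℂ} (hW : W ∈ Complex.slitPlane) (m N : ℕ) :
    (m : ℂ) ^ N + W ≠ 0 := by
  rw [add_comm]
  exact_mod_cast add_natCast_ne_zero hW (m ^ N)

/-- The convergence-making terms 1/n enter with weight ∑ b^(1-k) over the roots b, which is N for k
= 1 and 0 otherwise; hence the subtraction for k = 1 alone. -/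
theorem hasSum_pow_div_pow_add {k N : ℕ} (hk : 1 ≤ k) (hkN : k ≤ N) {W : ℂ}
    (hW : W ∈ Complex.slitPlane) :
    HasSum (fun n : ℕ ↦ ((n + 1 : ℕ) : ℂ) ^ (N - k) / (((n + 1 : ℕ) : ℂ) ^ N + W) -
        if k = 1 then 1 / ((n + 1 : ℕ) : ℂ) else 0)
      (-(1 / N) * ∑ l ∈ Finset.range N, negRoot N W l ^ (1 - k : ℤ) *
        (Complex.digamma (-negRoot N W l + 1) + Real.eulerMascheroniConstant)) := by
  have hN' : (N : ℂ) ≠ 0 := by exact_mod_cast (by lia : N ≠ 0)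
  have hW0 := Complex.slitPlane_ne_zero hW
  obtain ⟨δ, hδ, hδπ, hWδ⟩ := exists_mem_sector hW
  have h := (hasSum_sum fun l (hl : l ∈ Finset.range N) ↦ (hasSum_digamma_add_one
    (log_neg_negRoot (Finset.mem_range.1 hl) hδ hWδ).2.1).mul_left
      (negRoot N W l ^ (1 - k : ℤ))).mul_left (-(1 / N : ℂ))
  refine h.congr_fun fun n ↦ ?_
  have h1 := sum_negRoot_div hk hkN hW0 (natCast_pow_add_ne_zero hW (n + 1) N)
  have h2 := sum_negRoot_one_sub hk hkN W
  simp only [mul_sub, Finset.sum_sub_distrib, ← Finset.sum_mul]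
  simp only [← sub_eq_add_neg]
  rw [h1, h2]
  split_ifs with h <;> field_simp <;> ring


/-! ### Expansion of `powSum` for large W. -/

theorem riemannZeta_one_sub_of_odd {m : ℕ} (hm : 2 ≤ m) (ho : Odd m) :
    riemannZeta (1 - m) = 0 := by
  rw [riemannZeta_one_sub_natCast (by lia), bernoulli_eq_zero_of_odd ho (by lia)]
  simp

/-- The extra 1/z in ψ(z+1) flips the sign of the ζ(0) term, and the other odd terms vanish. At z =
-b the expansion is therefore in powers of the root b itself. -/
theorem sum_riemannZeta_inv_neg_pow {M : ℕ} (hM : 1 ≤ M) (z : ℂ) :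
    ∑ m ∈ Finset.Icc 1 M, riemannZeta (1 - m) * (z ^ m)⁻¹ + z⁻¹ =
      ∑ m ∈ Finset.Icc 1 M, riemannZeta (1 - m) * ((-z) ^ m)⁻¹ := by
  induction M, hM using Nat.le_induction with
  | base =>
    simp only [Finset.Icc_self, Finset.sum_singleton, Nat.cast_one, sub_self, riemannZeta_zero,
      pow_one, inv_neg]
    ring
  | succ M hM ih =>
    rw [Finset.sum_Icc_succ_top (by lia), Finset.sum_Icc_succ_top (by lia), ← ih]
    rcases Nat.even_or_odd (M + 1) with h | h
    · rw [h.neg_pow]; ring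
    · rw [riemannZeta_one_sub_of_odd (by lia) h]; ring

theorem exists_norm_digamma_add_one_sub_le {δ : ℝ} (hδ : 0 < δ) (hδπ : δ < Real.pi) (M : ℕ) :
    ∃ R K : ℝ, 2 ≤ R ∧ 0 ≤ K ∧ ∀ z ∈ sector δ, R ≤ ‖z‖ →
      ‖Complex.digamma (z + 1) - (Complex.log z + ∑ m ∈ Finset.Icc 1 M,
        riemannZeta (1 - m) * ((-z) ^ m)⁻¹)‖ ≤ K / ‖z‖ ^ (M + 1) := by
  obtain ⟨R, K, hR, hK, h⟩ := exists_norm_digamma_sub_le hδ hδπ M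
  refine ⟨R, K + 1, hR, by positivity, fun z hz hzR ↦ ?_⟩
  have h1 := h z hz hzR
  rw [Complex.digamma_apply_add_one z fun m hm ↦ add_natCast_ne_zero hz.1 m (by rw [hm]; ring)]
  have h0 : (0 : ℝ) < ‖z‖ := by linarith
  rcases Nat.eq_zero_or_pos M with rfl | hM
  -- With no terms kept, 1/z has nothing to combine with and goes into the error; this is why the
  -- constant is K + 1.
  · simp only [digammaApprox, Finset.Icc_eq_empty_of_lt zero_lt_one, Finset.sum_empty, add_zero,
      zero_add, pow_one] at h1 ⊢
    rw [add_sub_right_comm, add_div]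
    refine (norm_add_le _ _).trans (add_le_add h1 (by rw [norm_inv, one_div]))
  · rw [← sum_riemannZeta_inv_neg_pow hM]
    rw [digammaApprox] at h1
    have : Complex.digamma z + z⁻¹ - (Complex.log z + (∑ m ∈ Finset.Icc 1 M,
        riemannZeta (1 - m) * (z ^ m)⁻¹ + z⁻¹)) = Complex.digamma z - (Complex.log z +
        ∑ m ∈ Finset.Icc 1 M, riemannZeta (1 - m) * (z ^ m)⁻¹) := by ring
    rw [this]
    refine h1.trans ?_
    gcongr
    linarith

/-- The sum `∑ n ≥ 1, n ^ (N - k) / (n ^ N + W)`, with the divergent part `1 / n` of the summand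
removed if `k = 1`. -/
noncomputable def powSum (k N : ℕ) (W : ℂ) : ℂ :=
  ∑' n : ℕ, (((n + 1 : ℕ) : ℂ) ^ (N - k) / (((n + 1 : ℕ) : ℂ) ^ N + W) -
    if k = 1 then 1 / ((n + 1 : ℕ) : ℂ) else 0)

/-- The leading part of `powSum k N W` as `W → ∞`. -/
noncomputable def powSumMain (k N : ℕ) (W : ℂ) : ℂ :=
  if k = 1 then -(Real.eulerMascheroniConstant + Complex.log W / N) else
    Real.pi / N / Complex.sin (Real.pi / N * (k - 1)) *
      Complex.exp ((1 - k : ℤ) * (Complex.log W / N))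

theorem sum_negRoot_mul_log_eq {k N : ℕ} (hk : 1 ≤ k) (hkN : k ≤ N) {δ : ℝ} (hδ : 0 < δ) {W : ℂ}
    (hW : W ∈ sector δ) :
    -(1 / N) * ∑ l ∈ Finset.range N, negRoot N W l ^ (1 - k : ℤ) *
      (Complex.log (-negRoot N W l) + Real.eulerMascheroniConstant) = powSumMain k N W := by
  have hN' : (N : ℂ) ≠ 0 := by exact_mod_cast (by lia : N ≠ 0)
  have h1 : ∑ l ∈ Finset.range N, negRoot N W l ^ (1 - k : ℤ) *
      (Complex.log (-negRoot N W l) + Real.eulerMascheroniConstant) =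
      (∑ l ∈ Finset.range N, negRoot N W l ^ (1 - k : ℤ)) *
        (Complex.log W / N + Real.eulerMascheroniConstant) +
      Complex.exp ((1 - k : ℤ) * (Complex.log W / N)) *
        ∑ l ∈ Finset.range N, rootNegOne N l ^ (1 - k : ℤ) * (rootAngle N l * Complex.I) := by
    rw [Finset.sum_mul, Finset.mul_sum, ← Finset.sum_add_distrib]
    refine Finset.sum_congr rfl fun l hl ↦ ?_
    rw [(log_neg_negRoot (Finset.mem_range.1 hl) hδ hW).1]
    have : negRoot N W l ^ (1 - k : ℤ) = rootNegOne N l ^ (1 - k : ℤ) *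
        Complex.exp ((1 - k : ℤ) * (Complex.log W / N)) := by
      rw [negRoot, mul_zpow, Complex.exp_int_mul]
    rw [this]
    ring
  rw [h1, sum_negRoot_one_sub hk hkN, powSumMain]
  split_ifs with h
  · subst h
    have := sum_rootAngle N
    simp only [Nat.cast_one, sub_self, zpow_zero, one_mul, ← Finset.sum_mul, this]
    field_simp
    ring
  · rw [sum_rootNegOne_zpow_mul_angle (by lia) hkN]
    ring

/-- The power sum vanishes unless m = qN + 1 - k. The cutoff (Q+1)N - k stops just before the index
belonging to q = Q+1. -/
theorem sum_riemannZeta_mul_negRoot {k N : ℕ} (hk : 1 ≤ k) (hkN : k ≤ N) (Q : ℕ) {W : ℂ}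
    (hW : W ≠ 0) :
    ∑ m ∈ Finset.Icc 1 ((Q + 1) * N - k), riemannZeta (1 - m) *
      ∑ l ∈ Finset.range N, negRoot N W l ^ (1 - k - m : ℤ) =
    N * ∑ q ∈ Finset.Icc 1 Q, (-1) ^ q * riemannZeta (k - q * N) * (W ^ q)⁻¹ := by
  have hN : N ≠ 0 := by lia
  rw [Finset.mul_sum]
  symm
  have hle : ∀ q : ℕ, 1 ≤ q → k ≤ q * N := fun q hq ↦ hkN.trans (Nat.le_mul_of_pos_left N hq)
  refine Finset.sum_of_injOn (fun q ↦ q * N + 1 - k) ?_ ?_ ?_ ?_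
  · intro q hq q' hq' h
    have h1 := hle q (Finset.mem_Icc.1 (Finset.mem_coe.1 hq)).1
    have h2 := hle q' (Finset.mem_Icc.1 (Finset.mem_coe.1 hq')).1
    exact Nat.eq_of_mul_eq_mul_right (Nat.pos_of_ne_zero hN) (by simp only at h; lia)
  · intro q hq
    obtain ⟨h1, h2⟩ := Finset.mem_Icc.1 (Finset.mem_coe.1 hq)
    have h3 := hle q h1
    have h4 : q * N ≤ Q * N := Nat.mul_le_mul_right N h2
    have h5 : (Q + 1) * N = Q * N + N := by ring
    exact Finset.mem_coe.2 (Finset.mem_Icc.2 ⟨by lia, by lia⟩)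
  · intro m hm hm'
    obtain ⟨h1, h2⟩ := Finset.mem_Icc.1 hm
    rw [sum_negRoot_zpow_of_not_dvd hN, mul_zero]
    rintro ⟨q, hq⟩
    have hq0 : q ≤ 0 := by
      by_contra hq1
      have : (N : ℤ) * 1 ≤ N * q := by gcongr; lia
      lia
    obtain ⟨p, rfl⟩ : ∃ p : ℕ, q = -p := ⟨q.natAbs, by lia⟩
    have hp : p * N + 1 = m + k := by
      zify
      linear_combination hq
    refine hm' ⟨p, Finset.mem_coe.2 (Finset.mem_Icc.2 ⟨?_, ?_⟩), by simp only; lia⟩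
    · rcases Nat.eq_zero_or_pos p with rfl | h
      · lia
      · exact h
    · by_contra hpQ
      have : (Q + 1) * N ≤ p * N := Nat.mul_le_mul_right N (by lia)
      lia
  · intro q hq
    have h3 := hle q (Finset.mem_Icc.1 hq).1
    have h4 : (1 - k - (q * N + 1 - k : ℕ) : ℤ) = N * (-q : ℤ) := by
      rw [Nat.cast_sub (by lia)]; push_cast; ring
    have h5 : (1 - ((q * N + 1 - k : ℕ) : ℂ)) = k - q * N := by
      rw [Nat.cast_sub (by lia)]; push_cast; ring
    rw [h4, h5, sum_negRoot_zpow_mul hN hW, zpow_neg, zpow_natCast, neg_pow W, mul_inv,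
      ← inv_pow (-1 : ℂ), inv_neg_one]
    ring

theorem exists_norm_powSum_sub_le {k N : ℕ} (hk : 1 ≤ k) (hkN : k ≤ N) {δ : ℝ} (hδ : 0 < δ)
    (hδπ : δ < Real.pi) (Q : ℕ) :
    ∃ R K : ℝ, 0 < R ∧ 0 ≤ K ∧ ∀ W ∈ sector δ, R ≤ ‖W‖ →
      ‖powSum k N W - powSumMain k N W + ∑ q ∈ Finset.Icc 1 Q,
        (-1) ^ q * riemannZeta (k - q * N) * (W ^ q)⁻¹‖ ≤ K / ‖W‖ ^ (Q + 1) := by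
  have hN : N ≠ 0 := by lia
  have hN1 : (1 : ℝ) ≤ N := by exact_mod_cast Nat.one_le_iff_ne_zero.2 hN
  have hN' : (N : ℂ) ≠ 0 := by exact_mod_cast hN
  have hδN : δ / N < Real.pi := (div_le_self hδ.le hN1).trans_lt hδπ
  obtain ⟨R, K, hR, hK, h⟩ := exists_norm_digamma_add_one_sub_le
    (div_pos hδ (by linarith : (0 : ℝ) < N)) hδN ((Q + 1) * N - k)
  refine ⟨R ^ N, K, by positivity, hK, fun W hW hWR ↦ ?_⟩
  have hW0 := Complex.slitPlane_ne_zero hW.1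
  rw [powSum, (hasSum_pow_div_pow_add hk hkN hW.1).tsum_eq, ← sum_negRoot_mul_log_eq hk hkN hδ hW]
  have hsum := sum_riemannZeta_mul_negRoot hk hkN Q hW0
  set S := ∑ q ∈ Finset.Icc 1 Q, (-1) ^ q * riemannZeta (k - q * N) * (W ^ q)⁻¹
  have hS : S = 1 / N * ∑ l ∈ Finset.range N, negRoot N W l ^ (1 - k : ℤ) *
      ∑ m ∈ Finset.Icc 1 ((Q + 1) * N - k), riemannZeta (1 - m) * ((- -negRoot N W l) ^ m)⁻¹ := by
    rw [one_div, eq_inv_mul_iff_mul_eq₀ hN', ← hsum]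
    simp only [Finset.mul_sum]
    rw [Finset.sum_comm]
    refine Finset.sum_congr rfl fun l _ ↦ Finset.sum_congr rfl fun m _ ↦ ?_
    rw [zpow_sub₀ (negRoot_ne_zero N W l), zpow_natCast, neg_neg]
    ring
  have heq : -(1 / N) * ∑ l ∈ Finset.range N, negRoot N W l ^ (1 - k : ℤ) *
        (Complex.digamma (-negRoot N W l + 1) + Real.eulerMascheroniConstant) -
      -(1 / N) * ∑ l ∈ Finset.range N, negRoot N W l ^ (1 - k : ℤ) *
        (Complex.log (-negRoot N W l) + Real.eulerMascheroniConstant) + S =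
      -(1 / N) * ∑ l ∈ Finset.range N, negRoot N W l ^ (1 - k : ℤ) *
        (Complex.digamma (-negRoot N W l + 1) - (Complex.log (-negRoot N W l) +
          ∑ m ∈ Finset.Icc 1 ((Q + 1) * N - k), riemannZeta (1 - m) *
            ((- -negRoot N W l) ^ m)⁻¹)) := by
    rw [hS]
    simp only [mul_sub, mul_add, Finset.sum_sub_distrib, Finset.sum_add_distrib]
    ring
  rw [heq, norm_mul, norm_neg, norm_div, norm_one, Complex.norm_natCast]
  have hterm : ∀ l ∈ Finset.range N, ‖negRoot N W l ^ (1 - k : ℤ) *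
        (Complex.digamma (-negRoot N W l + 1) - (Complex.log (-negRoot N W l) +
          ∑ m ∈ Finset.Icc 1 ((Q + 1) * N - k), riemannZeta (1 - m) *
            ((- -negRoot N W l) ^ m)⁻¹))‖ ≤ K / ‖W‖ ^ (Q + 1) := by
    intro l hl
    have hb0 : 0 < ‖negRoot N W l‖ := norm_pos_iff.2 (negRoot_ne_zero N W l)
    have hbR : R ≤ ‖-negRoot N W l‖ := by
      rw [norm_neg]
      refine le_of_pow_le_pow_left₀ hN hb0.le ?_
      rw [norm_negRoot_pow hN hW0]
      exact hWR
    have hb := h _ (log_neg_negRoot (Finset.mem_range.1 hl) hδ hW).2 hbR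
    have hpow : ‖negRoot N W l‖ ^ (1 - k : ℤ) = (‖negRoot N W l‖ ^ (k - 1))⁻¹ := by
      rw [← zpow_natCast, ← zpow_neg]; congr 1; lia
    -- The weight b^(1-k) and the digamma error together have degree exactly -(Q+1)N in b, that is,
    -- -(Q+1) in W.
    have hmul : ‖negRoot N W l‖ ^ (k - 1) * ‖negRoot N W l‖ ^ ((Q + 1) * N - k + 1) =
        ‖W‖ ^ (Q + 1) := by
      rw [← norm_negRoot_pow hN hW0 l, ← pow_mul, ← pow_add]
      congr 1
      have : k ≤ (Q + 1) * N := hkN.trans (Nat.le_mul_of_pos_left N (by lia))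
      rw [mul_comm N]
      lia
    rw [norm_mul, norm_zpow, hpow, ← hmul]
    rw [norm_neg] at hb
    calc _ ≤ (‖negRoot N W l‖ ^ (k - 1))⁻¹ * (K / ‖negRoot N W l‖ ^ ((Q + 1) * N - k + 1)) := by
          gcongr
      _ = _ := by field_simp
  calc _ ≤ 1 / (N : ℝ) * ∑ l ∈ Finset.range N, K / ‖W‖ ^ (Q + 1) := by
        gcongr
        exact norm_sum_le_of_le _ hterm
    _ = _ := by
        rw [Finset.sum_const, Finset.card_range, nsmul_eq_mul]
        field_simp

/-! ### Summation over j and the sign pattern of the coefficients. -/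

theorem hasSum_inv_pow_riemannZeta {q : ℕ} (hq : 2 ≤ q) :
    HasSum (fun j : ℕ ↦ (((j + 1 : ℕ) : ℂ) ^ q)⁻¹) (riemannZeta q) := by
  have h := hasSum_rpow_neg_riemannZeta (s := q) (by exact_mod_cast hq)
  rw [Complex.ofReal_natCast] at h
  refine h.congr_fun fun j ↦ ?_
  rw [Real.rpow_neg (Nat.cast_nonneg _), Real.rpow_natCast]
  push_cast
  rfl

/-- The part of the small-argument expansion of the Herglotz function carrying the integral powers
of the variable. -/
theorem exists_norm_tsum_powSum_le {k N : ℕ} (hk : 1 ≤ k) (hkN : k ≤ N) {δ : ℝ} (hδ : 0 < δ)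
    (hδπ : δ < Real.pi) (Q : ℕ) :
    ∃ r K : ℝ, 0 < r ∧ ∀ x ∈ sector δ, ‖x‖ ≤ r →
      (Summable fun j : ℕ ↦ (powSum k N ((j + 1 : ℕ) * x⁻¹) - powSumMain k N ((j + 1 : ℕ) * x⁻¹)) /
        ((j + 1 : ℕ) : ℂ)) ∧
      ‖∑' j : ℕ, (powSum k N ((j + 1 : ℕ) * x⁻¹) - powSumMain k N ((j + 1 : ℕ) * x⁻¹)) /
        ((j + 1 : ℕ) : ℂ) + ∑ q ∈ Finset.Icc 1 Q,
          (-1) ^ q * riemannZeta (k - q * N) * riemannZeta (1 + q) * x ^ q‖ ≤ K * ‖x‖ ^ (Q + 1) := by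
  obtain ⟨R, K, hR, hK, h⟩ := exists_norm_powSum_sub_le hk hkN hδ hδπ Q
  have hZ : Summable fun j : ℕ ↦ 1 / (((j + 1 : ℕ) : ℝ) ^ (Q + 2)) :=
    (summable_nat_add_iff 1).2 (Real.summable_one_div_nat_pow.2 (by lia))
  refine ⟨1 / R, K * ∑' j : ℕ, 1 / (((j + 1 : ℕ) : ℝ) ^ (Q + 2)), by positivity,
    fun x hx hxr ↦ ?_⟩
  have hx0 : x ≠ 0 := Complex.slitPlane_ne_zero hx.1
  have hx0' : 0 < ‖x‖ := norm_pos_iff.2 hx0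
  have hj0 : ∀ j : ℕ, ((j + 1 : ℕ) : ℂ) ≠ 0 := fun j ↦ Nat.cast_ne_zero.2 j.succ_ne_zero
  have hterm : ∀ j : ℕ, ‖(powSum k N ((j + 1 : ℕ) * x⁻¹) - powSumMain k N ((j + 1 : ℕ) * x⁻¹)) /
        ((j + 1 : ℕ) : ℂ) + ∑ q ∈ Finset.Icc 1 Q, (-1) ^ q * riemannZeta (k - q * N) * x ^ q *
          (((j + 1 : ℕ) : ℂ) ^ (1 + q))⁻¹‖ ≤
      K * ‖x‖ ^ (Q + 1) * (1 / (((j + 1 : ℕ) : ℝ) ^ (Q + 2))) := by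
    intro j
    have hjp : (0 : ℝ) < ((j + 1 : ℕ) : ℝ) := by positivity
    have hW : ((j + 1 : ℕ) : ℂ) * x⁻¹ ∈ sector δ := by
      simpa using ofReal_mul_mem_sector (inv_mem_sector hx) hjp
    have hWn : ‖((j + 1 : ℕ) : ℂ) * x⁻¹‖ = ((j + 1 : ℕ) : ℝ) / ‖x‖ := by
      rw [norm_mul, norm_inv, Complex.norm_natCast, div_eq_mul_inv]
    have hWR : R ≤ ‖((j + 1 : ℕ) : ℂ) * x⁻¹‖ := by
      rw [hWn, le_div_iff₀ hx0']
      rw [le_div_iff₀ hR] at hxr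
      have : (1 : ℝ) ≤ ((j + 1 : ℕ) : ℝ) := by simp
      linarith
    have h1 := h _ hW hWR
    have h2 : (powSum k N ((j + 1 : ℕ) * x⁻¹) - powSumMain k N ((j + 1 : ℕ) * x⁻¹)) /
        ((j + 1 : ℕ) : ℂ) + ∑ q ∈ Finset.Icc 1 Q, (-1) ^ q * riemannZeta (k - q * N) * x ^ q *
          (((j + 1 : ℕ) : ℂ) ^ (1 + q))⁻¹ =
        (powSum k N ((j + 1 : ℕ) * x⁻¹) - powSumMain k N ((j + 1 : ℕ) * x⁻¹) +
          ∑ q ∈ Finset.Icc 1 Q, (-1) ^ q * riemannZeta (k - q * N) *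
            ((((j + 1 : ℕ) : ℂ) * x⁻¹) ^ q)⁻¹) / ((j + 1 : ℕ) : ℂ) := by
      rw [add_div _ _ ((j + 1 : ℕ) : ℂ), Finset.sum_div]
      congr 1
      refine Finset.sum_congr rfl fun q _ ↦ ?_
      have := hj0 j
      rw [mul_pow, inv_pow, mul_inv, inv_inv, pow_add, pow_one, mul_inv]
      field_simp
    rw [h2, norm_div, Complex.norm_natCast, div_le_iff₀ hjp]
    refine h1.trans (le_of_eq ?_)
    rw [hWn, div_pow, pow_succ (((j + 1 : ℕ) : ℝ)) (Q + 1)]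
    field_simp
  have hzeta := hasSum_sum fun q (hq : q ∈ Finset.Icc 1 Q) ↦
    (hasSum_inv_pow_riemannZeta (q := 1 + q) (by have := (Finset.mem_Icc.1 hq).1; lia)).mul_left
      ((-1) ^ q * riemannZeta (k - q * N) * x ^ q)
  have hs1 := Summable.of_norm_bounded (hZ.mul_left (K * ‖x‖ ^ (Q + 1))) hterm
  have hs2 := (hs1.sub hzeta.summable)
  simp only [add_sub_cancel_right] at hs2
  refine ⟨hs2, ?_⟩
  have h3 := tsum_of_norm_bounded (hZ.mul_left (K * ‖x‖ ^ (Q + 1))).hasSum hterm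
  rw [(hs2.hasSum.add hzeta).tsum_eq, tsum_mul_left] at h3
  convert! h3 using 1
  · congr 2
    refine Finset.sum_congr rfl fun q _ ↦ ?_
    push_cast
    ring
  · ring

/-- Parity of the coefficients at the integral powers. -/
theorem neg_one_pow_mul_riemannZeta {k N m : ℕ} (hk : 1 ≤ k) (hkN : k ≤ N) (hm : 1 ≤ m) :
    (-1) ^ k * ((-1) ^ (m * (N + 1)) * riemannZeta (k - m * N) * riemannZeta (1 + m)) =
      -((-1) ^ m * riemannZeta (k - m * N) * riemannZeta (1 + m)) +
        if k = N ∧ m = 1 then riemannZeta 2 else 0 := by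
  have hle : k ≤ m * N := hkN.trans (Nat.le_mul_of_pos_left N hm)
  split_ifs with h
  · obtain ⟨rfl, rfl⟩ := h
    have h1 : ((-1 : ℂ) ^ k) * (-1) ^ k = 1 := by rw [← mul_pow]; simp
    simp only [Nat.cast_one, one_mul, sub_self, riemannZeta_zero, pow_succ, pow_zero]
    rw [one_add_one_eq_two]
    linear_combination (1 / 2 * riemannZeta 2) * h1
  · have hlt : k < m * N := by
      refine lt_of_le_of_ne hle fun heq ↦ h ?_
      have hkN' : k = N := by
        have := Nat.le_mul_of_pos_left N hm
        lia
      refine ⟨hkN', ?_⟩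
      subst hkN'
      exact (Nat.eq_of_mul_eq_mul_right hk (by rw [one_mul]; exact heq)).symm
    obtain ⟨e, he⟩ := Nat.exists_eq_add_of_lt hlt
    have harg : (k : ℂ) - m * N = -((e + 1 : ℕ) : ℂ) := by
      have := congrArg (Nat.cast : ℕ → ℂ) he
      push_cast at this ⊢
      linear_combination -this
    rw [harg, add_zero]
    rcases Nat.even_or_odd (e + 1) with ho | ho
    · obtain ⟨p, hp⟩ := ho
      obtain ⟨p, rfl⟩ : ∃ p', p = p' + 1 := ⟨p - 1, by lia⟩
      have : riemannZeta (-((e + 1 : ℕ) : ℂ)) = 0 := by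
        rw [hp, ← riemannZeta_neg_two_mul_nat_add_one p]
        congr 1; push_cast; ring
      rw [this]
      ring
    · have h1 : (-1 : ℂ) ^ k * (-1) ^ (m * (N + 1)) = -(-1) ^ m := by
        rw [← pow_add, show k + m * (N + 1) = m + (2 * k + (e + 1)) by rw [mul_add, he]; lia,
          pow_add, pow_add, pow_mul, ho.neg_one_pow]
        simp
      linear_combination (riemannZeta (-((e + 1 : ℕ) : ℂ)) * riemannZeta (1 + m)) * h1

/-- The 𝓑 correction only cancels once the m = 1 term is in the partial sum, so the case M = 0 is
deduced from M = 1. -/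
theorem hasAsymptoticSeries_pow_of_one_le {l : Filter ℂ} (hl : l ≤ 𝓝 0) {f h : ℂ → ℂ} {a : ℕ → ℂ}
    (H : ∀ M : ℕ, 1 ≤ M → (fun x ↦ f x - (h x + ∑ m ∈ Finset.Icc 1 M, a m * x ^ m)) =O[l]
      fun x ↦ x ^ (M + 1)) : HasAsymptoticSeries l f h a fun m x ↦ x ^ m := by
  intro M
  rcases Nat.eq_zero_or_pos M with rfl | hM
  · have h1 : (fun x : ℂ ↦ x ^ (1 + 1)) =O[l] fun x ↦ x ^ 1 :=
      ((isLittleO_pow_pow (by lia)).isBigO).mono hl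
    have h2 := ((H 1 le_rfl).trans h1).add ((isBigO_refl (fun x : ℂ ↦ x ^ 1) l).const_mul_left (a 1))
    refine h2.congr_left fun x ↦ ?_
    simp
    ring
  · exact H M hM


/-! ### Expansion at zero for k ≥ 2. -/

theorem hasSum_log_div_pow {k : ℕ} (hk : 2 ≤ k) :
    HasSum (fun n : ℕ ↦ (Real.log (n + 1 : ℕ) : ℂ) / ((n + 1 : ℕ) : ℂ) ^ k)
      (-deriv riemannZeta k) := by
  have hre : 1 < (k : ℂ).re := by
    rw [Complex.natCast_re]; exact_mod_cast hk
  have habs : LSeries.abscissaOfAbsConv 1 < (k : ℂ).re := by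
    rw [LSeries.abscissaOfAbsConv_one]; exact_mod_cast hre
  have hder : deriv riemannZeta k = -LSeries (LSeries.logMul 1) k := by
    rw [← (LSeries_hasDerivAt habs).deriv]
    refine Filter.EventuallyEq.deriv_eq ?_
    filter_upwards [(isOpen_lt continuous_const Complex.continuous_re).mem_nhds hre] with s hs
    exact (LSeries_one_eq_riemannZeta hs).symm
  have hs : LSeriesHasSum (LSeries.logMul 1) k (LSeries (LSeries.logMul 1) k) :=
    (LSeriesSummable_logMul_of_lt_re habs).LSeriesHasSum
  rw [hder, neg_neg]
  rw [LSeriesHasSum, ← hasSum_nat_add_iff' 1] at hs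
  simp only [Finset.range_one, Finset.sum_singleton, LSeries.term_zero, sub_zero] at hs
  refine hs.congr_fun fun n ↦ ?_
  rw [LSeries.term_of_ne_zero (by lia), LSeries.logMul, Complex.cpow_natCast, Pi.one_apply,
    mul_one, Complex.natCast_log]

/-- With z = n^N x the term has size |z|/(j |j+z| n^k). The sector bound followed by weighted AM-GM
gives |j+z| ≥ c j^θ |z|^(1-θ), which separates n from j. -/
theorem summable_digamma_double {k N : ℕ} (hk : 2 ≤ k) (hkN : k ≤ N) {x : ℂ}
    (hx : x ∈ Complex.slitPlane) :
    Summable fun p : ℕ × ℕ ↦ (1 / ((p.2 + 1 : ℕ) : ℂ) -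
      1 / (((p.2 + 1 : ℕ) : ℂ) + ((p.1 + 1 : ℕ) : ℂ) ^ N * x)) / ((p.1 + 1 : ℕ) : ℂ) ^ k := by
  obtain ⟨δ, hδ, hδπ, hxδ⟩ := exists_mem_sector hx
  set c := Real.sin (δ / 2)
  have hc : 0 < c := sin_half_pos hδ hδπ
  have hx0 : 0 < ‖x‖ := norm_pos_iff.2 (Complex.slitPlane_ne_zero hx)
  have hN : (0 : ℝ) < N := by exact_mod_cast (by lia : 0 < N)
  have hN2 : (2 : ℝ) ≤ N := by exact_mod_cast hk.trans hkN
  -- This θ turns n^(Nθ) into n^(1/2): the majorant is n^(-(k-1/2)) j^(-(1+θ)), summable in both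
  -- variables because k ≥ 2.
  set θ : ℝ := 1 / (2 * N)
  have hθ : 0 < θ := by positivity
  have hθN : N * θ = 1 / 2 := by simp only [θ]; field_simp
  have hθ1 : θ ≤ 1 := by nlinarith
  have hs1 : Summable fun n : ℕ ↦ ((n + 1 : ℕ) : ℝ) ^ (-(k - 1 / 2) : ℝ) := by
    refine (summable_nat_add_iff 1).2 (Real.summable_nat_rpow.2 ?_)
    have : (2 : ℝ) ≤ k := by exact_mod_cast hk
    linarith
  have hs2 : Summable fun j : ℕ ↦ ((j + 1 : ℕ) : ℝ) ^ (-(1 + θ) : ℝ) :=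
    (summable_nat_add_iff 1).2 (Real.summable_nat_rpow.2 (by linarith))
  have hs := (hs1.mul_of_nonneg hs2 (fun n ↦ by positivity) fun j ↦ by positivity).mul_left
    (‖x‖ / c * ‖x‖ ^ (-(1 - θ)))
  refine Summable.of_norm_bounded hs fun p ↦ ?_
  obtain ⟨n, j⟩ := p
  simp only
  set a : ℝ := ((n + 1 : ℕ) : ℝ)
  set b : ℝ := ((j + 1 : ℕ) : ℝ)
  have ha : 0 < a := by positivity
  have hb : 0 < b := by positivity
  have haN : 0 < a ^ N := by positivity
  have hz : ((a ^ N : ℝ) : ℂ) * x ∈ sector δ := ofReal_mul_mem_sector hxδ haN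
  have hnz : ‖((a ^ N : ℝ) : ℂ) * x‖ = a ^ N * ‖x‖ := by
    rw [norm_mul, Complex.norm_real, Real.norm_of_nonneg haN.le]
  have hzc : ((n + 1 : ℕ) : ℂ) ^ N * x = ((a ^ N : ℝ) : ℂ) * x := by simp [a]
  have hbc : ((j + 1 : ℕ) : ℂ) = (b : ℂ) := by simp [b]
  have hac : ((n + 1 : ℕ) : ℂ) = (a : ℂ) := by simp [a]
  have hlow := sin_half_mul_le_norm_add hδ hz hb.le
  rw [hnz] at hlow
  have h0 : ((a ^ N : ℝ) : ℂ) * x + b ≠ 0 :=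
    Complex.slitPlane_ne_zero (add_mem_slitPlane hz.1 hb.le)
  have hb0 : (b : ℂ) ≠ 0 := by exact_mod_cast hb.ne'
  have heq : 1 / (b : ℂ) - 1 / (b + ((a ^ N : ℝ) : ℂ) * x) =
      ((a ^ N : ℝ) : ℂ) * x / (b * (((a ^ N : ℝ) : ℂ) * x + b)) := by
    rw [add_comm (b : ℂ)]; field_simp; ring
  rw [hzc, hbc, hac, heq, norm_div, norm_div, hnz, norm_mul, norm_pow, Complex.norm_real,
    Complex.norm_real, Real.norm_of_nonneg ha.le, Real.norm_of_nonneg hb.le]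
  have hgm : b ^ θ * (a ^ N * ‖x‖) ^ (1 - θ) ≤ a ^ N * ‖x‖ + b := by
    have h1 := Real.geom_mean_le_arith_mean2_weighted hθ.le (by linarith : 0 ≤ 1 - θ) hb.le
      (by positivity : 0 ≤ a ^ N * ‖x‖) (by ring)
    have : 0 ≤ a ^ N * ‖x‖ := by positivity
    nlinarith
  have hgm' : c * (b ^ θ * (a ^ N * ‖x‖) ^ (1 - θ)) ≤ ‖((a ^ N : ℝ) : ℂ) * x + b‖ :=
    le_trans (by gcongr) hlow
  have hpos : 0 < c * (b ^ θ * (a ^ N * ‖x‖) ^ (1 - θ)) := by positivity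
  calc a ^ N * ‖x‖ / (b * ‖((a ^ N : ℝ) : ℂ) * x + b‖) / a ^ k
      ≤ a ^ N * ‖x‖ / (b * (c * (b ^ θ * (a ^ N * ‖x‖) ^ (1 - θ)))) / a ^ k := by gcongr
    _ = ‖x‖ / c * ‖x‖ ^ (-(1 - θ)) * (a ^ (-(k - 1 / 2) : ℝ) * b ^ (-(1 + θ))) := by
      have e1 : (a ^ N * ‖x‖) ^ (1 - θ) = a ^ (N - 1 / 2 : ℝ) * ‖x‖ ^ (1 - θ) := by
        rw [Real.mul_rpow haN.le hx0.le, ← Real.rpow_natCast, ← Real.rpow_mul ha.le]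
        congr 2
        linear_combination -hθN
      have e2 : a ^ (-(k - 1 / 2) : ℝ) * a ^ k * a ^ (N - 1 / 2 : ℝ) = a ^ N := by
        rw [← Real.rpow_natCast, ← Real.rpow_natCast, ← Real.rpow_add ha, ← Real.rpow_add ha]
        congr 1; ring
      have e3 : b ^ (-(1 + θ)) * b ^ θ * b = 1 := by
        have : b ^ (-(1 + θ)) * b ^ θ * b ^ (1 : ℝ) = 1 := by
          rw [← Real.rpow_add hb, ← Real.rpow_add hb]
          simp
        rwa [Real.rpow_one] at this
      have e4 : ‖x‖ ^ (-(1 - θ)) * ‖x‖ ^ (1 - θ) = 1 := by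
        rw [← Real.rpow_add hx0]; simp
      rw [e1, ← e2]
      have p1 : 0 < a ^ (N - 1 / 2 : ℝ) := by positivity
      have p2 : 0 < ‖x‖ ^ (1 - θ) := by positivity
      have p3 : 0 < b ^ θ := by positivity
      rw [div_div, div_eq_iff (by positivity)]
      generalize a ^ (-(k - 1 / 2) : ℝ) = A at *
      generalize a ^ (N - 1 / 2 : ℝ) = B at *
      generalize b ^ (-(1 + θ)) = C at *
      generalize ‖x‖ ^ (-(1 - θ)) = D at *
      generalize ‖x‖ ^ (1 - θ) = E at *
      generalize b ^ θ = G at *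
      have : c⁻¹ * c = 1 := inv_mul_cancel₀ hc.ne'
      rw [div_eq_mul_inv]
      linear_combination (-A * a ^ k * B * ‖x‖) * e3 + (-A * a ^ k * B * ‖x‖ * (C * G * b)) * e4 +
        (-A * a ^ k * B * ‖x‖ * (C * G * b) * (D * E)) * this

theorem pow_mul_div_pow_add {k N : ℕ} (hkN : k ≤ N) {x : ℂ} (hx : x ∈ Complex.slitPlane)
    (n j : ℕ) :
    (1 / ((j + 1 : ℕ) : ℂ) - 1 / (((j + 1 : ℕ) : ℂ) + ((n + 1 : ℕ) : ℂ) ^ N * x)) /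
      ((n + 1 : ℕ) : ℂ) ^ k =
    ((n + 1 : ℕ) : ℂ) ^ (N - k) / (((n + 1 : ℕ) : ℂ) ^ N + (j + 1 : ℕ) * x⁻¹) /
      ((j + 1 : ℕ) : ℂ) := by
  have hx0 := Complex.slitPlane_ne_zero hx
  have hj0 : ((j + 1 : ℕ) : ℂ) ≠ 0 := Nat.cast_ne_zero.2 j.succ_ne_zero
  have hn0 : ((n + 1 : ℕ) : ℂ) ≠ 0 := Nat.cast_ne_zero.2 n.succ_ne_zero
  have hW : ((j + 1 : ℕ) : ℂ) * x⁻¹ ∈ Complex.slitPlane := by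
    have : (0 : ℝ) < ((j + 1 : ℕ) : ℝ) := by positivity
    simpa using ofReal_mul_mem_slitPlane (inv_mem_slitPlane hx) this
  have h1 := natCast_pow_add_ne_zero hW (n + 1) N
  have h2 : ((j + 1 : ℕ) : ℂ) + ((n + 1 : ℕ) : ℂ) ^ N * x =
      x * (((n + 1 : ℕ) : ℂ) ^ N + (j + 1 : ℕ) * x⁻¹) := by
    field_simp; ring
  have h3 : ((n + 1 : ℕ) : ℂ) ^ N = ((n + 1 : ℕ) : ℂ) ^ (N - k) * ((n + 1 : ℕ) : ℂ) ^ k := by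
    rw [← pow_add]; congr 1; lia
  have h4 : 1 / ((j + 1 : ℕ) : ℂ) - 1 / (((j + 1 : ℕ) : ℂ) + ((n + 1 : ℕ) : ℂ) ^ N * x) =
      ((n + 1 : ℕ) : ℂ) ^ N / (((j + 1 : ℕ) : ℂ) *
        (((n + 1 : ℕ) : ℂ) ^ N + (j + 1 : ℕ) * x⁻¹)) := by
    have h5 := mul_ne_zero hx0 h1
    rw [h2, div_sub_div _ _ hj0 h5, div_eq_div_iff (mul_ne_zero hj0 h5) (mul_ne_zero hj0 h1)]
    linear_combination (-((j + 1 : ℕ) : ℂ) * (((n + 1 : ℕ) : ℂ) ^ N + (j + 1 : ℕ) * x⁻¹)) * h2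
  rw [h4, div_div, div_div, div_eq_div_iff (mul_ne_zero (mul_ne_zero hj0 h1) (pow_ne_zero _ hn0))
    (mul_ne_zero h1 hj0)]
  linear_combination ((((n + 1 : ℕ) : ℂ) ^ N + (j + 1 : ℕ) * x⁻¹) * ((j + 1 : ℕ) : ℂ)) * h3

theorem log_natCast_pow_mul {x : ℂ} (hx : x ≠ 0) (n N : ℕ) :
    Complex.log (((n + 1 : ℕ) : ℂ) ^ N * x) = N * Real.log (n + 1 : ℕ) + Complex.log x := by
  have : ((n + 1 : ℕ) : ℂ) ^ N = ((((n + 1 : ℕ) : ℝ) ^ N : ℝ) : ℂ) := by push_cast; rfl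
  rw [this, Complex.log_ofReal_mul (by positivity) hx, Real.log_pow]
  push_cast
  rfl

theorem herglotzTerm_natCast (k N : ℕ) {x : ℂ} (hx : x ∈ Complex.slitPlane) (n : ℕ) :
    herglotzTerm k N x (n + 1) =
      (Complex.digamma (((n + 1 : ℕ) : ℂ) ^ N * x + 1) - (((n + 1 : ℕ) : ℂ) ^ N * x)⁻¹ -
        (N * Real.log (n + 1 : ℕ) + Complex.log x)) / ((n + 1 : ℕ) : ℂ) ^ k := by
  have hz : ((n + 1 : ℕ) : ℂ) ^ N * x ∈ Complex.slitPlane := by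
    have := ofReal_mul_mem_slitPlane hx (t := ((n + 1 : ℕ) : ℝ) ^ N) (by positivity)
    simpa using this
  rw [Complex.digamma_apply_add_one _ fun m hm ↦ add_natCast_ne_zero hz m (by rw [hm]; ring),
    add_sub_cancel_right, ← log_natCast_pow_mul (Complex.slitPlane_ne_zero hx), herglotzTerm,
    Real.rpow_natCast, Real.rpow_natCast]
  push_cast
  rfl

theorem herglotzF_eq_tsum_powSum {k N : ℕ} (hk : 2 ≤ k) (hkN : k ≤ N) {x : ℂ}
    (hx : x ∈ Complex.slitPlane) :
    (Summable fun j : ℕ ↦ powSum k N ((j + 1 : ℕ) * x⁻¹) / ((j + 1 : ℕ) : ℂ)) ∧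
    herglotzF k N x = ∑' j : ℕ, powSum k N ((j + 1 : ℕ) * x⁻¹) / ((j + 1 : ℕ) : ℂ) -
      riemannZeta (k + N) / x - (Real.eulerMascheroniConstant + Complex.log x) * riemannZeta k +
      N * deriv riemannZeta k := by
  have hD := summable_digamma_double hk hkN hx
  have hpow : ∀ j : ℕ, ∑' n : ℕ, (1 / ((j + 1 : ℕ) : ℂ) -
      1 / (((j + 1 : ℕ) : ℂ) + ((n + 1 : ℕ) : ℂ) ^ N * x)) / ((n + 1 : ℕ) : ℂ) ^ k =
      powSum k N ((j + 1 : ℕ) * x⁻¹) / ((j + 1 : ℕ) : ℂ) := by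
    intro j
    simp only [powSum, if_neg (show ¬ k = 1 by lia), sub_zero]
    rw [← tsum_div_const]
    exact tsum_congr fun n ↦ pow_mul_div_pow_add hkN hx n j
  have hdig : ∀ n : ℕ, ∑' j : ℕ, (1 / ((j + 1 : ℕ) : ℂ) -
      1 / (((j + 1 : ℕ) : ℂ) + ((n + 1 : ℕ) : ℂ) ^ N * x)) / ((n + 1 : ℕ) : ℂ) ^ k =
      (Complex.digamma (((n + 1 : ℕ) : ℂ) ^ N * x + 1) + Real.eulerMascheroniConstant) /
        ((n + 1 : ℕ) : ℂ) ^ k := by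
    intro n
    have hz : ((n + 1 : ℕ) : ℂ) ^ N * x ∈ Complex.slitPlane := by
      have := ofReal_mul_mem_slitPlane hx (t := ((n + 1 : ℕ) : ℝ) ^ N) (by positivity)
      simpa using this
    rw [tsum_div_const, (hasSum_digamma_add_one hz).tsum_eq]
  have h1 := hD.prod
  have h2 := hD.prod_symm.prod
  simp only [Prod.swap_prod_mk] at h1 h2
  simp only [hdig] at h1
  simp only [hpow] at h2
  refine ⟨h2, ?_⟩
  have hcomm := Summable.tsum_comm (f := fun n j : ℕ ↦ (1 / ((j + 1 : ℕ) : ℂ) -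
      1 / (((j + 1 : ℕ) : ℂ) + ((n + 1 : ℕ) : ℂ) ^ N * x)) / ((n + 1 : ℕ) : ℂ) ^ k) hD
  simp only [hdig, hpow] at hcomm
  have hz1 := (hasSum_inv_pow_riemannZeta (q := k + N) (by lia)).mul_right x⁻¹
  have hz2 := (hasSum_inv_pow_riemannZeta hk).mul_left
    (Real.eulerMascheroniConstant + Complex.log x)
  have hz3 := (hasSum_log_div_pow hk).mul_left (N : ℂ)
  have htot := ((h1.hasSum.sub hz1).sub hz2).sub hz3
  have hx0 := Complex.slitPlane_ne_zero hx
  have hF : herglotzF k N x = _ := (htot.congr_fun fun n ↦ by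
    have hn0 : ((n + 1 : ℕ) : ℂ) ≠ 0 := Nat.cast_ne_zero.2 n.succ_ne_zero
    rw [herglotzTerm_natCast k N hx, mul_inv, pow_add]
    field_simp
    ring).tsum_eq
  rw [hF, ← hcomm]
  push_cast
  ring

theorem hasSum_powSumMain {k N : ℕ} (hk : 2 ≤ k) (hkN : k ≤ N) {x : ℂ}
    (hx : x ∈ Complex.slitPlane) :
    HasSum (fun j : ℕ ↦ powSumMain k N ((j + 1 : ℕ) * x⁻¹) / ((j + 1 : ℕ) : ℂ))
      (Real.pi / N * (riemannZeta (1 + ((k : ℂ) - 1) / N) /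
        Complex.sin (Real.pi / N * (k - 1))) * x ^ (((k : ℂ) - 1) / N)) := by
  have hx0 := Complex.slitPlane_ne_zero hx
  have hN : (0 : ℝ) < N := by exact_mod_cast (by lia : 0 < N)
  have hk1 : (2 : ℝ) ≤ k := by exact_mod_cast hk
  have hs : 1 < 1 + ((k : ℝ) - 1) / N := by
    have : 0 < ((k : ℝ) - 1) / N := div_pos (by linarith) hN
    linarith
  have h := (hasSum_rpow_neg_riemannZeta hs).mul_left
    (Real.pi / N / Complex.sin (Real.pi / N * (k - 1)) * x ^ (((k : ℂ) - 1) / N))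
  convert! h using 1
  · ext j
    have hj : (0 : ℝ) < ((j + 1 : ℕ) : ℝ) := by positivity
    have hj0 : ((j + 1 : ℕ) : ℂ) ≠ 0 := Nat.cast_ne_zero.2 j.succ_ne_zero
    have hlog : Complex.log (((j + 1 : ℕ) : ℂ) * x⁻¹) = Real.log (j + 1 : ℕ) - Complex.log x := by
      have := Complex.log_ofReal_mul hj (inv_ne_zero hx0)
      rw [Complex.log_inv _ (Complex.mem_slitPlane_iff_arg.1 hx).1] at this
      rw [sub_eq_add_neg, ← this]
      simp
    have hr : ((((j + 1 : ℕ) : ℝ) ^ (-(1 + ((k : ℝ) - 1) / N)) : ℝ) : ℂ) =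
        Complex.exp (-((k - 1) / N) * Real.log (j + 1 : ℕ)) / ((j + 1 : ℕ) : ℂ) := by
      rw [neg_add, Real.rpow_add hj, Real.rpow_neg_one, Real.rpow_def_of_pos hj,
        div_eq_mul_inv, mul_comm]
      push_cast
      congr 2
      ring
    have he : Complex.exp ((1 - k : ℤ) * ((Real.log (j + 1 : ℕ) - Complex.log x) / N)) =
        Complex.exp (Complex.log x * ((k - 1) / N)) *
          Complex.exp (-((k - 1) / N) * Real.log (j + 1 : ℕ)) := by
      rw [← Complex.exp_add]; congr 1; push_cast; ring
    rw [powSumMain, if_neg (by lia), hr, hlog, Complex.cpow_def_of_ne_zero hx0, he]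
    ring
  · push_cast
    ring

theorem sum_neg_one_pow_mul_riemannZeta {k N M : ℕ} (hk : 1 ≤ k) (hkN : k ≤ N) (hM : 1 ≤ M)
    (x : ℂ) :
    ∑ m ∈ Finset.Icc 1 M, (-1) ^ k * ((-1) ^ (m * (N + 1)) *
          riemannZeta ((k : ℂ) - (m : ℂ) * (N : ℂ)) * riemannZeta (1 + (m : ℂ))) * x ^ m =
      -∑ m ∈ Finset.Icc 1 M, (-1) ^ m * riemannZeta (k - m * N) * riemannZeta (1 + m) * x ^ m +
        if k = N then riemannZeta 2 * x else 0 := by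
  have hone : (if k = N then riemannZeta 2 * x else 0) = ∑ m ∈ Finset.Icc 1 M,
      (if m = 1 then (if k = N then riemannZeta 2 * x else 0) else 0) := by
    rw [Finset.sum_ite_eq', if_pos (Finset.mem_Icc.2 ⟨le_rfl, hM⟩)]
  rw [hone, ← Finset.sum_neg_distrib, ← Finset.sum_add_distrib]
  refine Finset.sum_congr rfl fun m hm ↦ ?_
  rw [neg_one_pow_mul_riemannZeta hk hkN (Finset.mem_Icc.1 hm).1, add_mul]
  congr 1
  · ring
  · by_cases h1 : m = 1 <;> by_cases h2 : k = N <;> simp [h1, h2]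

theorem hasAsymptoticSeries_atZero {k N : ℕ} (hk : 1 < k) (hkN : k ≤ N) {δ : ℝ} (hδ : 0 < δ)
    (hδπ : δ < Real.pi) :
    HasAsymptoticSeries (sectorAtZero δ) (herglotzF k N)
        (fun x ↦ -(riemannZeta ((k : ℂ) + (N : ℂ)) / x)
          - ((Real.eulerMascheroniConstant : ℂ) + Complex.log x) * riemannZeta (k : ℂ)
          + (N : ℂ) * deriv riemannZeta (k : ℂ)
          + (Real.pi : ℂ) / (N : ℂ) *
              (riemannZeta (1 + ((k : ℂ) - 1) / (N : ℂ)) /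
                Complex.sin ((Real.pi : ℂ) / (N : ℂ) * ((k : ℂ) - 1))) *
              x ^ (((k : ℂ) - 1) / (N : ℂ))
          + x ^ (((k : ℂ) - 1) / (N : ℂ)) * herglotzB k N x)
        (fun m ↦ (-1) ^ k * ((-1) ^ (m * (N + 1)) *
          riemannZeta ((k : ℂ) - (m : ℂ) * (N : ℂ)) * riemannZeta (1 + (m : ℂ))))
        (fun m x ↦ x ^ m) := by
  have hN0 : (N : ℂ) ≠ 0 := by exact_mod_cast (by lia : N ≠ 0)
  refine hasAsymptoticSeries_pow_of_one_le nhdsWithin_le_nhds fun M hM ↦ ?_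
  obtain ⟨r, K, hr, h⟩ := exists_norm_tsum_powSum_le hk.le hkN hδ hδπ M
  refine IsBigO.of_bound K ?_
  rw [eventually_nhdsWithin_iff]
  filter_upwards [Metric.closedBall_mem_nhds (0 : ℂ) hr] with x hxr hx
  obtain ⟨h1, h2⟩ := h x hx (by simpa using hxr)
  obtain ⟨h3, h4⟩ := herglotzF_eq_tsum_powSum (by lia) hkN hx.1
  have h5 := hasSum_powSumMain (by lia) hkN hx.1
  have hx0 := Complex.slitPlane_ne_zero hx.1
  simp only [sub_div] at h2
  rw [(h3.hasSum.sub h5).tsum_eq] at h2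
  rw [norm_pow]
  convert! h2 using 2
  -- For k = N the two powers of x multiply to x and the sign exponent 2k+1 is odd, so this is minus
  -- the ζ(2) x left over from the parity comparison.
  have hB : x ^ (((k : ℂ) - 1) / N) * herglotzB k N x =
      -(if k = N then riemannZeta 2 * x else 0) := by
    rw [herglotzB]
    split_ifs with hkeq
    · subst hkeq
      have hx1 : x ^ (((k : ℂ) - 1) / k) * x ^ (1 / (k : ℂ)) = x := by
        rw [← Complex.cpow_add _ _ hx0, ← add_div, sub_add_cancel, div_self hN0, Complex.cpow_one]
      rw [div_self hN0, one_add_one_eq_two, Odd.neg_one_pow ⟨k, by ring⟩]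
      linear_combination (-riemannZeta 2) * hx1
    · simp
  rw [h4, hB, sum_neg_one_pow_mul_riemannZeta hk.le hkN hM]
  ring


/-! ### The logarithmic series `logSum` up to a constant. -/

theorem norm_log_one_add_le {δ : ℝ} (hδ : 0 < δ) (hδπ : δ < Real.pi) {w : ℂ} (hw : w ∈ sector δ) :
    ‖Complex.log (1 + w)‖ ≤ ‖w‖ / Real.sin (δ / 2) := by
  set c := Real.sin (δ / 2)
  have hc : 0 < c := sin_half_pos hδ hδπ
  have hslit : ∀ t ∈ Set.Icc (0 : ℝ) 1, (1 : ℂ) + t * w ∈ Complex.slitPlane ∧ c ≤ ‖1 + t * w‖ := by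
    intro t ht
    rcases ht.1.eq_or_lt with h | h
    · rw [← h]
      simpa using Real.sin_le_one _
    · have h1 := ofReal_mul_mem_sector hw h
      have h2 := sin_half_mul_le_norm_add hδ h1 zero_le_one
      rw [Complex.ofReal_one, add_comm _ (1 : ℂ)] at h2
      refine ⟨by simpa [add_comm] using add_mem_slitPlane h1.1 zero_le_one, le_trans ?_ h2⟩
      have : 0 ≤ ‖(t : ℂ) * w‖ := norm_nonneg _
      change c ≤ c * _
      nlinarith
  have hder : ∀ t ∈ Set.Icc (0 : ℝ) 1, HasDerivWithinAt (fun t : ℝ ↦ Complex.log (1 + t * w))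
      (w / (1 + t * w)) (Set.Icc 0 1) t := by
    intro t ht
    have h1 : HasDerivAt (fun t : ℝ ↦ 1 + (t : ℂ) * w) w t := by
      simpa using ((hasDerivAt_id (t : ℂ)).comp_ofReal.mul_const w).const_add 1
    exact (h1.clog_real (hslit t ht).1).hasDerivWithinAt
  have := norm_image_sub_le_of_norm_deriv_le_segment_01' hder (C := ‖w‖ / c) fun t ht ↦ by
    rw [norm_div]
    have := (hslit t (Set.Ico_subset_Icc_self ht)).2
    gcongr
  simpa using this

/-- The sum `∑ n ≥ 1, log (1 + W / n ^ N) / n`. -/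
noncomputable def logSum (N : ℕ) (W : ℂ) : ℂ :=
  ∑' n : ℕ, Complex.log (1 + W / ((n + 1 : ℕ) : ℂ) ^ N) / ((n + 1 : ℕ) : ℂ)

theorem summable_one_div_succ_sq : Summable fun n : ℕ ↦ 1 / ((n + 1 : ℕ) : ℝ) ^ 2 :=
  (summable_nat_add_iff 1).2 (Real.summable_one_div_nat_pow.2 one_lt_two)

theorem natCast_succ_le_pow {N : ℕ} (hN : 1 ≤ N) (n : ℕ) :
    ((n + 1 : ℕ) : ℝ) ≤ ((n + 1 : ℕ) : ℝ) ^ N :=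
  le_self_pow₀ (by simp) (by lia)

theorem summable_logSum {N : ℕ} (hN : 1 ≤ N) {W : ℂ} (hW : W ∈ Complex.slitPlane) :
    Summable fun n : ℕ ↦ Complex.log (1 + W / ((n + 1 : ℕ) : ℂ) ^ N) / ((n + 1 : ℕ) : ℂ) := by
  obtain ⟨δ, hδ, hδπ, hWδ⟩ := exists_mem_sector hW
  have hc : 0 < Real.sin (δ / 2) := sin_half_pos hδ hδπ
  refine Summable.of_norm_bounded (summable_one_div_succ_sq.mul_left (‖W‖ / Real.sin (δ / 2)))
    fun n ↦ ?_
  have hn : (0 : ℝ) < ((n + 1 : ℕ) : ℝ) := by positivity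
  have h1 : W / ((n + 1 : ℕ) : ℂ) ^ N ∈ sector δ := by
    have := ofReal_mul_mem_sector hWδ (t := (((n + 1 : ℕ) : ℝ) ^ N)⁻¹) (by positivity)
    rw [div_eq_inv_mul]
    simpa using this
  rw [norm_div, Complex.norm_natCast]
  have h2 := norm_log_one_add_le hδ hδπ h1
  rw [norm_div, norm_pow, Complex.norm_natCast] at h2
  calc _ ≤ ‖W‖ / ((n + 1 : ℕ) : ℝ) ^ N / Real.sin (δ / 2) / ((n + 1 : ℕ) : ℝ) := by gcongr
    _ ≤ ‖W‖ / ((n + 1 : ℕ) : ℝ) / Real.sin (δ / 2) / ((n + 1 : ℕ) : ℝ) := by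
      have := natCast_succ_le_pow hN n
      gcongr
    _ = _ := by field_simp

theorem exp_mem_sector {δ : ℝ} (hδ : 0 < δ) {u : ℂ} (hu : |u.im| ≤ Real.pi - δ) :
    Complex.exp u ∈ sector δ ∧ Complex.log (Complex.exp u) = u := by
  have h := abs_le.1 hu
  have hlog : Complex.log (Complex.exp u) = u := Complex.log_exp (by linarith) (by linarith)
  have harg : (Complex.exp u).arg = u.im := by rw [← Complex.log_im, hlog]
  refine ⟨⟨Complex.mem_slitPlane_iff_arg.2 ⟨?_, Complex.exp_ne_zero _⟩, ?_⟩, hlog⟩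
  · rw [harg]; intro h'; linarith
  · rw [harg]; exact hu

theorem powSum_one_term {N : ℕ} (hN : 1 ≤ N) {W : ℂ} (hW : W ∈ Complex.slitPlane) (n : ℕ) :
    ((n + 1 : ℕ) : ℂ) ^ (N - 1) / (((n + 1 : ℕ) : ℂ) ^ N + W) - 1 / ((n + 1 : ℕ) : ℂ) =
      -(W / (((n + 1 : ℕ) : ℂ) ^ N + W) / ((n + 1 : ℕ) : ℂ)) := by
  have hn0 : ((n + 1 : ℕ) : ℂ) ≠ 0 := Nat.cast_ne_zero.2 n.succ_ne_zero
  have h1 := natCast_pow_add_ne_zero hW (n + 1) N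
  obtain ⟨N, rfl⟩ := Nat.exists_eq_add_of_le' hN
  rw [Nat.add_sub_cancel, div_div, ← neg_div, div_sub_div _ _ h1 hn0,
    div_left_inj' (mul_ne_zero h1 hn0)]
  ring

theorem powSum_one_eq {N : ℕ} (hN : 1 ≤ N) {W : ℂ} (hW : W ∈ Complex.slitPlane) :
    (Summable fun n : ℕ ↦ W / (((n + 1 : ℕ) : ℂ) ^ N + W) / ((n + 1 : ℕ) : ℂ)) ∧
    ∑' n : ℕ, W / (((n + 1 : ℕ) : ℂ) ^ N + W) / ((n + 1 : ℕ) : ℂ) = -powSum 1 N W := by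
  have h := (hasSum_pow_div_pow_add le_rfl hN hW).summable.hasSum
  simp only [if_true, powSum_one_term hN hW] at h
  have h2 := h.neg
  simp only [neg_neg] at h2
  refine ⟨h2.summable, ?_⟩
  simp only [powSum, if_true, powSum_one_term hN hW]
  exact h2.tsum_eq

/-- In the variable u = log W the sector becomes a convex strip, and termwise differentiation yields
the `powSum` whose expansion is known. -/
theorem hasDerivAt_logSum_exp {N : ℕ} (hN : 1 ≤ N) {δ : ℝ} (hδ : 0 < δ) (hδπ : δ < Real.pi)
    {u : ℂ} (hu : |u.im| ≤ Real.pi - δ) :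
    HasDerivAt (fun u ↦ logSum N (Complex.exp u)) (-powSum 1 N (Complex.exp u)) u := by
  set c := Real.sin (δ / 2 / 2)
  have hδ2 : 0 < δ / 2 := by positivity
  have hc : 0 < c := sin_half_pos hδ2 (by linarith)
  -- The strip is widened to δ/2 so that it is an open neighbourhood of u; bounding Re v keeps |exp
  -- v| bounded and the derivatives dominated.
  set t : Set ℂ := {v : ℂ | v.re < u.re + 1} ∩
    ({v : ℂ | -(Real.pi - δ / 2) < v.im} ∩ {v : ℂ | v.im < Real.pi - δ / 2})
  have ht : IsOpen t := (isOpen_lt Complex.continuous_re continuous_const).inter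
    ((isOpen_lt continuous_const Complex.continuous_im).inter
      (isOpen_lt Complex.continuous_im continuous_const))
  have h't : IsPreconnected t := ((convex_halfSpace_re_lt _).inter
    ((convex_halfSpace_im_gt _).inter (convex_halfSpace_im_lt _))).isPreconnected
  have hut : u ∈ t := by
    have := abs_le.1 hu
    refine ⟨?_, ?_, ?_⟩
    · exact lt_add_one u.re
    · change -(Real.pi - δ / 2) < u.im; linarith
    · change u.im < Real.pi - δ / 2; linarith
  have hsec : ∀ v ∈ t, Complex.exp v ∈ sector (δ / 2) := fun v hv ↦
    (exp_mem_sector hδ2 (abs_le.2 ⟨le_of_lt hv.2.1, le_of_lt hv.2.2⟩)).1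
  rw [← (powSum_one_eq hN (hsec u hut).1).2]
  refine hasDerivAt_tsum_of_isPreconnected (g := fun (n : ℕ) (v : ℂ) ↦
      Complex.log (1 + Complex.exp v / ((n + 1 : ℕ) : ℂ) ^ N) / ((n + 1 : ℕ) : ℂ))
    (g' := fun (n : ℕ) (v : ℂ) ↦ Complex.exp v / (((n + 1 : ℕ) : ℂ) ^ N + Complex.exp v) /
      ((n + 1 : ℕ) : ℂ))
    (summable_one_div_succ_sq.mul_left (Real.exp (u.re + 1) / c)) ht h't ?_ ?_ hut
    (summable_logSum hN (hsec u hut).1) hut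
  · intro n v hv
    have hn0 : ((n + 1 : ℕ) : ℂ) ≠ 0 := Nat.cast_ne_zero.2 n.succ_ne_zero
    have h0 := natCast_pow_add_ne_zero (hsec v hv).1 (n + 1) N
    have h1 : 1 + Complex.exp v / ((n + 1 : ℕ) : ℂ) ^ N ∈ Complex.slitPlane := by
      have := ofReal_mul_mem_slitPlane (hsec v hv).1 (t := (((n + 1 : ℕ) : ℝ) ^ N)⁻¹) (by positivity)
      have := add_mem_slitPlane this zero_le_one
      rw [div_eq_inv_mul, add_comm]
      simpa using this
    refine (((((Complex.hasDerivAt_exp v).div_const _).const_add 1).clog h1).div_const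
      ((n + 1 : ℕ) : ℂ)).congr_deriv ?_
    have hN0 : ((n + 1 : ℕ) : ℂ) ^ N ≠ 0 := pow_ne_zero _ hn0
    have h2 : 1 + Complex.exp v / ((n + 1 : ℕ) : ℂ) ^ N =
        (((n + 1 : ℕ) : ℂ) ^ N + Complex.exp v) / ((n + 1 : ℕ) : ℂ) ^ N := by
      field_simp
    rw [h2, div_div_div_cancel_right₀ hN0]
  · intro n v hv
    have hn : (0 : ℝ) < ((n + 1 : ℕ) : ℝ) := by positivity
    have h1 := sin_half_mul_le_norm_add hδ2 (hsec v hv) (t := ((n + 1 : ℕ) : ℝ) ^ N) (by positivity)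
    have h2 : c * ((n + 1 : ℕ) : ℝ) ≤ ‖((n + 1 : ℕ) : ℂ) ^ N + Complex.exp v‖ := by
      rw [Complex.ofReal_pow, Complex.ofReal_natCast, add_comm (Complex.exp v)] at h1
      refine le_trans (mul_le_mul_of_nonneg_left ?_ hc.le) h1
      have := natCast_succ_le_pow hN n
      have := norm_nonneg (Complex.exp v)
      linarith
    have h3 : ‖Complex.exp v‖ ≤ Real.exp (u.re + 1) := by
      rw [Complex.norm_exp]
      exact Real.exp_le_exp.2 (le_of_lt hv.1)
    rw [norm_div, norm_div, Complex.norm_natCast]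
    calc _ ≤ Real.exp (u.re + 1) / (c * ((n + 1 : ℕ) : ℝ)) / ((n + 1 : ℕ) : ℝ) := by gcongr
      _ = _ := by field_simp

/-- The difference of `logSum N (exp u)` and its asymptotic main term. -/
noncomputable def logSumRest (N : ℕ) (u : ℂ) : ℂ :=
  logSum N (Complex.exp u) - Real.eulerMascheroniConstant * u - u ^ 2 / (2 * N)

/-- The derivative is minus the difference of `powSum` and its main term, hence O(exp(-Re w)); the
mean value inequality on a convex half-strip finishes. -/
theorem exists_norm_logSumRest_sub_le {N : ℕ} (hN : 1 ≤ N) {δ : ℝ} (hδ : 0 < δ)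
    (hδπ : δ < Real.pi) :
    ∃ R K : ℝ, 0 ≤ K ∧ ∀ ρ : ℝ, R ≤ ρ → ∀ u v : ℂ, ρ ≤ u.re → ρ ≤ v.re → |u.im| ≤ Real.pi - δ →
      |v.im| ≤ Real.pi - δ → ‖logSumRest N u - logSumRest N v‖ ≤ K * Real.exp (-ρ) * ‖u - v‖ := by
  obtain ⟨R, K, hR, hK, h⟩ := exists_norm_powSum_sub_le le_rfl hN hδ hδπ 0
  have hN0 : (N : ℂ) ≠ 0 := by exact_mod_cast (by lia : N ≠ 0)
  refine ⟨Real.log R, K, hK, fun ρ hρ u v hu hv hu' hv' ↦ ?_⟩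
  set s : Set ℂ := {w : ℂ | ρ ≤ w.re} ∩
    ({w : ℂ | -(Real.pi - δ) ≤ w.im} ∩ {w : ℂ | w.im ≤ Real.pi - δ})
  have hs : Convex ℝ s := (convex_halfSpace_re_ge _).inter
    ((convex_halfSpace_im_ge _).inter (convex_halfSpace_im_le _))
  have hmem : ∀ w : ℂ, ρ ≤ w.re → |w.im| ≤ Real.pi - δ → w ∈ s := fun w h1 h2 ↦
    ⟨h1, (abs_le.1 h2).1, (abs_le.1 h2).2⟩
  have hd : ∀ w ∈ s, HasDerivWithinAt (logSumRest N)
      (-(powSum 1 N (Complex.exp w) - powSumMain 1 N (Complex.exp w))) s w := by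
    intro w hw
    have hw' : |w.im| ≤ Real.pi - δ := abs_le.2 ⟨hw.2.1, hw.2.2⟩
    have h1 := ((hasDerivAt_logSum_exp hN hδ hδπ hw').sub
      ((hasDerivAt_id w).const_mul (Real.eulerMascheroniConstant : ℂ))).sub
      (((hasDerivAt_id w).pow 2).div_const (2 * (N : ℂ)))
    refine (h1.congr_deriv ?_).hasDerivWithinAt
    rw [powSumMain, if_pos rfl, (exp_mem_sector hδ hw').2]
    simp only [id]
    push_cast
    field_simp
    ring
  have hb : ∀ w ∈ s, ‖-(powSum 1 N (Complex.exp w) - powSumMain 1 N (Complex.exp w))‖ ≤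
      K * Real.exp (-ρ) := by
    intro w hw
    have hw' : |w.im| ≤ Real.pi - δ := abs_le.2 ⟨hw.2.1, hw.2.2⟩
    have hρw : ρ ≤ w.re := hw.1
    have h1 := h _ (exp_mem_sector hδ hw').1 (by
      rw [Complex.norm_exp, ← Real.log_le_iff_le_exp hR]
      linarith)
    simp only [Finset.Icc_eq_empty_of_lt zero_lt_one, Finset.sum_empty, add_zero, zero_add,
      pow_one] at h1
    rw [norm_neg]
    refine h1.trans ?_
    rw [Complex.norm_exp, div_eq_mul_inv, ← Real.exp_neg]
    gcongr
  exact hs.norm_image_sub_le_of_norm_hasDerivWithin_le hd hb (hmem v hv hv') (hmem u hu hu')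

/-- A limit along the real points N log Y suffices: with Y the floor of exp(Re u / N), the distance
from u to N log Y is at most N log 2 + π, while the Lipschitz constant decays exponentially. -/
theorem tendsto_logSumRest {N : ℕ} (hN : 1 ≤ N) {C : ℂ}
    (h : Tendsto (fun Y : ℕ ↦ logSumRest N (N * Real.log Y)) atTop (𝓝 C)) {δ : ℝ} (hδ : 0 < δ)
    (hδπ : δ < Real.pi) {ι : Type*} {l : Filter ι} {u : ι → ℂ} (hu : ∀ i, |(u i).im| ≤ Real.pi - δ)
    (hre : Tendsto (fun i ↦ (u i).re) l atTop) :
    Tendsto (fun i ↦ logSumRest N (u i)) l (𝓝 C) := by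
  obtain ⟨R, K, hK, hlip⟩ := exists_norm_logSumRest_sub_le hN hδ hδπ
  have hN0 : (0 : ℝ) < N := by exact_mod_cast hN
  set Y : ι → ℕ := fun i ↦ ⌊Real.exp ((u i).re / N)⌋₊
  have hexp : Tendsto (fun i ↦ Real.exp ((u i).re / N)) l atTop :=
    Real.tendsto_exp_atTop.comp (hre.atTop_div_const hN0)
  have hY : Tendsto Y l atTop := tendsto_nat_floor_atTop.comp hexp
  have h1 := h.comp hY
  have hsmall : Tendsto (fun i ↦ K * Real.exp (-((u i).re - N * Real.log 2)) *
      (N * Real.log 2 + Real.pi)) l (𝓝 0) := by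
    have h2 : Tendsto (fun i ↦ (u i).re - N * Real.log 2) l atTop :=
      tendsto_atTop_add_const_right _ _ hre
    simpa using ((Real.tendsto_exp_neg_atTop_nhds_zero.comp h2).const_mul K).mul_const
      (N * Real.log 2 + Real.pi)
  have hdiff : Tendsto (fun i ↦ logSumRest N (u i) - logSumRest N (N * Real.log (Y i))) l (𝓝 0) := by
    refine squeeze_zero_norm' ?_ hsmall
    filter_upwards [hY.eventually_ge_atTop 1, hre.eventually_ge_atTop (R + N * Real.log 2)]
      with i hi1 hi2
    have hYpos : (1 : ℝ) ≤ Y i := by exact_mod_cast hi1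
    have e1 : (Y i : ℝ) ≤ Real.exp ((u i).re / N) := Nat.floor_le (Real.exp_pos _).le
    have e2 : Real.exp ((u i).re / N) ≤ 2 * Y i := by
      have := (Nat.lt_floor_add_one (Real.exp ((u i).re / N))).le
      change _ ≤ (Y i : ℝ) + 1 at this
      linarith
    have e3 : N * Real.log (Y i) ≤ (u i).re := by
      have := (Real.log_le_iff_le_exp (by linarith)).2 e1
      rw [le_div_iff₀ hN0] at this
      linarith
    have e4 : (u i).re - N * Real.log 2 ≤ N * Real.log (Y i) := by
      have := (Real.le_log_iff_exp_le (by linarith)).2 e2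
      rw [Real.log_mul two_ne_zero (by linarith), div_le_iff₀ hN0] at this
      linarith
    have hv : ((N : ℂ) * Real.log (Y i)) = ((N * Real.log (Y i) : ℝ) : ℂ) := by push_cast; rfl
    have hlog2 : 0 < Real.log 2 := Real.log_pos one_lt_two
    have := hlip ((u i).re - N * Real.log 2) (by linarith) (u i) (N * Real.log (Y i))
      (by nlinarith) (by rw [hv, Complex.ofReal_re]; exact e4) (hu i) (by
        rw [hv, Complex.ofReal_im, abs_zero]; linarith)
    refine this.trans ?_
    gcongr
    refine (Complex.norm_le_abs_re_add_abs_im _).trans ?_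
    rw [hv, Complex.sub_re, Complex.sub_im, Complex.ofReal_re, Complex.ofReal_im, sub_zero]
    refine add_le_add ?_ ((hu i).trans (by linarith))
    rw [abs_le]
    constructor <;> nlinarith
  simpa using hdiff.add h1


/-! ### Existence of the first Stieltjes constant. -/

theorem exists_log_sq_sub_eq {n : ℕ} (hn : 3 ≤ n) :
    Real.log (n + 1 : ℕ) / (n + 1 : ℕ) ≤ Real.log (n + 1 : ℕ) ^ 2 / 2 - Real.log n ^ 2 / 2 ∧
      Real.log (n + 1 : ℕ) ^ 2 / 2 - Real.log n ^ 2 / 2 ≤ Real.log n / n := by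
  have hn3 : (3 : ℝ) ≤ n := by exact_mod_cast hn
  have he : Real.exp 1 ≤ 3 := Real.exp_one_lt_three.le
  have hder : ∀ t : ℝ, 0 < t → HasDerivAt (fun t ↦ Real.log t ^ 2 / 2) (Real.log t / t) t := by
    intro t ht
    refine (((Real.hasDerivAt_log ht.ne').pow 2).div_const 2).congr_deriv ?_
    field_simp
    simp
  obtain ⟨ξ, ⟨h1, h2⟩, h3⟩ := exists_hasDerivAt_eq_slope (fun t ↦ Real.log t ^ 2 / 2)
    (fun t ↦ Real.log t / t) (lt_add_one (n : ℝ))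
    (fun t ht ↦ (hder t (by linarith [ht.1])).continuousAt.continuousWithinAt)
    (fun t ht ↦ hder t (by linarith [ht.1]))
  rw [add_sub_cancel_left, div_one] at h3
  push_cast
  rw [← h3]
  exact ⟨Real.log_div_self_antitoneOn (Set.mem_Ici.2 (by linarith)) (Set.mem_Ici.2 (by linarith))
    h2.le, Real.log_div_self_antitoneOn (Set.mem_Ici.2 (by linarith)) (Set.mem_Ici.2 (by linarith))
    h1.le⟩

/-- `stieltjesOne` is a `limUnder`, meaningful only once convergence is known. As (log t)/t
decreases for t ≥ e, the sequence decreases from n = 3 on; it is bounded below through the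
increasing variant with log²(n+1). -/
theorem tendsto_stieltjesOne :
    Tendsto (fun n : ℕ ↦ ∑ j ∈ Finset.Icc 1 n, Real.log (j : ℝ) / (j : ℝ) - Real.log (n : ℝ) ^ 2 / 2)
      atTop (𝓝 stieltjesOne) := by
  set s : ℕ → ℝ := fun n ↦ ∑ j ∈ Finset.Icc 1 n, Real.log (j : ℝ) / (j : ℝ)
  have hs : ∀ n, s (n + 1) = s n + Real.log (n + 1 : ℕ) / (n + 1 : ℕ) := fun n ↦
    Finset.sum_Icc_succ_top (by lia) _
  have hanti : Antitone fun n : ℕ ↦ s (n + 3) - Real.log (n + 3 : ℕ) ^ 2 / 2 := by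
    refine antitone_nat_of_succ_le fun n ↦ ?_
    have := (exists_log_sq_sub_eq (n := n + 3) (by lia)).1
    rw [show n + 1 + 3 = n + 3 + 1 by lia, hs (n + 3)]
    linarith
  have hmono : Monotone fun n : ℕ ↦ s (n + 3) - Real.log (n + 3 + 1 : ℕ) ^ 2 / 2 := by
    refine monotone_nat_of_le_succ fun n ↦ ?_
    have := (exists_log_sq_sub_eq (n := n + 3 + 1) (by lia)).2
    rw [show n + 1 + 3 = n + 3 + 1 by lia, hs (n + 3)]
    linarith
  have hbdd : BddBelow (Set.range fun n : ℕ ↦ s (n + 3) - Real.log (n + 3 : ℕ) ^ 2 / 2) := by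
    refine ⟨s 3 - Real.log (0 + 3 + 1 : ℕ) ^ 2 / 2, ?_⟩
    rintro _ ⟨n, rfl⟩
    have h1 := hmono (Nat.zero_le n)
    have h2 : Real.log (n + 3 : ℕ) ^ 2 ≤ Real.log (n + 3 + 1 : ℕ) ^ 2 := by
      have h3 : 0 ≤ Real.log (n + 3 : ℕ) := Real.log_natCast_nonneg _
      have h4 : Real.log (n + 3 : ℕ) ≤ Real.log (n + 3 + 1 : ℕ) :=
        Real.log_le_log (by positivity) (by push_cast; linarith)
      gcongr
    simp only [zero_add] at h1 ⊢
    linarith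
  have h := tendsto_atTop_ciInf hanti hbdd
  exact tendsto_nhds_limUnder ⟨_, (tendsto_add_atTop_iff_nat 3).1 h⟩

theorem sum_log_div_eq (J : ℕ) :
    ∑ j ∈ Finset.range J, (Real.log (j + 1 : ℕ) : ℂ) / ((j + 1 : ℕ) : ℂ) =
      ((∑ j ∈ Finset.Icc 1 J, Real.log (j : ℝ) / (j : ℝ) : ℝ) : ℂ) := by
  induction J with
  | zero => simp
  | succ J ih =>
    rw [Finset.sum_range_succ, ih, Finset.sum_Icc_succ_top (by lia)]
    push_cast
    rfl

/-! ### Interchange of summations for k = 1. -/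

/-- Each increment of the logarithm is compared with 1/(z+1+J) by the mean value inequality, and the
error bounds telescope. Independence of J is what dominated convergence requires. -/
theorem norm_log_sub_sum_le {δ : ℝ} (hδ : 0 < δ) (hδπ : δ < Real.pi) {z : ℂ} (hz : z ∈ sector δ)
    (J : ℕ) :
    ‖Complex.log (1 + J / z) - ∑ j ∈ Finset.range J, 1 / (z + 1 + j)‖ ≤
      1 / Real.sin (δ / 2) ^ 2 / ‖z‖ := by
  set c := Real.sin (δ / 2)
  have hc : 0 < c := sin_half_pos hδ hδπ
  have hz0 := Complex.slitPlane_ne_zero hz.1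
  have hzp : 0 < ‖z‖ := norm_pos_iff.2 hz0
  have hstep : ∀ J : ℕ, ‖Complex.log (1 + (J + 1 : ℕ) / z) - Complex.log (1 + J / z) -
      1 / (z + 1 + J)‖ ≤ 1 / c ^ 2 * (1 / (‖z‖ + J) - 1 / (‖z‖ + (J + 1 : ℕ))) := by
    intro J
    have hJ : (0 : ℝ) ≤ J := Nat.cast_nonneg J
    have hder : ∀ t ∈ Set.Icc (J : ℝ) (J + 1), HasDerivWithinAt
        (fun t : ℝ ↦ Complex.log (1 + t / z) - t / (z + 1 + J))
        (1 / (z + t) - 1 / (z + 1 + J)) (Set.Icc (J : ℝ) (J + 1)) t := by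
      intro t ht
      have ht0 : 0 ≤ t := hJ.trans ht.1
      have h0 : z + t ≠ 0 := Complex.slitPlane_ne_zero (add_mem_slitPlane hz.1 ht0)
      have h1 : HasDerivAt (fun t : ℝ ↦ 1 + (t : ℂ) / z) (1 / z) t := by
        simpa using ((hasDerivAt_id (t : ℂ)).comp_ofReal.div_const z).const_add 1
      have h2 : HasDerivAt (fun t : ℝ ↦ (t : ℂ) / (z + 1 + J)) (1 / (z + 1 + J)) t := by
        simpa using (hasDerivAt_id (t : ℂ)).comp_ofReal.div_const (z + 1 + J)
      have h3 : 1 + (t : ℂ) / z ∈ Complex.slitPlane := by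
        rcases ht0.eq_or_lt with h | h
        · rw [← h]; simp
        · have := add_mem_slitPlane (ofReal_mul_mem_slitPlane (inv_mem_slitPlane hz.1) h) zero_le_one
          rw [div_eq_mul_inv, add_comm]
          simpa using this
      refine (((h1.clog_real h3).sub h2).congr_deriv ?_).hasDerivWithinAt
      congr 1
      rw [show 1 + (t : ℂ) / z = (z + t) / z by field_simp, div_div_div_cancel_right₀ hz0]
    have hb : ∀ t ∈ Set.Ico (J : ℝ) (J + 1), ‖1 / (z + t) - 1 / (z + 1 + J)‖ ≤
        1 / c ^ 2 * (1 / (‖z‖ + J) - 1 / (‖z‖ + (J + 1 : ℕ))) := by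
      intro t ht
      have ht0 : 0 ≤ t := hJ.trans ht.1
      have h0 : z + t ≠ 0 := Complex.slitPlane_ne_zero (add_mem_slitPlane hz.1 ht0)
      have hJ1 : (0 : ℝ) ≤ J + 1 := by linarith
      have h0' : z + 1 + J ≠ 0 := by
        have := Complex.slitPlane_ne_zero (add_mem_slitPlane hz.1 hJ1)
        push_cast at this
        rwa [add_assoc, add_comm (1 : ℂ)]
      have l1 := sin_half_mul_le_norm_add hδ hz ht0
      have l2 := sin_half_mul_le_norm_add hδ hz hJ1
      have l1' : c * (‖z‖ + J) ≤ ‖z + t‖ :=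
        le_trans (mul_le_mul_of_nonneg_left (by linarith [ht.1]) hc.le) l1
      have l2' : c * (‖z‖ + (J + 1)) ≤ ‖z + 1 + J‖ := by
        push_cast at l2
        rwa [add_assoc, add_comm (1 : ℂ)]
      have e1 : 1 / (z + t) - 1 / (z + 1 + J) = ((J + 1 - t : ℝ) : ℂ) / ((z + t) * (z + 1 + J)) := by
        rw [div_sub_div _ _ h0 h0']
        push_cast
        ring
      rw [e1, norm_div, norm_mul, Complex.norm_real, Real.norm_of_nonneg (by linarith [ht.2])]
      calc _ ≤ 1 / (c * (‖z‖ + J) * (c * (‖z‖ + (J + 1)))) := by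
            gcongr
            linarith [ht.1]
        _ = _ := by
            push_cast
            field_simp
            ring
    have := norm_image_sub_le_of_norm_deriv_le_segment' hder hb (J + 1)
      (Set.right_mem_Icc.2 (by linarith))
    rw [add_sub_cancel_left, mul_one] at this
    convert! this using 2
    push_cast
    ring
  have key : ‖Complex.log (1 + J / z) - ∑ j ∈ Finset.range J, 1 / (z + 1 + j)‖ ≤
      1 / c ^ 2 * (1 / ‖z‖ - 1 / (‖z‖ + J)) := by
    induction J with
    | zero => simp
    | succ J ih =>
      rw [Finset.sum_range_succ]
      have h1 : Complex.log (1 + (J + 1 : ℕ) / z) -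
          (∑ j ∈ Finset.range J, 1 / (z + 1 + j) + 1 / (z + 1 + J)) =
          (Complex.log (1 + J / z) - ∑ j ∈ Finset.range J, 1 / (z + 1 + j)) +
          (Complex.log (1 + (J + 1 : ℕ) / z) - Complex.log (1 + J / z) - 1 / (z + 1 + J)) := by
        ring
      rw [h1]
      refine (norm_add_le _ _).trans ((add_le_add ih (hstep J)).trans (le_of_eq ?_))
      ring
  refine key.trans ?_
  have h1 : 0 ≤ 1 / (‖z‖ + J) := by positivity
  have h2 : 0 ≤ 1 / c ^ 2 := by positivity
  rw [div_eq_mul_one_div (1 / c ^ 2)]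
  exact mul_le_mul_of_nonneg_left (by linarith) h2

theorem tendsto_log_sub_sum {z : ℂ} (hz : z ∈ Complex.slitPlane) :
    Tendsto (fun J : ℕ ↦ Complex.log (1 + J / z) - ∑ j ∈ Finset.range J, 1 / (z + 1 + j)) atTop
      (𝓝 (Complex.digamma (z + 1) - Complex.log z)) := by
  have hz1 : z + 1 ∈ Complex.slitPlane := by simpa using add_mem_slitPlane hz zero_le_one
  have h1 : Tendsto (fun J : ℕ ↦ (1 : ℂ) / J + z⁻¹) atTop (𝓝 z⁻¹) := by
    simpa using (tendsto_const_div_atTop_nhds_zero_nat (1 : ℂ)).add_const z⁻¹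
  have h2 := (continuousAt_clog (inv_mem_slitPlane hz)).tendsto.comp h1
  rw [Complex.log_inv _ (Complex.mem_slitPlane_iff_arg.1 hz).1] at h2
  have h3 := h2.add (tendsto_log_sub_sum_digamma hz1)
  rw [neg_add_eq_sub] at h3
  refine h3.congr' ?_
  filter_upwards [eventually_gt_atTop 0, h1.eventually_ne (inv_ne_zero (Complex.slitPlane_ne_zero hz))]
    with J hJ hne
  have hJ0 : (J : ℂ) ≠ 0 := by exact_mod_cast hJ.ne'
  have : 1 + (J : ℂ) / z = ((J : ℝ) : ℂ) * (1 / J + z⁻¹) := by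
    push_cast
    rw [mul_add, mul_one_div_cancel hJ0, div_eq_mul_inv]
  rw [this, Complex.log_ofReal_mul (by exact_mod_cast hJ) hne]
  simp only [Function.comp]
  ring

/-- The Herglotz function with `k = 1` as a limit of sums of elementary series. -/
theorem tendsto_logSum_add_sum_powSum {N : ℕ} (hN : 1 ≤ N) {x : ℂ} (hx : x ∈ Complex.slitPlane) :
    Tendsto (fun J : ℕ ↦ logSum N (J * x⁻¹) +
      ∑ j ∈ Finset.range J, powSum 1 N ((j + 1 : ℕ) * x⁻¹) / ((j + 1 : ℕ) : ℂ)) atTop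
      (𝓝 (herglotzF 1 N x + riemannZeta (N + 1) / x)) := by
  obtain ⟨δ, hδ, hδπ, hxδ⟩ := exists_mem_sector hx
  set c := Real.sin (δ / 2)
  have hc : 0 < c := sin_half_pos hδ hδπ
  have hx0 := Complex.slitPlane_ne_zero hx
  have hxp : 0 < ‖x‖ := norm_pos_iff.2 hx0
  set z : ℕ → ℂ := fun n ↦ ((n + 1 : ℕ) : ℂ) ^ N * x
  have hzs : ∀ n, z n ∈ sector δ := fun n ↦ by
    simpa [z] using ofReal_mul_mem_sector hxδ (t := ((n + 1 : ℕ) : ℝ) ^ N) (by positivity)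
  have hn0 : ∀ n : ℕ, ((n + 1 : ℕ) : ℂ) ≠ 0 := fun n ↦ Nat.cast_ne_zero.2 n.succ_ne_zero
  have htan : Tendsto (fun J : ℕ ↦ ∑' n : ℕ, (Complex.log (1 + J / z n) -
      ∑ j ∈ Finset.range J, 1 / (z n + 1 + j)) / ((n + 1 : ℕ) : ℂ)) atTop
      (𝓝 (∑' n : ℕ, (Complex.digamma (z n + 1) - Complex.log (z n)) / ((n + 1 : ℕ) : ℂ))) := by
    -- Since |n^N x| ≥ n|x|, the uniform bound divided by n is a multiple of 1/n².
    refine tendsto_tsum_of_dominated_convergence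
      (summable_one_div_succ_sq.mul_left (1 / c ^ 2 / ‖x‖))
      (fun n ↦ (tendsto_log_sub_sum (hzs n).1).div_const _) (Eventually.of_forall fun J n ↦ ?_)
    rw [norm_div, Complex.norm_natCast]
    have hn : (0 : ℝ) < ((n + 1 : ℕ) : ℝ) := by positivity
    have h1 : ((n + 1 : ℕ) : ℝ) * ‖x‖ ≤ ‖z n‖ := by
      simp only [z]
      rw [norm_mul, norm_pow, Complex.norm_natCast]
      have := natCast_succ_le_pow hN n
      gcongr
    calc _ ≤ 1 / c ^ 2 / ‖z n‖ / ((n + 1 : ℕ) : ℝ) := by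
          gcongr
          exact norm_log_sub_sum_le hδ hδπ (hzs n) J
      _ ≤ 1 / c ^ 2 / (((n + 1 : ℕ) : ℝ) * ‖x‖) / ((n + 1 : ℕ) : ℝ) := by gcongr
      _ = _ := by field_simp
  have hlim : ∑' n : ℕ, (Complex.digamma (z n + 1) - Complex.log (z n)) / ((n + 1 : ℕ) : ℂ) =
      herglotzF 1 N x + riemannZeta (N + 1) / x := by
    have hS := (summable_herglotzTerm (k := 1) (N := N) (by exact_mod_cast hN)
      (by linarith [show (0 : ℝ) < N by exact_mod_cast hN]) hx).hasSum
    have hZ := (hasSum_inv_pow_riemannZeta (q := N + 1) (by lia)).mul_right x⁻¹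
    have := (hS.add hZ).tsum_eq
    rw [herglotzF]
    push_cast at this
    rw [div_eq_mul_inv, ← this]
    refine tsum_congr fun n ↦ ?_
    have hT := herglotzTerm_natCast 1 N hx n
    rw [Nat.cast_one] at hT
    have := hn0 n
    have hL := log_natCast_pow_mul hx0 n N
    push_cast at hT hL this ⊢
    simp only [z]
    push_cast
    rw [hT, hL, pow_one, pow_succ ((n : ℂ) + 1) N, mul_inv, mul_inv]
    field_simp
    ring
  rw [hlim] at htan
  refine htan.congr' ?_
  filter_upwards [eventually_gt_atTop 0] with J hJ
  have hWs : ∀ j : ℕ, 0 < j → (j : ℂ) * x⁻¹ ∈ Complex.slitPlane := fun j hj ↦ by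
    have : (0 : ℝ) < j := by exact_mod_cast hj
    simpa using ofReal_mul_mem_slitPlane (inv_mem_slitPlane hx) this
  have hpow : ∀ j ∈ Finset.range J, HasSum (fun n : ℕ ↦ 1 / (z n + 1 + j) / ((n + 1 : ℕ) : ℂ))
      (-(powSum 1 N ((j + 1 : ℕ) * x⁻¹) / ((j + 1 : ℕ) : ℂ))) := by
    intro j _
    obtain ⟨h1, h2⟩ := powSum_one_eq hN (hWs (j + 1) j.succ_pos)
    have h3 := h1.hasSum
    rw [h2] at h3
    have h4 := h3.div_const ((j + 1 : ℕ) : ℂ)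
    rw [neg_div] at h4
    refine h4.congr_fun fun n ↦ ?_
    have h5 := natCast_pow_add_ne_zero (hWs (j + 1) j.succ_pos) (n + 1) N
    have h6 : z n + 1 + j = x * (((n + 1 : ℕ) : ℂ) ^ N + (j + 1 : ℕ) * x⁻¹) := by
      simp only [z]
      rw [mul_add, mul_comm x (((j + 1 : ℕ) : ℂ) * x⁻¹), inv_mul_cancel_right₀ hx0]
      push_cast
      ring
    rw [h6]
    have := hn0 n
    have := hn0 j
    generalize ((n + 1 : ℕ) : ℂ) ^ N + (j + 1 : ℕ) * x⁻¹ = D at *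
    field_simp
  have hlog := (summable_logSum hN (hWs J hJ)).hasSum
  have htot := hlog.sub (hasSum_sum hpow)
  rw [Finset.sum_neg_distrib, sub_neg_eq_add] at htot
  refine (htot.congr_fun fun n ↦ ?_).tsum_eq
  rw [sub_div, Finset.sum_div]
  congr 3
  simp only [z]
  rw [div_mul_eq_div_div_swap, div_eq_mul_inv (J : ℂ)]


/-! ### The constant term of `logSum`. -/

theorem tendsto_harmonic_sub_log_complex :
    Tendsto (fun J : ℕ ↦ ((harmonic J : ℚ) : ℂ) - Real.log J) atTop
      (𝓝 (Real.eulerMascheroniConstant : ℂ)) := by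
  refine ((Complex.continuous_ofReal.tendsto _).comp Real.tendsto_harmonic_sub_log).congr
    fun J ↦ ?_
  simp

/-- H_J - log J - γ lies between 0 and 1/J, so it beats the logarithm. This controls the cross term
when H_J² is replaced by log² J. -/
theorem tendsto_harmonic_sub_log_mul_log :
    Tendsto (fun J : ℕ ↦ (((harmonic J : ℚ) : ℂ) - Real.log J - Real.eulerMascheroniConstant) *
      Real.log J) atTop (𝓝 0) := by
  have h : Tendsto (fun J : ℕ ↦ ((harmonic J : ℚ) - Real.log J - Real.eulerMascheroniConstant) *
      Real.log J) atTop (𝓝 0) := by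
    have h1 : Tendsto (fun J : ℕ ↦ Real.log J / J) atTop (𝓝 0) := by
      have := (Real.isLittleO_log_id_atTop.comp_tendsto tendsto_natCast_atTop_atTop).tendsto_div_nhds_zero
      simpa using this
    refine squeeze_zero' ?_ ?_ h1
    · filter_upwards [eventually_gt_atTop 0] with J hJ
      have h2 := Real.eulerMascheroniConstant_lt_eulerMascheroniSeq' J
      rw [Real.eulerMascheroniSeq', if_neg hJ.ne'] at h2
      exact mul_nonneg (by linarith) (Real.log_natCast_nonneg J)
    · filter_upwards [eventually_gt_atTop 0] with J hJ
      have hJ0 : (0 : ℝ) < J := by exact_mod_cast hJ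
      have h2 := Real.eulerMascheroniSeq_lt_eulerMascheroniConstant J
      rw [Real.eulerMascheroniSeq] at h2
      have h3 : Real.log (J + 1) - Real.log J ≤ 1 / J := by
        rw [← Real.log_div (by linarith) hJ0.ne']
        refine (Real.log_le_sub_one_of_pos (by positivity)).trans (le_of_eq ?_)
        field_simp
        ring
      calc _ ≤ 1 / J * Real.log J :=
            mul_le_mul_of_nonneg_right (by linarith) (Real.log_natCast_nonneg J)
        _ = _ := by ring
  have h2 := (Complex.continuous_ofReal.tendsto _).comp h
  rw [Complex.ofReal_zero] at h2
  refine h2.congr fun J ↦ ?_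
  simp

theorem tendsto_stieltjesOne_complex :
    Tendsto (fun J : ℕ ↦ ∑ j ∈ Finset.range J, (Real.log (j + 1 : ℕ) : ℂ) / ((j + 1 : ℕ) : ℂ) -
      (Real.log J : ℂ) ^ 2 / 2) atTop (𝓝 (stieltjesOne : ℂ)) := by
  refine ((Complex.continuous_ofReal.tendsto _).comp tendsto_stieltjesOne).congr fun J ↦ ?_
  rw [sum_log_div_eq]
  simp

theorem digamma_natCast_add_two (j : ℕ) :
    Complex.digamma ((j + 1 : ℕ) + 1) = (harmonic (j + 1) : ℚ) - Real.eulerMascheroniConstant := by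
  induction j with
  | zero =>
    rw [Nat.zero_add, Nat.cast_one, Complex.digamma_apply_add_one 1 fun m h ↦ by
      have := congrArg Complex.re h
      simp at this
      have := (Nat.cast_nonneg m : (0 : ℝ) ≤ m)
      linarith, Complex.digamma_one]
    simp
    ring
  | succ j ih =>
    rw [Nat.cast_succ, Complex.digamma_apply_add_one _ fun m h ↦ by
      have := congrArg Complex.re h
      simp at this
      have := (Nat.cast_nonneg m : (0 : ℝ) ≤ m)
      have := (Nat.cast_nonneg j : (0 : ℝ) ≤ j)
      linarith, ih, harmonic_succ (j + 1)]
    push_cast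
    ring

theorem powSum_one_one {W : ℂ} (hW : W ∈ Complex.slitPlane) :
    powSum 1 1 W = -(Complex.digamma (W + 1) + Real.eulerMascheroniConstant) := by
  rw [powSum, ← (hasSum_digamma_add_one hW).neg.tsum_eq]
  refine tsum_congr fun n ↦ ?_
  simp

theorem two_mul_sum_harmonic_div (J : ℕ) :
    2 * ∑ j ∈ Finset.range J, ((harmonic (j + 1) : ℚ) : ℂ) / ((j + 1 : ℕ) : ℂ) =
      ((harmonic J : ℚ) : ℂ) ^ 2 + ∑ j ∈ Finset.range J, (((j + 1 : ℕ) : ℂ) ^ 2)⁻¹ := by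
  induction J with
  | zero => simp
  | succ J ih =>
    have hJ : ((J + 1 : ℕ) : ℂ) ≠ 0 := Nat.cast_ne_zero.2 J.succ_ne_zero
    rw [Finset.sum_range_succ, mul_add, ih, Finset.sum_range_succ, harmonic_succ J]
    push_cast at hJ ⊢
    field_simp
    ring

/-- At x = 1 and N = 1 every digamma value is a harmonic number. Subtracting the partial sums of the
Herglotz series from the limit formula removes the unknown value 𝓕(1), and ∑ H_j/j is evaluated by
squaring H_J. -/
theorem tendsto_logSumRest_one :
    Tendsto (fun Y : ℕ ↦ logSumRest 1 ((1 : ℕ) * Real.log Y)) atTop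
      (𝓝 (riemannZeta 2 - stieltjesOne)) := by
  have h1 := tendsto_logSum_add_sum_powSum le_rfl Complex.one_mem_slitPlane
  have hZ := hasSum_inv_pow_riemannZeta (q := 2) le_rfl
  have hS := (summable_herglotzTerm (k := 1) (N := (1 : ℕ)) (by simp) (by simp)
    Complex.one_mem_slitPlane).hasSum
  have h2 := (hS.add hZ).tendsto_sum_nat
  have heq : herglotzF 1 (1 : ℕ) 1 + riemannZeta ((1 : ℕ) + 1) / 1 =
      ∑' n : ℕ, herglotzTerm 1 (1 : ℕ) 1 (n + 1) + riemannZeta (2 : ℕ) := by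
    rw [herglotzF]; norm_num
  rw [heq] at h1
  have h3 := (h1.sub h2).add hZ.tendsto_sum_nat
  -- The added null sequence equals H² - γH - log² J - γ log J with H = H_J; it trades harmonic
  -- numbers for logarithms.
  have h4 := (h3.sub tendsto_stieltjesOne_complex).add
    ((tendsto_harmonic_sub_log_mul_log.const_mul 2).add
      ((tendsto_harmonic_sub_log_complex.sub_const (Real.eulerMascheroniConstant : ℂ)).mul tendsto_harmonic_sub_log_complex))
  have h5 : (∑' n : ℕ, herglotzTerm 1 (1 : ℕ) 1 (n + 1) + riemannZeta (2 : ℕ) -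
      (∑' n : ℕ, herglotzTerm 1 (1 : ℕ) 1 (n + 1) + riemannZeta (2 : ℕ)) + riemannZeta (2 : ℕ) -
      stieltjesOne + (2 * 0 + ((Real.eulerMascheroniConstant : ℂ) - Real.eulerMascheroniConstant) *
      Real.eulerMascheroniConstant)) = riemannZeta 2 - stieltjesOne := by
    push_cast; ring
  rw [h5] at h4
  refine h4.congr' ?_
  filter_upwards [eventually_gt_atTop 0] with J hJ
  have hJ0 : (J : ℂ) ≠ 0 := by exact_mod_cast hJ.ne'
  have hexp : Complex.exp ((1 : ℕ) * Real.log J) = J * 1⁻¹ := by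
    rw [Nat.cast_one, one_mul, Complex.natCast_log, Complex.exp_log hJ0]
    simp
  rw [logSumRest, hexp]
  have hp : ∑ j ∈ Finset.range J, powSum 1 1 ((j + 1 : ℕ) * 1⁻¹) / ((j + 1 : ℕ) : ℂ) =
      -∑ j ∈ Finset.range J, ((harmonic (j + 1) : ℚ) : ℂ) / ((j + 1 : ℕ) : ℂ) := by
    rw [← Finset.sum_neg_distrib]
    refine Finset.sum_congr rfl fun j _ ↦ ?_
    have hj : ((j + 1 : ℕ) : ℂ) ∈ Complex.slitPlane := Or.inl (by
      rw [Complex.natCast_re]; positivity)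
    rw [inv_one, mul_one, powSum_one_one hj, digamma_natCast_add_two]
    ring
  have ht : ∑ n ∈ Finset.range J, (herglotzTerm 1 (1 : ℕ) 1 (n + 1) +
      (((n + 1 : ℕ) : ℂ) ^ 2)⁻¹) =
      ∑ j ∈ Finset.range J, ((harmonic (j + 1) : ℚ) : ℂ) / ((j + 1 : ℕ) : ℂ) -
        Real.eulerMascheroniConstant * (harmonic J : ℚ) -
        ∑ j ∈ Finset.range J, (Real.log (j + 1 : ℕ) : ℂ) / ((j + 1 : ℕ) : ℂ) := by
    rw [harmonic, Rat.cast_sum, Finset.mul_sum, ← Finset.sum_sub_distrib, ← Finset.sum_sub_distrib]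
    refine Finset.sum_congr rfl fun n _ ↦ ?_
    have hn0 : ((n + 1 : ℕ) : ℂ) ≠ 0 := Nat.cast_ne_zero.2 n.succ_ne_zero
    have hT := herglotzTerm_natCast 1 1 Complex.one_mem_slitPlane n
    rw [pow_one, mul_one, digamma_natCast_add_two, Complex.log_one, Nat.cast_one] at hT
    rw [Nat.cast_one, hT]
    generalize ((harmonic (n + 1) : ℚ) : ℂ) = H
    push_cast at hn0 ⊢
    field_simp
    ring
  have hq := two_mul_sum_harmonic_div J
  rw [hp, ht]
  push_cast at hq ⊢
  linear_combination -hq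

theorem sum_rootAngle_sq {N : ℕ} (hN : 1 ≤ N) :
    ∑ l ∈ Finset.range N, (rootAngle N l : ℂ) ^ 2 = Real.pi ^ 2 * (N ^ 2 - 1) / (3 * N) := by
  have hN0 : (N : ℂ) ≠ 0 := by exact_mod_cast (by lia : N ≠ 0)
  have h : ∀ n : ℕ, ∑ l ∈ Finset.range n, (2 * (l : ℂ) + 1 - N) ^ 2 =
      (n : ℂ) * (4 * (n : ℂ) ^ 2 - 1) / 3 - 2 * N * (n : ℂ) ^ 2 + n * (N : ℂ) ^ 2 := by
    intro n
    induction n with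
    | zero => simp
    | succ n ih => rw [Finset.sum_range_succ, ih]; push_cast; ring
  have h2 : ∀ l : ℕ, (rootAngle N l : ℂ) ^ 2 = Real.pi ^ 2 / N ^ 2 * (2 * (l : ℂ) + 1 - N) ^ 2 := by
    intro l
    rw [rootAngle]
    push_cast
    ring
  simp only [h2]
  rw [← Finset.mul_sum, h N]
  field_simp
  ring

theorem prod_sub_negRoot {N : ℕ} (hN : 1 ≤ N) {W : ℂ} (hW : W ≠ 0) (a : ℂ) :
    ∏ l ∈ Finset.range N, (a - negRoot N W l) = a ^ N + W := by
  have hζ := Complex.isPrimitiveRoot_exp N (by lia)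
  have h := hζ.pow_sub_pow_eq_prod_sub_mul a (negRoot N W 0) hN
  rw [negRoot_pow (by lia) hW, sub_neg_eq_add] at h
  rw [h]
  refine Finset.prod_bij (fun l _ ↦ Complex.exp (2 * Real.pi * Complex.I / N) ^ l) ?_ ?_ ?_ ?_
  · intro l _
    rw [Polynomial.mem_nthRootsFinset hN, ← pow_mul, mul_comm l N, pow_mul, hζ.pow_eq_one, one_pow]
  · intro i hi j hj hij
    exact hζ.pow_inj (Finset.mem_range.1 hi) (Finset.mem_range.1 hj) hij
  · intro μ hμ
    rw [Polynomial.mem_nthRootsFinset hN] at hμ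
    have : NeZero N := ⟨by lia⟩
    obtain ⟨i, hi, rfl⟩ := hζ.eq_pow_of_pow_eq_one hμ
    exact ⟨i, Finset.mem_range.2 hi, rfl⟩
  · intro l _
    congr 1
    rw [negRoot, negRoot, rootNegOne, rootNegOne, ← Complex.exp_nat_mul]
    rw [← Complex.exp_add, ← Complex.exp_add, ← Complex.exp_add]
    congr 1
    push_cast
    ring

theorem ofReal_add_mul_I_im (a b : ℝ) : ((a : ℂ) + b * Complex.I).im = b := by simp

theorem ofReal_add_mul_I_re (a b : ℝ) : ((a : ℂ) + b * Complex.I).re = a := by simp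

theorem rootAngle_reflect {N l : ℕ} (hl : l < N) : rootAngle N (N - 1 - l) = -rootAngle N l := by
  rw [rootAngle, rootAngle, Nat.cast_sub (by lia), Nat.cast_sub (by lia)]
  push_cast
  ring

theorem abs_rootAngle_le_sub {N l : ℕ} (hl : l < N) :
    |rootAngle N l| ≤ Real.pi - Real.pi / (N + 1) := by
  have hN : (0 : ℝ) < N := by exact_mod_cast (Nat.zero_le l).trans_lt hl
  refine (abs_rootAngle_le hl).trans ?_
  have h1 : Real.pi / (N + 1) ≤ Real.pi / N :=
    div_le_div_of_nonneg_left Real.pi_pos.le hN (by linarith)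
  have h2 : Real.pi * (N - 1) / N = Real.pi - Real.pi / N := by field_simp
  linarith

/-- The logarithm of `1 + Y ^ N / a ^ N` as a sum over the roots of `-Y ^ N`. -/
theorem log_one_add_pow_div_pow {N : ℕ} (hN : 1 ≤ N) (Y n : ℕ) :
    Complex.log (1 + Complex.exp (N * Real.log Y) / ((n + 1 : ℕ) : ℂ) ^ N) =
      ∑ l ∈ Finset.range N, Complex.log (1 + Complex.exp (Real.log Y + rootAngle N l * Complex.I) /
        ((n + 1 : ℕ) : ℂ)) := by
  have hN0 : (N : ℂ) ≠ 0 := by exact_mod_cast (by lia : N ≠ 0)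
  have hn0 : ((n + 1 : ℕ) : ℂ) ≠ 0 := Nat.cast_ne_zero.2 n.succ_ne_zero
  have hδ : 0 < Real.pi / (N + 1 : ℝ) := by positivity
  set f : ℕ → ℂ := fun l ↦ 1 + Complex.exp (Real.log Y + rootAngle N l * Complex.I) /
        ((n + 1 : ℕ) : ℂ)
  have hf : ∀ l ∈ Finset.range N, f l ∈ Complex.slitPlane := by
    intro l hl
    have h1 := (exp_mem_sector hδ (u := Real.log Y + rootAngle N l * Complex.I) (by
      rw [ofReal_add_mul_I_im]; exact abs_rootAngle_le_sub (Finset.mem_range.1 hl))).1.1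
    have h2 := ofReal_mul_mem_slitPlane h1 (t := ((n + 1 : ℕ) : ℝ)⁻¹) (by positivity)
    have h3 := add_mem_slitPlane h2 zero_le_one
    simp only [f]
    rw [div_eq_inv_mul, add_comm]
    simpa using h3
  -- Both sides have the same exponential by the factorization. Conjugation swaps l with N-1-l, so
  -- the sum of logarithms is real and no multiple of 2πi can intervene.
  have hconj : (starRingEnd ℂ) (∑ l ∈ Finset.range N, Complex.log (f l)) =
      ∑ l ∈ Finset.range N, Complex.log (f l) := by
    rw [map_sum, ← Finset.sum_range_reflect]
    refine Finset.sum_congr rfl fun l hl ↦ ?_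
    have hl' := Finset.mem_range.1 hl
    rw [← Complex.log_conj _ (Complex.mem_slitPlane_iff_arg.1
      (hf (N - 1 - l) (Finset.mem_range.2 (by lia)))).1]
    congr 1
    simp only [f]
    rw [map_add, map_one, map_div₀, map_natCast, ← Complex.exp_conj, map_add, map_mul,
      Complex.conj_ofReal, Complex.conj_ofReal, Complex.conj_I, rootAngle_reflect hl']
    push_cast
    ring_nf
  obtain ⟨r, hr⟩ := Complex.conj_eq_iff_real.1 hconj
  set W : ℂ := Complex.exp (N * Real.log Y)
  have hWreal : W = ((Real.exp (N * Real.log Y) : ℝ) : ℂ) := by simp [W]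
  have hWlog : Complex.log W = N * Real.log Y := by
    rw [hWreal, ← Complex.ofReal_log (Real.exp_pos _).le, Real.log_exp]
    push_cast
    rfl
  have hprod : ∏ l ∈ Finset.range N, f l = 1 + W / ((n + 1 : ℕ) : ℂ) ^ N := by
    have h1 := prod_sub_negRoot hN (Complex.exp_ne_zero (N * Real.log Y)) ((n + 1 : ℕ) : ℂ)
    have h2 : ∀ l, f l = (((n + 1 : ℕ) : ℂ) - negRoot N W l) / ((n + 1 : ℕ) : ℂ) := by
      intro l
      rw [sub_eq_add_neg, neg_negRoot_eq_exp (by lia), hWlog, mul_div_cancel_left₀ _ hN0]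
      simp only [f]
      field_simp
    simp only [h2]
    rw [Finset.prod_div_distrib, h1, Finset.prod_const, Finset.card_range]
    field_simp
    rfl
  have hexp : Complex.exp r = 1 + W / ((n + 1 : ℕ) : ℂ) ^ N := by
    rw [← hr, Complex.exp_sum, ← hprod]
    exact Finset.prod_congr rfl fun l hl ↦ Complex.exp_log (Complex.slitPlane_ne_zero (hf l hl))
  rw [hr, ← hexp]
  exact Complex.log_exp (by simp [Real.pi_pos]) (by simp [Real.pi_pos.le])

theorem logSum_exp_mul_log {N : ℕ} (hN : 1 ≤ N) (Y : ℕ) :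
    logSum N (Complex.exp (N * Real.log Y)) =
      ∑ l ∈ Finset.range N, logSum 1 (Complex.exp (Real.log Y + rootAngle N l * Complex.I)) := by
  have hδ : 0 < Real.pi / (N + 1 : ℝ) := by positivity
  have h := hasSum_sum fun l (hl : l ∈ Finset.range N) ↦ (summable_logSum le_rfl
    (exp_mem_sector hδ (u := Real.log Y + rootAngle N l * Complex.I) (by
      rw [ofReal_add_mul_I_im]; exact abs_rootAngle_le_sub (Finset.mem_range.1 hl))).1.1).hasSum
  rw [logSum]
  refine (h.congr_fun fun n ↦ ?_).tsum_eq
  rw [log_one_add_pow_div_pow hN, Finset.sum_div]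
  simp only [pow_one]

/-- `logSum N` at Y^N splits into N values of `logSum 1` at the points Y exp(iθ_l). As ∑ θ_l = 0,
only ∑ θ_l² disturbs the quadratic main terms, giving Nζ(2) - π²(N²-1)/(6N) = π²/(6N). -/
theorem tendsto_logSumRest_natCast {N : ℕ} (hN : 1 ≤ N) :
    Tendsto (fun Y : ℕ ↦ logSumRest N (N * Real.log Y)) atTop
      (𝓝 (Real.pi ^ 2 / (6 * N) - N * stieltjesOne)) := by
  have hN0 : (N : ℂ) ≠ 0 := by exact_mod_cast (by lia : N ≠ 0)
  have hN1 : (1 : ℝ) ≤ N := by exact_mod_cast hN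
  have hδ : 0 < Real.pi / (N + 1 : ℝ) := by positivity
  have hδπ : Real.pi / (N + 1 : ℝ) < Real.pi := div_lt_self Real.pi_pos (by linarith)
  have h1 := (tendsto_finsetSum (Finset.range N) fun l hl ↦
    tendsto_logSumRest le_rfl tendsto_logSumRest_one hδ hδπ
      (u := fun Y : ℕ ↦ (Real.log Y : ℂ) + rootAngle N l * Complex.I) (l := atTop)
      (fun Y ↦ by rw [ofReal_add_mul_I_im]; exact abs_rootAngle_le_sub (Finset.mem_range.1 hl))
      ((Real.tendsto_log_atTop.comp tendsto_natCast_atTop_atTop).congr fun Y ↦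
        (ofReal_add_mul_I_re _ _).symm)).sub_const
    (1 / 2 * ∑ l ∈ Finset.range N, (rootAngle N l : ℂ) ^ 2)
  have h2 : ∑ l ∈ Finset.range N, (riemannZeta 2 - stieltjesOne : ℂ) -
      1 / 2 * ∑ l ∈ Finset.range N, (rootAngle N l : ℂ) ^ 2 =
      Real.pi ^ 2 / (6 * N) - N * stieltjesOne := by
    rw [sum_rootAngle_sq hN, Finset.sum_const, Finset.card_range, nsmul_eq_mul, riemannZeta_two]
    field_simp
    ring
  rw [h2] at h1
  refine h1.congr fun Y ↦ ?_
  have hs := sum_rootAngle N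
  simp only [logSumRest]
  rw [logSum_exp_mul_log hN, Finset.sum_sub_distrib, Finset.sum_sub_distrib, ← Finset.mul_sum,
    ← Finset.sum_div, Finset.sum_add_distrib, ← Finset.sum_mul, hs]
  have hsq : ∑ l ∈ Finset.range N, ((Real.log Y : ℂ) + rootAngle N l * Complex.I) ^ 2 =
      N * (Real.log Y : ℂ) ^ 2 - ∑ l ∈ Finset.range N, (rootAngle N l : ℂ) ^ 2 := by
    have : ∀ l : ℕ, ((Real.log Y : ℂ) + rootAngle N l * Complex.I) ^ 2 = (Real.log Y : ℂ) ^ 2 +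
        2 * Real.log Y * Complex.I * rootAngle N l - (rootAngle N l : ℂ) ^ 2 := by
      intro l
      linear_combination (rootAngle N l : ℂ) ^ 2 * Complex.I_sq
    simp only [this]
    rw [Finset.sum_sub_distrib, Finset.sum_add_distrib, ← Finset.mul_sum, hs, Finset.sum_const,
      Finset.card_range, nsmul_eq_mul]
    ring
  rw [hsq, Finset.sum_const, Finset.card_range, nsmul_eq_mul]
  rw [Nat.cast_one]
  generalize ∑ l ∈ Finset.range N, logSum 1 (Complex.exp (Real.log Y + rootAngle N l * Complex.I)) =
    S
  generalize ∑ l ∈ Finset.range N, (rootAngle N l : ℂ) ^ 2 = T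
  generalize (Real.log Y : ℂ) = L
  field_simp
  ring


/-! ### Expansion at zero for k = 1. -/

theorem herglotzF_one_eq {N : ℕ} (hN : 1 ≤ N) {x : ℂ} (hx : x ∈ Complex.slitPlane)
    (hs : Summable fun j : ℕ ↦ (powSum 1 N ((j + 1 : ℕ) * x⁻¹) -
      powSumMain 1 N ((j + 1 : ℕ) * x⁻¹)) / ((j + 1 : ℕ) : ℂ)) :
    herglotzF 1 N x = -(riemannZeta ((N : ℂ) + 1) / x) +
      1 / (N : ℂ) * ((Real.pi : ℂ) ^ 2 / 6 -
        ((N : ℂ) - 1) * (Real.eulerMascheroniConstant : ℂ) * Complex.log x +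
        1 / 2 * Complex.log x ^ 2 - (N : ℂ) * (Real.eulerMascheroniConstant : ℂ) ^ 2 -
        ((N : ℂ) ^ 2 + 1) * (stieltjesOne : ℂ)) +
      ∑' j : ℕ, (powSum 1 N ((j + 1 : ℕ) * x⁻¹) - powSumMain 1 N ((j + 1 : ℕ) * x⁻¹)) /
        ((j + 1 : ℕ) : ℂ) := by
  obtain ⟨δ, hδ, hδπ, hxδ⟩ := exists_mem_sector hx
  have hN0 : (N : ℂ) ≠ 0 := by exact_mod_cast (by lia : N ≠ 0)
  have hx0 := Complex.slitPlane_ne_zero hx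
  have hlog : ∀ j : ℕ, 0 < j →
      Complex.log ((j : ℂ) * x⁻¹) = Real.log j - Complex.log x := by
    intro j hj
    have := Complex.log_ofReal_mul (r := (j : ℝ)) (by exact_mod_cast hj) (inv_ne_zero hx0)
    rw [Complex.log_inv _ (Complex.mem_slitPlane_iff_arg.1 hx).1] at this
    rw [sub_eq_add_neg, ← this, Complex.ofReal_natCast]
  set E := ∑' j : ℕ, (powSum 1 N ((j + 1 : ℕ) * x⁻¹) - powSumMain 1 N ((j + 1 : ℕ) * x⁻¹)) /
        ((j + 1 : ℕ) : ℂ)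
  set g : ℂ := (Real.eulerMascheroniConstant : ℂ)
  set L := Complex.log x
  have hR : Tendsto (fun J : ℕ ↦ logSumRest N (Real.log J - L)) atTop
      (𝓝 (Real.pi ^ 2 / (6 * N) - N * stieltjesOne)) := by
    refine tendsto_logSumRest hN (tendsto_logSumRest_natCast hN) hδ hδπ (fun J ↦ ?_) ?_
    · rw [Complex.sub_im, Complex.ofReal_im, zero_sub, abs_neg, Complex.log_im]
      exact hxδ.2
    · refine (tendsto_atTop_add_const_right _ (-L.re)
        (Real.tendsto_log_atTop.comp tendsto_natCast_atTop_atTop)).congr fun J ↦ ?_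
      rw [Complex.sub_re, Complex.ofReal_re]
      rfl
  -- Four convergent pieces: the remainder of `logSum` at J/x, the sum of the `powSum` errors, and
  -- the harmonic and Stieltjes sums from the main terms -(γ + (log j - log x)/N)/j. All log J and
  -- log² J terms cancel among them.
  have hlim := ((hR.add hs.hasSum.tendsto_sum_nat).add
    (tendsto_harmonic_sub_log_complex.const_mul (L / N - g))).sub
    (tendsto_stieltjesOne_complex.const_mul (1 / (N : ℂ)))
  have hlim' := hlim.add_const (-g * L + L ^ 2 / (2 * N))
  have hD := tendsto_logSum_add_sum_powSum hN hx
  have heq := tendsto_nhds_unique hD (hlim'.congr' ?_)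
  · change herglotzF 1 N x + riemannZeta (N + 1) / x = Real.pi ^ 2 / (6 * N) - N * stieltjesOne +
      E + (L / N - g) * g - 1 / N * stieltjesOne + (-g * L + L ^ 2 / (2 * N)) at heq
    rw [eq_sub_of_add_eq heq]
    field_simp
    ring
  · filter_upwards [eventually_gt_atTop 0] with J hJ
    have hJ0 : (J : ℂ) ≠ 0 := by exact_mod_cast hJ.ne'
    have hexp : Complex.exp (Real.log J - L) = J * x⁻¹ := by
      rw [← hlog J hJ, Complex.exp_log (mul_ne_zero hJ0 (inv_ne_zero hx0))]
    have hmain : ∑ j ∈ Finset.range J, powSumMain 1 N ((j + 1 : ℕ) * x⁻¹) / ((j + 1 : ℕ) : ℂ) =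
        (L / N - g) * (harmonic J : ℚ) -
          1 / N * ∑ j ∈ Finset.range J, (Real.log (j + 1 : ℕ) : ℂ) / ((j + 1 : ℕ) : ℂ) := by
      rw [harmonic, Rat.cast_sum, Finset.mul_sum, Finset.mul_sum, ← Finset.sum_sub_distrib]
      refine Finset.sum_congr rfl fun j _ ↦ ?_
      rw [powSumMain, if_pos rfl, hlog (j + 1) j.succ_pos, Rat.cast_inv, Rat.cast_natCast]
      ring
    simp only [sub_div]
    rw [Finset.sum_sub_distrib, hmain, logSumRest, hexp]
    ring

theorem hasAsymptoticSeries_atZero_one {N : ℕ} (hN : 1 ≤ N) {δ : ℝ} (hδ : 0 < δ)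
    (hδπ : δ < Real.pi) :
    HasAsymptoticSeries (sectorAtZero δ) (herglotzF 1 N)
        (fun x ↦ -(riemannZeta ((N : ℂ) + 1) / x)
          + 1 / (N : ℂ) *
            ((Real.pi : ℂ) ^ 2 / 6
              - ((N : ℂ) - 1) * (Real.eulerMascheroniConstant : ℂ) * Complex.log x
              + 1 / 2 * Complex.log x ^ 2
              - (N : ℂ) * (Real.eulerMascheroniConstant : ℂ) ^ 2
              - ((N : ℂ) ^ 2 + 1) * (stieltjesOne : ℂ))
          + herglotzB 1 N x)
        (fun m ↦ -((-1) ^ (m * (N + 1)) *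
          riemannZeta (1 - (m : ℂ) * (N : ℂ)) * riemannZeta (1 + (m : ℂ))))
        (fun m x ↦ x ^ m) := by
  refine hasAsymptoticSeries_pow_of_one_le nhdsWithin_le_nhds fun M hM ↦ ?_
  obtain ⟨r, K, hr, h⟩ := exists_norm_tsum_powSum_le le_rfl hN hδ hδπ M
  refine IsBigO.of_bound K ?_
  rw [eventually_nhdsWithin_iff]
  filter_upwards [Metric.closedBall_mem_nhds (0 : ℂ) hr] with x hxr hx
  obtain ⟨h1, h2⟩ := h x hx (by simpa using hxr)
  rw [norm_pow]
  convert! h2 using 2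
  have hB : herglotzB 1 N x = -(if 1 = N then riemannZeta 2 * x else 0) := by
    rw [herglotzB]
    split_ifs with hkeq
    · subst hkeq
      norm_num
      ring
    · simp
  have hS := sum_neg_one_pow_mul_riemannZeta le_rfl hN hM x
  rw [pow_one] at hS
  simp only [neg_one_mul, Nat.cast_one] at hS ⊢
  rw [herglotzF_one_eq hN hx.1 h1, hB, hS]
  ring

end Herglotz

theorem theorem2p6 :
    -- behaviour at infinity, for real parameters
    (∀ k N : ℝ, 0 < k → 0 < N → 1 < k + N →
      (∀ x ∈ Complex.slitPlane, Summable fun n : ℕ ↦ Herglotz.herglotzTerm k N x (n + 1)) ∧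
      ∀ δ : ℝ, 0 < δ → δ < Real.pi →
        Herglotz.HasAsymptoticSeries (Herglotz.sectorAtInfty δ)
          (Herglotz.herglotzF k N)
          (fun x ↦ -(1 / (2 * x)) * riemannZeta ((k : ℂ) + (N : ℂ)))
          (fun n ↦ -(((bernoulli (2 * n) : ℚ) : ℂ) / (2 * (n : ℂ)) *
            riemannZeta ((k : ℂ) + 2 * (n : ℂ) * (N : ℂ))))
          (fun n x ↦ (x ^ (2 * n))⁻¹)) ∧
    -- behaviour at zero, `1 < k ≤ N`
    (∀ k N : ℕ, 1 < k → k ≤ N → ∀ δ : ℝ, 0 < δ → δ < Real.pi →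
      Herglotz.HasAsymptoticSeries (Herglotz.sectorAtZero δ)
        (Herglotz.herglotzF k N)
        (fun x ↦ -(riemannZeta ((k : ℂ) + (N : ℂ)) / x)
          - ((Real.eulerMascheroniConstant : ℂ) + Complex.log x) * riemannZeta (k : ℂ)
          + (N : ℂ) * deriv riemannZeta (k : ℂ)
          + (Real.pi : ℂ) / (N : ℂ) *
              (riemannZeta (1 + ((k : ℂ) - 1) / (N : ℂ)) /
                Complex.sin ((Real.pi : ℂ) / (N : ℂ) * ((k : ℂ) - 1))) *
              x ^ (((k : ℂ) - 1) / (N : ℂ))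
          + x ^ (((k : ℂ) - 1) / (N : ℂ)) * Herglotz.herglotzB k N x)
        (fun m ↦ (-1) ^ k * ((-1) ^ (m * (N + 1)) *
          riemannZeta ((k : ℂ) - (m : ℂ) * (N : ℂ)) * riemannZeta (1 + (m : ℂ))))
        (fun m x ↦ x ^ m)) ∧
    -- behaviour at zero, `k = 1`
    (∀ N : ℕ, 1 ≤ N → ∀ δ : ℝ, 0 < δ → δ < Real.pi →
      Herglotz.HasAsymptoticSeries (Herglotz.sectorAtZero δ)
        (Herglotz.herglotzF 1 N)
        (fun x ↦ -(riemannZeta ((N : ℂ) + 1) / x)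
          + 1 / (N : ℂ) *
            ((Real.pi : ℂ) ^ 2 / 6
              - ((N : ℂ) - 1) * (Real.eulerMascheroniConstant : ℂ) * Complex.log x
              + 1 / 2 * Complex.log x ^ 2
              - (N : ℂ) * (Real.eulerMascheroniConstant : ℂ) ^ 2
              - ((N : ℂ) ^ 2 + 1) * (Herglotz.stieltjesOne : ℂ))
          + Herglotz.herglotzB 1 N x)
        (fun m ↦ -((-1) ^ (m * (N + 1)) *
          riemannZeta (1 - (m : ℂ) * (N : ℂ)) * riemannZeta (1 + (m : ℂ))))
        (fun m x ↦ x ^ m)) := by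
  exact ⟨fun k N _ hN hkN ↦ ⟨fun x hx ↦ Herglotz.summable_herglotzTerm hN hkN hx,
      fun δ hδ hδπ ↦ Herglotz.hasAsymptoticSeries_atInfty hN hkN hδ hδπ⟩,
    fun k N hk hkN δ hδ hδπ ↦ Herglotz.hasAsymptoticSeries_atZero hk hkN hδ hδπ,
    fun N hN δ hδ hδπ ↦ Herglotz.hasAsymptoticSeries_atZero_one hN hδ hδπ⟩
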